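/- **Setting.** Let $T>0$, and let $\beta:[0,T]\to(0,\beta_{\max}]$ be continuous; put $\overline\alpha_t=\exp(-\int_0^t\beta_r\,dr)$. Let $x_{0}\in\mathbb R^d$ be the target state, $h=(x_{0,1},\dots,x_{0,s})\in(\mathbb R^d)^s$ the observed states (context), $c_1\in\mathbb R^{k_1}$ the inexpensive and $c_2\in\mathbb R^{k_2}$ the expensive simulation. Given $(h,c_1)$ the pair $(x_0,c_2)$ has a joint p.d.f. $p(x_0,c_2\mid h,c_1)$; from it one obtains $p(x_0\mid h,c_1)$, $p(c_2\mid h,c_1)$ and $p(x_0\mid h,c_1,c_2)$. For $t\in(0,T]$ let $x_t=\sqrt{\overline\alpha_t}\,x_0+\sqrt{1-\overline\alpha_t}\,z$ with $z\sim\mathcal N(0,\mathbf I)$ independent of $(x_0,c_2)$ given $(h,c_1)$ (the time-$t$ marginal of $dx_t=-\frac{\beta_t}{2}x_t\,dt+\sqrt{\beta_t}\,dw_t$), with conditional densities $p(x_t\mid h,c_1)$, $p(x_t\mid h,c_1,c_2)$ and $p(c_2\mid x_t,h,c_1)=p(x_t,c_2\mid h,c_1)/p(x_t\mid h,c_1)$.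 Let $\epsilon_\theta(x,t,h,c_1)$ (denoising network) and $g(x,t,h,c_1,c_2)$ (guidance) be $\mathbb R^d$-valued functions, jointly continuous in $(t,x)\in(0,T]\times\mathbb R^d$, and suppose that there are constants $L_\epsilon,L_g>0$ such that for all $x,y\in\mathbb R^d$, $t\in(0,T]$ and all $h,c_1,c_2$ $$|(x-y)^\top(\epsilon_\theta(x,t,h,c_1)-\epsilon_\theta(y,t,h,c_1))|\le L_\epsilon\|x-y\|^2,\qquad |(x-y)^\top(g(x,t,h,c_1,c_2)-g(y,t,h,c_1,c_2))|\le L_g\|x-y\|^2 .$$ In continuous time the sampler draws $X_T\sim\mathcal N(0,\mathbf I)$, follows, with $t$ decreasing from $T$ to $0$, a solution, continuous on $[0,T]$, of $$-\frac{dX_t}{dt}=\frac{\beta_t}{2}X_t-\frac{\beta_t}{2\sqrt{1-\overline\alpha_t}}\,\epsilon_\theta(X_t,t,h,c_1)\quad\text{(choice 1)},$$ $$-\frac{dX_t}{dt}=\frac{\beta_t}{2}X_t-\frac{\beta_t}{2\sqrt{1-\overline\alpha_t}}\,\epsilon_\theta(X_t,t,h,c_1)+\frac{\beta_t}{2}\,g(X_t,t,h,c_1,c_2)\quad\text{(choice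 2)},$$ and returns $X_0$; let $q^{\mathrm{ch}\,1}_\theta$, $q^{\mathrm{ch}\,2}_\theta$ be the law of $X_0$. For a law $\rho$ of $x_0$ set $$\mathcal L_1(\rho)=\frac12\int_0^T\beta_t\,\mathbb E_{x_0\sim\rho}\Big\|\frac{\epsilon_\theta(x_t,t,h,c_1)}{\sqrt{1-\overline\alpha_t}}+\nabla_{x_t}\log p(x_t\mid h,c_1)\Big\|^2dt,$$ $$\mathcal L_2(\rho)=\frac12\int_0^T\beta_t\,\mathbb E_{x_0\sim\rho}\big\|g(x_t,t,h,c_1,c_2)-\nabla_{x_t}\log p(c_2\mid x_t,h,c_1)\big\|^2dt,$$ with values in $[0,\infty]$, and let $W_2$ be the 2-Wasserstein distance. **Theorem.** (1) There is a constant $C$, depending only on $T,\beta_{\max},L_\epsilon$, such that for all $(h,c_1)$ for which $\rho_1=p(x_0\mid h,c_1)$ has a finite second moment, $$W_2\big(p(x_0\mid h,c_1),\,q^{\mathrm{ch}\,1}_\theta\big)\le C\Big(\sqrt{\mathcal L_1(\rho_1)}+W_2\big(p(x_T\mid h,c_1),\mathcal N(0,\mathbf I)\big)\Big).$$ (The conditions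 on $g$ are not used here.) (2) There is a constant $C$, depending only on $T,\beta_{\max},L_\epsilon,L_g$, such that for all $(h,c_1,c_2)$ with $0<p(c_2\mid h,c_1)<\infty$ for which $\rho_2=p(x_0\mid h,c_1,c_2)$ has a finite second moment, $$W_2\big(p(x_0\mid h,c_1,c_2),\,q^{\mathrm{ch}\,2}_\theta\big)\le C\Big(\sqrt{\mathcal L_1(\rho_2)+\mathcal L_2(\rho_2)}+W_2\big(p(x_T\mid h,c_1,c_2),\mathcal N(0,\mathbf I)\big)\Big).$$ -/

import Mathlib

open MeasureTheory ProbabilityTheory Set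
open scoped ENNReal NNReal

noncomputable section

/-- Vectors `ℝⁿ` with the Euclidean norm. -/
abbrev Vec (n : ℕ) : Type := EuclideanSpace ℝ (Fin n)

/-- The histories `x_{0,1:s} = (x_{0,1}, …, x_{0,s})`, a list of `s` states in `ℝᵈ`. -/
abbrev History (s d : ℕ) : Type := Fin s → Vec d

/-! ### Wasserstein distance -/

/-- `π` is a coupling of `μ` and `ν`: a joint law with these marginals. -/
def IsCoupling {d : ℕ} (π : Measure (Vec d × Vec d)) (μ ν : Measure (Vec d)) : Prop :=
  π.map Prod.fst = μ ∧ π.map Prod.snd = ν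

/-- The 2-Wasserstein distance `(inf_π ∫ ‖x - y‖² dπ(x, y)) ^ (1/2)`, with values in `[0, ∞]`. -/
def W2 {d : ℕ} (μ ν : Measure (Vec d)) : ℝ≥0∞ :=
  (⨅ (π : Measure (Vec d × Vec d)) (_ : IsCoupling π μ ν),
    ∫⁻ z, ‖z.1 - z.2‖ₑ ^ 2 ∂π) ^ (1 / 2 : ℝ)

/-! ### The forward (variance preserving) diffusion -/

/-- A noise schedule on `[0, T]`: continuous, positive and at most `βmax`. -/
structure IsSchedule (T βmax : ℝ) (β : ℝ → ℝ) : Prop where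
  continuousOn : ContinuousOn β (Icc 0 T)
  pos : ∀ t ∈ Icc 0 T, 0 < β t
  le : ∀ t ∈ Icc 0 T, β t ≤ βmax

/-- Signal level in continuous time: `ᾱ_t = exp (-∫₀ᵗ β_r dr)`. -/
def alphaBar (β : ℝ → ℝ) (t : ℝ) : ℝ := Real.exp (-∫ r in (0 : ℝ)..t, β r)

/-- The measure with p.d.f. `f` with respect to Lebesgue measure. -/
def pdfLaw {d : ℕ} (f : Vec d → ℝ) : Measure (Vec d) :=
  volume.withDensity fun x => ENNReal.ofReal (f x)

/-- The law of `√a x₀ + √(1 - a) z`, where `x₀` has p.d.f. `f` and `z ∼ N(0, I)` is independent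
of `x₀`. With `a = ᾱ_t` this is the time `t` marginal of `dx = -(β/2) x dt + √β dw` started at
`x₀`. -/
def noisyLaw {d : ℕ} (a : ℝ) (f : Vec d → ℝ) : Measure (Vec d) :=
  ((pdfLaw f).prod (stdGaussian (Vec d))).map fun w => √a • w.1 + √(1 - a) • w.2

/-- The p.d.f. at `x` of `N(√a x₀, (1 - a) I)`, for `a < 1`. -/
def noiseKernel {d : ℕ} (a : ℝ) (x x₀ : Vec d) : ℝ :=
  (√(2 * Real.pi * (1 - a)))⁻¹ ^ d * Real.exp (-‖x - √a • x₀‖ ^ 2 / (2 * (1 - a)))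

/-- The p.d.f. at `x` of `√a x₀ + √(1 - a) z` (for `a < 1`), where `x₀` has density `f`. -/
def noisyPdf {d : ℕ} (a : ℝ) (f : Vec d → ℝ) (x : Vec d) : ℝ :=
  ∫ x₀, noiseKernel a x x₀ * f x₀

/-! ### The statistical model -/

/-- For each history `h` and each inexpensive simulation `c₁`, the joint p.d.f.
`p(x₀, c₂ | h, c₁)` of the target state `x₀` and the expensive simulation `c₂`. -/
structure DataModel (d s k₁ k₂ : ℕ) where
  joint : History s d → Vec k₁ → Vec d → Vec k₂ → ℝ
  nonneg : ∀ h c₁ x₀ c₂, 0 ≤ joint h c₁ x₀ c₂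
  measurable : ∀ h c₁, Measurable fun w : Vec d × Vec k₂ => joint h c₁ w.1 w.2
  mass : ∀ h c₁, ∫⁻ w : Vec d × Vec k₂, ENNReal.ofReal (joint h c₁ w.1 w.2) = 1

namespace DataModel

variable {d s k₁ k₂ : ℕ} (M : DataModel d s k₁ k₂) (h : History s d) (c₁ : Vec k₁) (c₂ : Vec k₂)

/-- `p(x₀ | h, c₁)`. -/
def cond1 (x₀ : Vec d) : ℝ := ∫ c₂, M.joint h c₁ x₀ c₂

/-- `p(c₂ | h, c₁)`. -/
def evidence : ℝ := ∫ x₀, M.joint h c₁ x₀ c₂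

/-- `p(x₀ | h, c₁, c₂)`. -/
def cond2 (x₀ : Vec d) : ℝ := M.joint h c₁ x₀ c₂ / M.evidence h c₁ c₂

/-- `p(c₂ | x_t, h, c₁) = p(x_t, c₂ | h, c₁) / p(x_t | h, c₁)` at signal level `a = ᾱ_t`; the
noise in `x_t` is independent of `(x₀, c₂)`. -/
def likelihood (a : ℝ) (x : Vec d) : ℝ :=
  noisyPdf a (fun x₀ => M.joint h c₁ x₀ c₂) x / noisyPdf a (M.cond1 h c₁) x

/-- The score `∇ log p(x_t | h, c₁)` at signal level `a = ᾱ_t`. -/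
def score (a : ℝ) (x : Vec d) : Vec d :=
  gradient (fun y => Real.log (noisyPdf a (M.cond1 h c₁) y)) x

/-- The guidance target `∇ log p(c₂ | x_t, h, c₁)`, gradient in `x_t`, at level `a = ᾱ_t`. -/
def guidance (a : ℝ) (x : Vec d) : Vec d :=
  gradient (fun y => Real.log (M.likelihood h c₁ c₂ a y)) x

/-- `𝓛₁ = ½ ∫₀ᵀ β_t E ‖ε(x_t, t) / √(1 - ᾱ_t) + ∇ log p(x_t | h, c₁)‖² dt`, where `x_t` is the
noised version of an `x₀` with p.d.f. `f`. -/
def errorScore (T : ℝ) (β : ℝ → ℝ) (ε : ℝ → Vec d → Vec d) (f : Vec d → ℝ) : ℝ≥0∞ :=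
  (1 / 2) * ∫⁻ t in Ioc 0 T, ENNReal.ofReal (β t) *
    ∫⁻ x, ‖(√(1 - alphaBar β t))⁻¹ • ε t x + M.score h c₁ (alphaBar β t) x‖ₑ ^ 2
      ∂(noisyLaw (alphaBar β t) f)

/-- `𝓛₂ = ½ ∫₀ᵀ β_t E ‖g(x_t, t) - ∇ log p(c₂ | x_t, h, c₁)‖² dt`, where `x_t` is the noised
version of an `x₀` with p.d.f. `f`. -/
def errorGuidance (T : ℝ) (β : ℝ → ℝ) (g : ℝ → Vec d → Vec d) (f : Vec d → ℝ) : ℝ≥0∞ :=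
  (1 / 2) * ∫⁻ t in Ioc 0 T, ENNReal.ofReal (β t) *
    ∫⁻ x, ‖g t x - M.guidance h c₁ c₂ (alphaBar β t) x‖ₑ ^ 2 ∂(noisyLaw (alphaBar β t) f)

end DataModel

/-! ### The samplers in continuous time -/

/-- Reverse-time drift of choice 1: `(β_t/2) x - β_t / (2 √(1 - ᾱ_t)) ε(x, t)`. -/
def drift1 {d : ℕ} (β : ℝ → ℝ) (ε : ℝ → Vec d → Vec d) (t : ℝ) (x : Vec d) : Vec d :=
  (β t / 2) • x - (β t / (2 * √(1 - alphaBar β t))) • ε t x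

/-- Reverse-time drift of choice 2: `(β_t/2) x - β_t / (2 √(1 - ᾱ_t)) ε(x, t) + (β_t/2) g(x, t)`. -/
def drift2 {d : ℕ} (β : ℝ → ℝ) (ε g : ℝ → Vec d → Vec d) (t : ℝ) (x : Vec d) : Vec d :=
  drift1 β ε t x + (β t / 2) • g t x

/-- `X` is a run of the continuous-time sampler with reverse-time drift `v`: `X_T ∼ N(0, I)`, and
`t` decreases from `T` to `0` along `dx = v dτ` with `τ = T - t`, that is `dx/dt = -v(x, t)`.
The sample is `X_0`. -/
structure IsSampler {d : ℕ} {Ω : Type*} [MeasurableSpace Ω] (P : Measure Ω) (T : ℝ)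
    (v : ℝ → Vec d → Vec d) (X : ℝ → Ω → Vec d) : Prop where
  aemeasurable : ∀ t ∈ Icc 0 T, AEMeasurable (X t) P
  init : P.map (X T) = stdGaussian (Vec d)
  continuousOn : ∀ᵐ ω ∂P, ContinuousOn (fun t => X t ω) (Icc 0 T)
  ode : ∀ᵐ ω ∂P, ∀ t ∈ Ioo 0 T, HasDerivAt (fun r => X r ω) (-v t (X t ω)) t

/-- Regularity of a time-dependent field on `(0, T]`: it is jointly continuous, and
`|(x - y)ᵀ (u(x, t) - u(y, t))| ≤ L ‖x - y‖²`. -/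
structure IsRegularField {d : ℕ} (T L : ℝ) (u : ℝ → Vec d → Vec d) : Prop where
  continuousOn : ContinuousOn (fun z : ℝ × Vec d => u z.1 z.2) (Ioc 0 T ×ˢ univ)
  lip : ∀ t ∈ Ioc 0 T, ∀ x y, |inner ℝ (x - y) (u t x - u t y)| ≤ L * ‖x - y‖ ^ 2

/-- The p.d.f. `f` has a finite second moment. -/
def HasSecondMoment {d : ℕ} (f : Vec d → ℝ) : Prop := ∫⁻ x, ‖x‖ₑ ^ 2 ∂(pdfLaw f) < ∞

end

open Filter Topology

/-! ### The Gaussian kernel -/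

/-! Both samplers solve dX/dt = -(β/2)(X + b(t, X)), where b is -ε/√(1-ᾱ) for choice 1 and that
field plus g for choice 2. With b replaced by the score ∇ log p_t, the same equation is the
probability flow, which carries the law of x_T to the law of x₀. The theorem therefore compares two
flows with nearby fields: couple x_T with X_T, run both flows down to time 0, and bound the distance
they reach.

The probability flow has to be constructed, for a density of x₀ without any regularity. In the
variables y = x/√ᾱ and σ = √(1-ᾱ)/√ᾱ the noised state is x₀ + σz, and Tweedie's formula
(`hasGradientAt_log_noisyPdf`) turns the flow into dy/dσ = E[z | x₀ + σz = y], the field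
`heatField`. On compact subsets of σ > 0 it is locally Lipschitz in y with linear growth
(`exists_lipschitzOnWith_heatField`, `exists_norm_heatField_le`), so flows of truncated fields
stabilize to a flow on (0, S]. That this flow transports the laws is checked on test functions: the
r-derivative of E w(Φ_r(x₀ + rz)), where Φ_r flows from time r to a fixed time, is the mean of a
linear form in z - v, and it vanishes because v is the conditional mean of z
(`integral_apply_heatField`, `hasDerivAt_integral_flow`). By Jensen the mean speed is at most E‖z‖
for every σ, so almost every trajectory has finite length and a limit at σ = 0, and the limit has
the law of x₀ (`exists_limit_flow_heatLaw`).

The comparison is a backward Grönwall argument (`norm_sub_le_of_inner_deriv_ge`). The one-sided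
conditions on ε and g give the expansion rate (β/2)(1 + Lg + Lε/√(1-ᾱ)); it is singular at t = 0 but
has the explicit primitive `expansionRate`, bounded by the permitted constants alone. The forcing is
the field error along the probability flow, whose law at time t is that of x_t, so Cauchy–Schwarz in
time yields the error functional. The same estimate applied to two sampler paths shows that X_0 is
almost surely a continuous function Ψ of X_T (`IsSampler.exists_continuous_map`). Any coupling at
time T can then be pushed forward to a coupling at time 0, which gives `IsSampler.W2_le`. For choice
2, Bayes' rule writes the target score as the sum of the unguided score and the guidance target, so
the field error splits into the two error terms. -/

/-- The density of `N(0, σ² I)`. -/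
noncomputable def gaussKer {d : ℕ} (σ : ℝ) (u : Vec d) : ℝ :=
  (√(2 * Real.pi) * σ)⁻¹ ^ d * Real.exp (-‖u‖ ^ 2 / (2 * σ ^ 2))

theorem gaussKer_pos {d : ℕ} {σ : ℝ} (hσ : 0 < σ) (u : Vec d) : 0 < gaussKer σ u := by
  unfold gaussKer
  positivity

theorem continuous_gaussKer {d : ℕ} (σ : ℝ) : Continuous (gaussKer σ : Vec d → ℝ) := by
  unfold gaussKer
  fun_prop

theorem integrable_gaussKer {d : ℕ} {σ : ℝ} (hσ : 0 < σ) :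
    Integrable (gaussKer σ : Vec d → ℝ) := by
  have h := GaussianFourier.integrable_cexp_neg_mul_sq_norm_add (V := Vec d)
    (b := ((1 / (2 * σ ^ 2) : ℝ) : ℂ)) (by rw [Complex.ofReal_re]; positivity) 0 0
  have h2 := h.re.const_mul ((√(2 * Real.pi) * σ)⁻¹ ^ d)
  refine h2.congr (Eventually.of_forall fun u => ?_)
  simp only [gaussKer, zero_mul, add_zero]
  congr 1
  have : (-((1 / (2 * σ ^ 2) : ℝ) : ℂ) * (‖u‖ : ℂ) ^ 2) = ((-‖u‖ ^ 2 / (2 * σ ^ 2) : ℝ) : ℂ) := by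
    push_cast; ring
  rw [this, ← Complex.ofReal_exp]
  exact Complex.ofReal_re _

theorem charFun_gaussKer {d : ℕ} {σ : ℝ} (hσ : 0 < σ) (t : Vec d) :
    charFun (volume.withDensity fun u : Vec d => ENNReal.ofReal (gaussKer σ u)) t =
      Complex.exp (-(σ ^ 2 * ‖t‖ ^ 2) / 2) := by
  rw [charFun_apply, integral_withDensity_eq_integral_toReal_smul
    (by exact (continuous_gaussKer σ).measurable.ennreal_ofReal) (by simp)]
  have hb : 0 < (((1 / (2 * σ ^ 2) : ℝ) : ℂ)).re := by
    rw [Complex.ofReal_re]; positivity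
  have h := GaussianFourier.integral_cexp_neg_mul_sq_norm_add (V := Vec d) hb Complex.I t
  have h1 : ∀ u : Vec d, (ENNReal.ofReal (gaussKer σ u)).toReal •
      Complex.exp ((inner ℝ u t : ℝ) * Complex.I) = (((√(2 * Real.pi) * σ)⁻¹ ^ d : ℝ) : ℂ) *
      Complex.exp (-((1 / (2 * σ ^ 2) : ℝ) : ℂ) * (‖u‖ : ℂ) ^ 2 +
        Complex.I * (inner ℝ t u : ℝ)) := by
    intro u
    rw [ENNReal.toReal_ofReal (gaussKer_pos hσ u).le, Complex.exp_add, gaussKer,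
      Complex.real_smul, Complex.ofReal_mul, Complex.ofReal_exp, real_inner_comm, mul_assoc,
      mul_comm Complex.I]
    congr 3
    push_cast; ring
  simp_rw [h1]
  rw [integral_const_mul, h, ← mul_assoc]
  have h2 : (((√(2 * Real.pi) * σ)⁻¹ ^ d : ℝ) : ℂ) *
      ((Real.pi : ℂ) / ((1 / (2 * σ ^ 2) : ℝ) : ℂ)) ^ ((Module.finrank ℝ (Vec d) : ℂ) / 2) = 1 := by
    rw [← Complex.ofReal_div]
    have : ((Module.finrank ℝ (Vec d) : ℂ) / 2) = ((d / 2 : ℝ) : ℂ) := by simp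
    rw [this, ← Complex.ofReal_cpow (by positivity), ← Complex.ofReal_mul]
    norm_cast
    have e : Real.pi / (1 / (2 * σ ^ 2)) = (√(2 * Real.pi) * σ) ^ (2 : ℝ) := by
      rw [Real.rpow_two, mul_pow, Real.sq_sqrt (by positivity)]
      field_simp
    rw [e, ← Real.rpow_mul (by positivity), mul_div_cancel₀ _ (by norm_num), Real.rpow_natCast,
      ← mul_pow, inv_mul_cancel₀ (by positivity), one_pow]
  rw [h2, one_mul]
  congr 1
  push_cast
  rw [Complex.I_sq]
  have : (σ : ℂ) ≠ 0 := by exact_mod_cast hσ.ne'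
  field_simp
  ring

theorem isFiniteMeasure_gaussKer {d : ℕ} {σ : ℝ} (hσ : 0 < σ) :
    IsFiniteMeasure (volume.withDensity fun u : Vec d => ENNReal.ofReal (gaussKer σ u)) :=
  isFiniteMeasure_withDensity_ofReal (integrable_gaussKer hσ).2

/-- The two finite measures have the same characteristic function; this also yields the
normalization of `gaussKer`. -/
theorem map_smul_stdGaussian {d : ℕ} {σ : ℝ} (hσ : 0 < σ) :
    (stdGaussian (Vec d)).map (fun z => σ • z) =
      volume.withDensity fun u : Vec d => ENNReal.ofReal (gaussKer σ u) := by
  have := isFiniteMeasure_gaussKer (d := d) hσ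
  have : IsProbabilityMeasure ((stdGaussian (Vec d)).map (fun z => σ • z)) :=
    Measure.isProbabilityMeasure_map (by fun_prop)
  refine Measure.ext_of_charFun ?_
  ext t
  rw [charFun_gaussKer hσ, charFun_map_smul, charFun_stdGaussian, norm_smul]
  congr 1
  push_cast
  rw [mul_pow, ← Complex.ofReal_pow, ← Complex.ofReal_pow σ]
  simp [sq_abs]

theorem lintegral_add_smul_stdGaussian {d : ℕ} {σ : ℝ} (hσ : 0 < σ) (x : Vec d)
    {F : Vec d → ℝ≥0∞} (hF : Measurable F) :
    ∫⁻ z, F (x + σ • z) ∂(stdGaussian (Vec d)) =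
      ∫⁻ y, ENNReal.ofReal (gaussKer σ (y - x)) * F y := by
  have h1 : ∫⁻ z, F (x + σ • z) ∂(stdGaussian (Vec d)) =
      ∫⁻ u, F (x + u) ∂((stdGaussian (Vec d)).map (fun z => σ • z)) := by
    rw [lintegral_map (by fun_prop) (by fun_prop)]
  rw [h1, map_smul_stdGaussian hσ, lintegral_withDensity_eq_lintegral_mul _
    (by exact (continuous_gaussKer σ).measurable.ennreal_ofReal) (by fun_prop),
    ← lintegral_add_right_eq_self (fun y => ENNReal.ofReal (gaussKer σ (y - x)) * F y) x]
  simp [add_comm]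

/-- The density is positive everywhere. This makes the almost sure starting points of the sampler
dense. -/
instance isOpenPosMeasure_stdGaussian {d : ℕ} : (stdGaussian (Vec d)).IsOpenPosMeasure := by
  have h := map_smul_stdGaussian (d := d) one_pos
  simp only [one_smul, Measure.map_id'] at h
  have hac : (volume : Measure (Vec d)) ≪ stdGaussian (Vec d) := by
    rw [h]
    refine withDensity_absolutelyContinuous' (by
      exact (continuous_gaussKer 1).measurable.ennreal_ofReal.aemeasurable) ?_
    exact Eventually.of_forall fun u => by simpa using gaussKer_pos one_pos u
  exact hac.isOpenPosMeasure

theorem ae_add_smul_stdGaussian {d : ℕ} {σ : ℝ} (hσ : 0 < σ) (x : Vec d)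
    {p : Vec d → Prop} (hp : ∀ᵐ y, p y) : ∀ᵐ z ∂(stdGaussian (Vec d)), p (x + σ • z) := by
  obtain ⟨s, hs, hm, h0⟩ := exists_measurable_superset_of_null (show volume {y | ¬ p y} = 0 from hp)
  have h := lintegral_add_smul_stdGaussian hσ x (F := s.indicator 1) (measurable_one.indicator hm)
  have h2 : ∫⁻ y, ENNReal.ofReal (gaussKer σ (y - x)) * s.indicator 1 y = 0 := by
    rw [lintegral_eq_zero_iff']
    · have : ∀ᵐ y, y ∉ s := measure_eq_zero_iff_ae_notMem.1 h0
      filter_upwards [this] with y hy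
      simp [hy]
    · have := (continuous_gaussKer (d := d) σ).measurable
      exact ((this.comp (measurable_id.sub_const x)).ennreal_ofReal.mul
        (measurable_one.indicator hm)).aemeasurable
  rw [h2, lintegral_eq_zero_iff (by
    exact (measurable_one.indicator hm).comp (by fun_prop))] at h
  filter_upwards [h] with z hz
  by_contra hn
  have : x + σ • z ∈ s := hs hn
  simp [this] at hz

/-! ### Gaussian smoothing of a probability measure -/

/-- With q = r/σ, one has q ≤ 1 + q²/2 ≤ exp(q²/2). -/
theorem exp_neg_sq_mul_le {σ r : ℝ} (hσ : 0 < σ) :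
    Real.exp (-r ^ 2 / (2 * σ ^ 2)) * r ≤ σ := by
  have h1 : r / σ ≤ Real.exp (r ^ 2 / (2 * σ ^ 2)) := by
    have h := Real.add_one_le_exp (r ^ 2 / (2 * σ ^ 2))
    have h2 : r ^ 2 / (2 * σ ^ 2) = (r / σ) ^ 2 / 2 := by field_simp
    rw [h2] at h ⊢
    nlinarith [sq_nonneg (r / σ - 1)]
  rw [div_le_iff₀ hσ] at h1
  calc Real.exp (-r ^ 2 / (2 * σ ^ 2)) * r
      ≤ Real.exp (-r ^ 2 / (2 * σ ^ 2)) * (Real.exp (r ^ 2 / (2 * σ ^ 2)) * σ) := by gcongr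
    _ = σ := by rw [← mul_assoc, ← Real.exp_add, neg_div, neg_add_cancel, Real.exp_zero, one_mul]

/-- The normalized Gaussian kernel `exp (-‖u‖² / (2 σ²))`. -/
noncomputable def heatExp {d : ℕ} (σ : ℝ) (u : Vec d) : ℝ := Real.exp (-‖u‖ ^ 2 / (2 * σ ^ 2))

section
variable {d : ℕ}

theorem heatExp_pos (σ : ℝ) (u : Vec d) : 0 < heatExp σ u := Real.exp_pos _

theorem heatExp_le_one (σ : ℝ) (u : Vec d) : heatExp σ u ≤ 1 := by
  rw [heatExp, Real.exp_le_one_iff, neg_div, neg_nonpos]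
  positivity

theorem norm_heatExp_smul_le {σ : ℝ} (hσ : 0 < σ) (u : Vec d) : ‖heatExp σ u • u‖ ≤ σ := by
  rw [norm_smul, Real.norm_of_nonneg (heatExp_pos σ u).le]
  exact exp_neg_sq_mul_le hσ

theorem continuous_heatExp (σ : ℝ) : Continuous (heatExp σ : Vec d → ℝ) := by
  unfold heatExp
  fun_prop

theorem continuousAt_heatExp {σ : ℝ} (hσ : 0 < σ) (u : Vec d) :
    ContinuousAt (fun p : ℝ × Vec d => heatExp p.1 p.2) (σ, u) := by
  unfold heatExp
  refine Real.continuous_exp.continuousAt.comp (ContinuousAt.div (by fun_prop) (by fun_prop) ?_)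
  positivity

theorem hasFDerivAt_heatExp (σ : ℝ) (u : Vec d) :
    HasFDerivAt (heatExp σ) (-(heatExp σ u / σ ^ 2) • innerSL ℝ u) u := by
  have h := ((hasStrictFDerivAt_norm_sq u).hasFDerivAt.neg.mul_const (1 / (2 * σ ^ 2))).exp
  have e : (heatExp σ : Vec d → ℝ) = fun u => Real.exp (-‖u‖ ^ 2 * (1 / (2 * σ ^ 2))) := by
    ext u; rw [heatExp, mul_one_div]
  rw [e]
  refine h.congr_fderiv ?_
  ext w
  by_cases hσ : σ = 0
  · simp [hσ]
  · simp
    field_simp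

theorem norm_fderiv_heatExp_le {σ : ℝ} (hσ : 0 < σ) (u : Vec d) :
    ‖-(heatExp σ u / σ ^ 2) • innerSL ℝ u‖ ≤ 1 / σ := by
  rw [norm_smul, innerSL_apply_norm, norm_neg, Real.norm_of_nonneg (by
    have := heatExp_pos σ u; positivity)]
  have h : heatExp σ u * ‖u‖ ≤ σ := exp_neg_sq_mul_le hσ
  calc heatExp σ u / σ ^ 2 * ‖u‖ = heatExp σ u * ‖u‖ / σ ^ 2 := by ring
    _ ≤ σ / σ ^ 2 := by gcongr
    _ = 1 / σ := by field_simp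

theorem abs_heatExp_sub_le {σ : ℝ} (hσ : 0 < σ) (u v : Vec d) :
    |heatExp σ u - heatExp σ v| ≤ 1 / σ * ‖u - v‖ :=
  convex_univ.norm_image_sub_le_of_norm_hasFDerivWithin_le (𝕜 := ℝ)
    (fun w _ => (hasFDerivAt_heatExp σ w).hasFDerivWithinAt)
    (fun w _ => norm_fderiv_heatExp_le hσ w) (mem_univ v) (mem_univ u)

/-- With s = ‖w‖²/(2σ²), the derivative at w has norm at most e^{-s}(1 + 2s), and e^s ≥ 1 + s bounds
this by 2, uniformly in σ. -/
theorem norm_heatExp_smul_sub_le {σ : ℝ} (hσ : 0 < σ) (u v : Vec d) :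
    ‖heatExp σ u • u - heatExp σ v • v‖ ≤ 2 * ‖u - v‖ := by
  refine convex_univ.norm_image_sub_le_of_norm_hasFDerivWithin_le (𝕜 := ℝ)
    (fun w _ => ((hasFDerivAt_heatExp σ w).smul (hasFDerivAt_id w)).hasFDerivWithinAt)
    (fun w _ => ?_) (mem_univ v) (mem_univ u)
  have h1 : 0 < heatExp σ w := heatExp_pos σ w
  refine ContinuousLinearMap.opNorm_le_bound _ (by norm_num) fun z => ?_
  simp only [id, add_apply, smul_apply,
    ContinuousLinearMap.smulRight_apply, ContinuousLinearMap.id_apply, innerSL_apply_apply]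
  have h2 : heatExp σ w * (1 + ‖w‖ ^ 2 / σ ^ 2) ≤ 2 := by
    have h := Real.add_one_le_exp (‖w‖ ^ 2 / (2 * σ ^ 2))
    have h3 : heatExp σ w * Real.exp (‖w‖ ^ 2 / (2 * σ ^ 2)) = 1 := by
      rw [heatExp, ← Real.exp_add, neg_div, neg_add_cancel, Real.exp_zero]
    have h4 : ‖w‖ ^ 2 / σ ^ 2 = 2 * (‖w‖ ^ 2 / (2 * σ ^ 2)) := by field_simp
    rw [h4]
    nlinarith
  calc ‖heatExp σ w • z + (-(heatExp σ w / σ ^ 2) • inner ℝ w z) • w‖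
      ≤ ‖heatExp σ w • z‖ + ‖(-(heatExp σ w / σ ^ 2) • inner ℝ w z) • w‖ := norm_add_le _ _
    _ ≤ heatExp σ w * ‖z‖ + (heatExp σ w / σ ^ 2 * (‖w‖ * ‖z‖)) * ‖w‖ := by
        rw [norm_smul, norm_smul, norm_smul, norm_neg, Real.norm_of_nonneg h1.le,
          Real.norm_of_nonneg (by positivity)]
        gcongr
        exact norm_inner_le_norm w z
    _ = heatExp σ w * (1 + ‖w‖ ^ 2 / σ ^ 2) * ‖z‖ := by field_simp
    _ ≤ 2 * ‖z‖ := by gcongr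

/-- Up to normalization, the density of `x₀ + σ z` where `x₀ ∼ μ` and `z ∼ N(0, I)`. -/
noncomputable def heatDens (μ : Measure (Vec d)) (σ : ℝ) (y : Vec d) : ℝ :=
  ∫ x, heatExp σ (y - x) ∂μ

/-- The unnormalized conditional mean of `σ z` given `x₀ + σ z = y`. -/
noncomputable def heatMoment (μ : Measure (Vec d)) (σ : ℝ) (y : Vec d) : Vec d :=
  ∫ x, heatExp σ (y - x) • (y - x) ∂μ

/-- The conditional mean of `z` given `x₀ + σ z = y`, where `x₀ ∼ μ` and `z ∼ N(0, I)`. -/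
noncomputable def heatField (μ : Measure (Vec d)) (σ : ℝ) (y : Vec d) : Vec d :=
  (σ * heatDens μ σ y)⁻¹ • heatMoment μ σ y

/-- The law of `x₀ + σ z` where `x₀ ∼ μ` and `z ∼ N(0, I)`. -/
noncomputable def heatLaw (μ : Measure (Vec d)) (σ : ℝ) : Measure (Vec d) :=
  (μ.prod (stdGaussian (Vec d))).map fun w => w.1 + σ • w.2

variable (μ : Measure (Vec d)) [IsProbabilityMeasure μ]

theorem integrable_heatExp (σ : ℝ) (y : Vec d) : Integrable (fun x => heatExp σ (y - x)) μ := by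
  refine Integrable.of_bound (C := 1) ?_ (Eventually.of_forall fun x => ?_)
  · exact ((continuous_heatExp σ).comp (by fun_prop)).aestronglyMeasurable
  · rw [Real.norm_of_nonneg (heatExp_pos _ _).le]
    exact heatExp_le_one _ _

theorem integrable_heatExp_smul {σ : ℝ} (hσ : 0 < σ) (y : Vec d) :
    Integrable (fun x => heatExp σ (y - x) • (y - x)) μ := by
  refine Integrable.of_bound (C := σ) ?_ (Eventually.of_forall fun x =>
    norm_heatExp_smul_le hσ _)
  exact (((continuous_heatExp σ).comp (by fun_prop : Continuous fun x => y - x)).smul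
    (by fun_prop)).aestronglyMeasurable

theorem heatDens_pos (σ : ℝ) (y : Vec d) : 0 < heatDens μ σ y := by
  refine (integral_pos_iff_support_of_nonneg (fun x => (heatExp_pos _ _).le)
    (integrable_heatExp μ σ y)).2 ?_
  have : Function.support (fun x => heatExp σ (y - x)) = univ := by
    ext x; simp [(heatExp_pos σ (y - x)).ne']
  rw [this]
  simp

theorem abs_heatDens_sub_le {σ : ℝ} (hσ : 0 < σ) (y y' : Vec d) :
    |heatDens μ σ y - heatDens μ σ y'| ≤ 1 / σ * ‖y - y'‖ := by
  rw [heatDens, heatDens, ← integral_sub (integrable_heatExp μ σ y) (integrable_heatExp μ σ y'),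
    ← Real.norm_eq_abs]
  refine (norm_integral_le_of_norm_le_const (μ := μ) (C := 1 / σ * ‖y - y'‖)
    (Eventually.of_forall fun x => ?_)).trans (by simp)
  simpa using abs_heatExp_sub_le hσ (y - x) (y' - x)

theorem norm_heatMoment_sub_le {σ : ℝ} (hσ : 0 < σ) (y y' : Vec d) :
    ‖heatMoment μ σ y - heatMoment μ σ y'‖ ≤ 2 * ‖y - y'‖ := by
  rw [heatMoment, heatMoment,
    ← integral_sub (integrable_heatExp_smul μ hσ y) (integrable_heatExp_smul μ hσ y')]
  refine (norm_integral_le_of_norm_le_const (μ := μ) (C := 2 * ‖y - y'‖)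
    (Eventually.of_forall fun x => ?_)).trans (by simp)
  simpa using norm_heatExp_smul_sub_le hσ (y - x) (y' - x)

theorem norm_heatMoment_le {σ : ℝ} (hσ : 0 < σ) (y : Vec d) : ‖heatMoment μ σ y‖ ≤ σ :=
  (norm_integral_le_of_norm_le_const (μ := μ) (C := σ)
    (Eventually.of_forall fun x => norm_heatExp_smul_le hσ _)).trans (by simp)

theorem continuousAt_heatDens {σ : ℝ} (hσ : 0 < σ) (y : Vec d) :
    ContinuousAt (fun p : ℝ × Vec d => heatDens μ p.1 p.2) (σ, y) := by
  refine continuousAt_of_dominated (bound := fun _ => 1) (Eventually.of_forall fun p => ?_)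
    (Eventually.of_forall fun p => Eventually.of_forall fun x => ?_) (integrable_const _)
    (Eventually.of_forall fun x => ?_)
  · exact (integrable_heatExp μ p.1 p.2).aestronglyMeasurable
  · rw [Real.norm_of_nonneg (heatExp_pos _ _).le]
    exact heatExp_le_one _ _
  · exact ContinuousAt.comp' (f := fun p : ℝ × Vec d => (p.1, p.2 - x))
      (g := fun p : ℝ × Vec d => heatExp p.1 p.2) (continuousAt_heatExp hσ _) (by fun_prop)

theorem continuousAt_heatMoment {σ : ℝ} (hσ : 0 < σ) (y : Vec d) :
    ContinuousAt (fun p : ℝ × Vec d => heatMoment μ p.1 p.2) (σ, y) := by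
  have hev : ∀ᶠ p : ℝ × Vec d in 𝓝 (σ, y), 0 < p.1 ∧ p.1 < σ + 1 :=
    (continuous_fst.continuousAt (x := (σ, y))).eventually (Ioo_mem_nhds hσ (lt_add_one σ))
  refine continuousAt_of_dominated (bound := fun _ => σ + 1) ?_ ?_ (integrable_const _)
    (Eventually.of_forall fun x => ?_)
  · filter_upwards [hev] with p hp
    exact (integrable_heatExp_smul μ hp.1 p.2).aestronglyMeasurable
  · filter_upwards [hev] with p hp
    exact Eventually.of_forall fun x => (norm_heatExp_smul_le hp.1 _).trans hp.2.le
  · exact (ContinuousAt.comp' (f := fun p : ℝ × Vec d => (p.1, p.2 - x))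
      (g := fun p : ℝ × Vec d => heatExp p.1 p.2) (continuousAt_heatExp hσ _)
      (by fun_prop)).smul (by fun_prop)

theorem continuousAt_heatField {σ : ℝ} (hσ : 0 < σ) (y : Vec d) :
    ContinuousAt (fun p : ℝ × Vec d => heatField μ p.1 p.2) (σ, y) := by
  refine ContinuousAt.smul (ContinuousAt.inv₀ (ContinuousAt.mul (by fun_prop)
    (continuousAt_heatDens μ hσ y)) ?_) (continuousAt_heatMoment μ hσ y)
  exact (mul_pos hσ (heatDens_pos μ σ y)).ne'

theorem continuous_heatField {σ : ℝ} (hσ : 0 < σ) : Continuous (heatField μ σ) :=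
  continuous_iff_continuousAt.2 fun y =>
    ContinuousAt.comp' (f := fun y : Vec d => (σ, y))
      (g := fun p : ℝ × Vec d => heatField μ p.1 p.2) (continuousAt_heatField μ hσ y) (by fun_prop)

/-- On bounded sets and for `σ` in a compact subset of `(0, ∞)`, the field is Lipschitz. -/
theorem exists_lipschitzOnWith_heatField {a b : ℝ} (ha : 0 < a) (r : ℝ) :
    ∃ K : ℝ≥0, ∀ σ ∈ Icc a b, LipschitzOnWith K (heatField μ σ) (Metric.closedBall 0 r) := by
  have hcpt : IsCompact (Icc a b ×ˢ Metric.closedBall (0 : Vec d) r) :=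
    isCompact_Icc.prod (isCompact_closedBall _ _)
  have hcont : ContinuousOn (fun p : ℝ × Vec d => (p.1 * heatDens μ p.1 p.2)⁻¹)
      (Icc a b ×ˢ Metric.closedBall (0 : Vec d) r) := by
    rintro ⟨σ, y⟩ ⟨hσ, -⟩
    have hσ' : 0 < σ := ha.trans_le hσ.1
    refine (ContinuousAt.inv₀ (ContinuousAt.mul (by fun_prop)
      (continuousAt_heatDens μ hσ' y)) ?_).continuousWithinAt
    exact (mul_pos hσ' (heatDens_pos μ σ y)).ne'
  obtain ⟨C, hC⟩ := hcpt.exists_bound_of_continuousOn hcont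
  have hC0 : ∀ σ ∈ Icc a b, ∀ y ∈ Metric.closedBall (0 : Vec d) r,
      (σ * heatDens μ σ y)⁻¹ ≤ |C| := fun σ hσ y hy =>
    (le_abs_self _).trans ((hC (σ, y) ⟨hσ, hy⟩).trans (le_abs_self C))
  refine ⟨Real.toNNReal (|C| * 2 + |C| * |C| * b), fun σ hσ =>
    LipschitzOnWith.of_dist_le_mul fun y hy y' hy' => ?_⟩
  have hσ0 : 0 < σ := ha.trans_le hσ.1
  have hb0 : 0 < b := hσ0.trans_le hσ.2
  rw [Real.coe_toNNReal _ (by positivity), dist_eq_norm, dist_eq_norm]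
  have hp := mul_pos hσ0 (heatDens_pos μ σ y)
  have hp' := mul_pos hσ0 (heatDens_pos μ σ y')
  -- Quotient rule for differences: one term varies the numerator, the other the denominator. The
  -- factor 1/σ in the Lipschitz bound of `heatDens` cancels against the explicit σ.
  have key : heatField μ σ y - heatField μ σ y' =
      (σ * heatDens μ σ y)⁻¹ • (heatMoment μ σ y - heatMoment μ σ y') +
      ((σ * heatDens μ σ y)⁻¹ * (σ * heatDens μ σ y')⁻¹ *
        (σ * (heatDens μ σ y' - heatDens μ σ y))) • heatMoment μ σ y' := by
    have : (σ * heatDens μ σ y)⁻¹ * (σ * heatDens μ σ y')⁻¹ *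
        (σ * (heatDens μ σ y' - heatDens μ σ y)) =
        (σ * heatDens μ σ y)⁻¹ - (σ * heatDens μ σ y')⁻¹ := by
      have := (heatDens_pos μ σ y).ne'
      have := (heatDens_pos μ σ y').ne'
      field_simp
    rw [this, heatField, heatField, smul_sub, sub_smul]
    abel
  rw [key]
  refine (norm_add_le _ _).trans ?_
  rw [norm_smul, norm_smul, norm_mul, norm_mul, norm_mul, Real.norm_of_nonneg (inv_pos.2 hp).le,
    Real.norm_of_nonneg (inv_pos.2 hp').le, Real.norm_of_nonneg hσ0.le, add_mul]
  have h1 := hC0 σ hσ y hy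
  have h2 := hC0 σ hσ y' hy'
  have h3 := norm_heatMoment_sub_le μ hσ0 y y'
  have h4 := norm_heatMoment_le μ hσ0 y'
  have h5 : ‖heatDens μ σ y' - heatDens μ σ y‖ ≤ 1 / σ * ‖y - y'‖ := by
    rw [norm_sub_rev]; exact abs_heatDens_sub_le μ hσ0 y y'
  have h6 : σ ≤ b := hσ.2
  have h7 := (inv_pos.2 hp').le
  have h8 : σ * ‖heatDens μ σ y' - heatDens μ σ y‖ ≤ ‖y - y'‖ := by
    calc σ * ‖heatDens μ σ y' - heatDens μ σ y‖ ≤ σ * (1 / σ * ‖y - y'‖) := by gcongr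
      _ = ‖y - y'‖ := by field_simp
  have t1 : (σ * heatDens μ σ y)⁻¹ * ‖heatMoment μ σ y - heatMoment μ σ y'‖ ≤
      |C| * 2 * ‖y - y'‖ := by
    rw [mul_assoc]; gcongr
  have t2 : (σ * heatDens μ σ y)⁻¹ * (σ * heatDens μ σ y')⁻¹ *
      (σ * ‖heatDens μ σ y' - heatDens μ σ y‖) * ‖heatMoment μ σ y'‖ ≤
      |C| * |C| * ‖y - y'‖ * b := by
    gcongr
    exact h4.trans h6
  linarith

/-- The field has linear growth, uniformly for `σ` in a bounded subset of `(0, ∞)`. -/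
theorem exists_norm_heatField_le {a b : ℝ} (ha : 0 < a) :
    ∃ A : ℝ, 0 ≤ A ∧ ∀ σ ∈ Icc a b, ∀ y, ‖heatField μ σ y‖ ≤ A * (1 + ‖y‖) := by
  -- A ball with half of the mass is enough to bound the density from below; no moment of `μ` is
  -- needed.
  obtain ⟨R, hR0, hR⟩ : ∃ R : ℝ, 0 ≤ R ∧ 1 / 2 ≤ μ.real (Metric.closedBall 0 R) := by
    have h1 : Tendsto (fun n : ℕ => μ.real (Metric.closedBall (0 : Vec d) n)) atTop
        (𝓝 (μ.real (⋃ n : ℕ, Metric.closedBall (0 : Vec d) n))) := by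
      have hm : Monotone fun n : ℕ => Metric.closedBall (0 : Vec d) n :=
        fun m n h => Metric.closedBall_subset_closedBall (by exact_mod_cast h)
      exact (ENNReal.tendsto_toReal (measure_ne_top _ _)).comp
        (tendsto_measure_iUnion_atTop hm)
    rw [Metric.iUnion_closedBall_nat, probReal_univ] at h1
    obtain ⟨n, hn⟩ := (h1.eventually (lt_mem_nhds (by norm_num : (1 : ℝ) / 2 < 1))).exists
    exact ⟨n, by positivity, hn.le⟩
  refine ⟨(2 * R + 2 + 4 * |b|) / a, by positivity, fun σ hσ y => ?_⟩
  have hσ0 : 0 < σ := ha.trans_le hσ.1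
  have hb : σ ≤ |b| := hσ.2.trans (le_abs_self b)
  set r : ℝ := ‖y‖ + R with hr
  have hr0 : 0 ≤ r := by positivity
  have hD := heatDens_pos μ σ y
  -- Every point of that ball lies within r = ‖y‖ + R of y.
  have hlow : Real.exp (-r ^ 2 / (2 * σ ^ 2)) ≤ 2 * heatDens μ σ y := by
    have h1 : ∫ x in Metric.closedBall 0 R, Real.exp (-r ^ 2 / (2 * σ ^ 2)) ∂μ ≤
        ∫ x in Metric.closedBall 0 R, heatExp σ (y - x) ∂μ := by
      refine setIntegral_mono_on (integrable_const _) (integrable_heatExp μ σ y).integrableOn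
        measurableSet_closedBall fun x hx => ?_
      have hx' : ‖y - x‖ ≤ r := by
        have : ‖x‖ ≤ R := by simpa using hx
        exact (norm_sub_le _ _).trans (by linarith)
      rw [heatExp]
      gcongr
    have h2 : ∫ x in Metric.closedBall 0 R, heatExp σ (y - x) ∂μ ≤ heatDens μ σ y :=
      setIntegral_le_integral (integrable_heatExp μ σ y)
        (Eventually.of_forall fun x => (heatExp_pos _ _).le)
    rw [setIntegral_const, smul_eq_mul] at h1
    have h3 : 1 / 2 * Real.exp (-r ^ 2 / (2 * σ ^ 2)) ≤
        μ.real (Metric.closedBall 0 R) * Real.exp (-r ^ 2 / (2 * σ ^ 2)) := by gcongr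
    linarith
  -- Points within 2r contribute at most 2r times the kernel. Beyond 2r, ‖y - x‖² ≥ (‖y - x‖/2)² +
  -- r², so the kernel splits off a factor exp(-r²/(2σ²)), which `hlow` compares with the density.
  have hpt : ∀ x, ‖heatExp σ (y - x) • (y - x)‖ ≤
      2 * r * heatExp σ (y - x) + 2 * σ * Real.exp (-r ^ 2 / (2 * σ ^ 2)) := by
    intro x
    rw [norm_smul, Real.norm_of_nonneg (heatExp_pos _ _).le]
    have hx0 := heatExp_pos σ (y - x)
    rcases le_total ‖y - x‖ (2 * r) with h | h
    · have : heatExp σ (y - x) * ‖y - x‖ ≤ heatExp σ (y - x) * (2 * r) := by gcongr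
      have h2 : 0 ≤ 2 * σ * Real.exp (-r ^ 2 / (2 * σ ^ 2)) := by positivity
      linarith
    · have h1 : Real.exp (-(‖y - x‖ / 2) ^ 2 / (2 * σ ^ 2)) * (‖y - x‖ / 2) ≤ σ :=
        exp_neg_sq_mul_le hσ0
      have h2 : heatExp σ (y - x) ≤ Real.exp (-(‖y - x‖ / 2) ^ 2 / (2 * σ ^ 2)) *
          Real.exp (-r ^ 2 / (2 * σ ^ 2)) := by
        rw [heatExp, ← Real.exp_add, ← add_div]
        gcongr
        nlinarith
      have h3 : heatExp σ (y - x) * ‖y - x‖ ≤ (Real.exp (-(‖y - x‖ / 2) ^ 2 / (2 * σ ^ 2)) *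
          Real.exp (-r ^ 2 / (2 * σ ^ 2))) * ‖y - x‖ := by gcongr
      have h4 : 0 ≤ 2 * r * heatExp σ (y - x) := by positivity
      have h5 : Real.exp (-(‖y - x‖ / 2) ^ 2 / (2 * σ ^ 2)) * (‖y - x‖ / 2) *
          Real.exp (-r ^ 2 / (2 * σ ^ 2)) ≤ σ * Real.exp (-r ^ 2 / (2 * σ ^ 2)) := by gcongr
      nlinarith
  have hM : ‖heatMoment μ σ y‖ ≤ (2 * r + 4 * σ) * heatDens μ σ y := by
    calc ‖heatMoment μ σ y‖ ≤ ∫ x, (2 * r * heatExp σ (y - x) +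
          2 * σ * Real.exp (-r ^ 2 / (2 * σ ^ 2))) ∂μ :=
          norm_integral_le_of_norm_le (((integrable_heatExp μ σ y).const_mul _).add
            (integrable_const _)) (Eventually.of_forall hpt)
      _ = 2 * r * heatDens μ σ y + 2 * σ * Real.exp (-r ^ 2 / (2 * σ ^ 2)) := by
          rw [integral_add ((integrable_heatExp μ σ y).const_mul _) (integrable_const _),
            integral_const_mul, heatDens]
          simp
      _ ≤ (2 * r + 4 * σ) * heatDens μ σ y := by nlinarith
  rw [heatField, norm_smul, norm_inv, Real.norm_of_nonneg (mul_pos hσ0 hD).le]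
  calc (σ * heatDens μ σ y)⁻¹ * ‖heatMoment μ σ y‖
      ≤ (σ * heatDens μ σ y)⁻¹ * ((2 * r + 4 * σ) * heatDens μ σ y) := by gcongr
    _ = (2 * r + 4 * σ) / σ := by field_simp
    _ ≤ (2 * r + 4 * |b|) / a := by
        have := hσ.1
        gcongr
    _ ≤ (2 * R + 2 + 4 * |b|) / a * (1 + ‖y‖) := by
        rw [div_mul_eq_mul_div]
        gcongr
        have := norm_nonneg y
        have := abs_nonneg b
        rw [hr]
        nlinarith [mul_nonneg hR0 (norm_nonneg y), mul_nonneg (abs_nonneg b) (norm_nonneg y)]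

end

/-! ### Conditional expectation of the noise given the smoothed variable. -/

section
variable {d : ℕ}

theorem gaussKer_eq_mul_heatExp (σ : ℝ) (u : Vec d) :
    gaussKer σ u = (√(2 * Real.pi) * σ)⁻¹ ^ d * heatExp σ u := rfl

theorem gaussKer_smul_inv_smul (σ : ℝ) (u : Vec d) : gaussKer σ u • σ⁻¹ • u =
    ((√(2 * Real.pi) * σ)⁻¹ ^ d * σ⁻¹) • (heatExp σ u • u) := by
  rw [gaussKer_eq_mul_heatExp, smul_smul, smul_smul]
  congr 1; ring

theorem integral_gaussKer (μ : Measure (Vec d)) (σ : ℝ) (y : Vec d) :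
    ∫ x, gaussKer σ (y - x) ∂μ = (√(2 * Real.pi) * σ)⁻¹ ^ d * heatDens μ σ y := by
  simp_rw [gaussKer_eq_mul_heatExp]
  rw [integral_const_mul, heatDens]

/-- A joint density relative to `μ.prod volume` allows the order of integration to be exchanged.
With y outermost, conditioning on x₀ + σz = y becomes an integral over x against the kernel. -/
theorem map_prodMk_add_smul (μ : Measure (Vec d)) [SFinite μ] {σ : ℝ} (hσ : 0 < σ) :
    (μ.prod (stdGaussian (Vec d))).map (fun w => (w.1, w.1 + σ • w.2)) =
      (μ.prod volume).withDensity fun p => ENNReal.ofReal (gaussKer σ (p.2 - p.1)) := by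
  have hk : Measurable fun p : Vec d × Vec d => ENNReal.ofReal (gaussKer σ (p.2 - p.1)) :=
    ((continuous_gaussKer σ).comp (by fun_prop)).measurable.ennreal_ofReal
  refine Measure.ext_of_lintegral _ fun F hF => ?_
  rw [lintegral_map hF (by fun_prop), lintegral_withDensity_eq_lintegral_mul _ hk hF,
    lintegral_prod _ (by fun_prop), lintegral_prod _ (hk.mul hF).aemeasurable]
  refine lintegral_congr fun x => ?_
  exact lintegral_add_smul_stdGaussian hσ x (F := fun y => F (x, y)) (by fun_prop)

variable (μ : Measure (Vec d)) [IsProbabilityMeasure μ]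

instance isProbabilityMeasure_heatLaw (σ : ℝ) : IsProbabilityMeasure (heatLaw μ σ) :=
  Measure.isProbabilityMeasure_map (by fun_prop)

theorem lintegral_heatLaw_fst {σ : ℝ} (hσ : 0 < σ) {F : Vec d × Vec d → ℝ≥0∞}
    (hF : Measurable F) :
    ∫⁻ w, F (w.1, w.1 + σ • w.2) ∂(μ.prod (stdGaussian (Vec d))) =
      ∫⁻ y, ∫⁻ x, ENNReal.ofReal (gaussKer σ (y - x)) * F (x, y) ∂μ := by
  have hk : Measurable fun p : Vec d × Vec d => ENNReal.ofReal (gaussKer σ (p.2 - p.1)) :=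
    ((continuous_gaussKer σ).comp (by fun_prop)).measurable.ennreal_ofReal
  rw [← lintegral_map (g := fun w : Vec d × Vec d => (w.1, w.1 + σ • w.2)) hF (by fun_prop),
    map_prodMk_add_smul μ hσ, lintegral_withDensity_eq_lintegral_mul _ hk hF,
    lintegral_prod_symm _ (hk.mul hF).aemeasurable]
  rfl

theorem integral_gaussKer_smul {σ : ℝ} (hσ : 0 < σ) (y : Vec d) :
    ∫ x, gaussKer σ (y - x) • σ⁻¹ • (y - x) ∂μ =
      ((√(2 * Real.pi) * σ)⁻¹ ^ d * heatDens μ σ y) • heatField μ σ y := by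
  simp_rw [gaussKer_smul_inv_smul]
  rw [integral_smul, heatField, smul_smul]
  have := (heatDens_pos μ σ y).ne'
  congr 1
  field_simp

/-- Jensen's inequality for a conditional mean. The bound does not depend on σ, which makes the
trajectories have finite length down to σ = 0. -/
theorem lintegral_enorm_heatField_le {σ : ℝ} (hσ : 0 < σ) :
    ∫⁻ y, ‖heatField μ σ y‖ₑ ∂(heatLaw μ σ) ≤ ∫⁻ z, ‖z‖ₑ ∂(stdGaussian (Vec d)) := by
  have hV : Measurable (heatField μ σ) := (continuous_heatField μ hσ).measurable
  have hR : ∫⁻ z, ‖z‖ₑ ∂(stdGaussian (Vec d)) =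
      ∫⁻ y, ∫⁻ x, ENNReal.ofReal (gaussKer σ (y - x)) * ‖σ⁻¹ • (y - x)‖ₑ ∂μ := by
    rw [← lintegral_heatLaw_fst μ hσ (F := fun p => ‖σ⁻¹ • (p.2 - p.1)‖ₑ) (by fun_prop)]
    simp only [add_sub_cancel_left, inv_smul_smul₀ hσ.ne']
    rw [lintegral_prod _ (by fun_prop)]
    simp
  rw [heatLaw, lintegral_map hV.enorm (by fun_prop), hR,
    lintegral_heatLaw_fst μ hσ (F := fun p => ‖heatField μ σ p.2‖ₑ)
      (hV.comp measurable_snd).enorm]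
  refine lintegral_mono fun y => ?_
  have hc : 0 < (√(2 * Real.pi) * σ)⁻¹ ^ d := by positivity
  have hi : Integrable (fun x => gaussKer σ (y - x)) μ := by
    simp_rw [gaussKer_eq_mul_heatExp]
    exact (integrable_heatExp μ σ y).const_mul _
  calc ∫⁻ x, ENNReal.ofReal (gaussKer σ (y - x)) * ‖heatField μ σ y‖ₑ ∂μ
      = ‖∫ x, gaussKer σ (y - x) • σ⁻¹ • (y - x) ∂μ‖ₑ := by
        rw [lintegral_mul_const' _ _ enorm_ne_top, ← ofReal_integral_eq_lintegral_ofReal hi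
          (Eventually.of_forall fun x => (gaussKer_pos hσ _).le), integral_gaussKer,
          integral_gaussKer_smul μ hσ, enorm_smul,
          Real.enorm_of_nonneg (mul_pos hc (heatDens_pos μ σ y)).le]
    _ ≤ ∫⁻ x, ‖gaussKer σ (y - x) • σ⁻¹ • (y - x)‖ₑ ∂μ := enorm_integral_le_lintegral_enorm _
    _ = ∫⁻ x, ENNReal.ofReal (gaussKer σ (y - x)) * ‖σ⁻¹ • (y - x)‖ₑ ∂μ := by
        refine lintegral_congr fun x => ?_
        rw [enorm_smul, Real.enorm_of_nonneg (gaussKer_pos hσ _).le]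

theorem integrable_heatField_comp {σ : ℝ} (hσ : 0 < σ) :
    Integrable (fun w : Vec d × Vec d => heatField μ σ (w.1 + σ • w.2))
      (μ.prod (stdGaussian (Vec d))) := by
  have hV : Continuous (heatField μ σ) := continuous_heatField μ hσ
  refine ⟨(hV.comp (by fun_prop)).aestronglyMeasurable, ?_⟩
  have h := lintegral_enorm_heatField_le μ hσ
  rw [heatLaw, lintegral_map hV.measurable.enorm (by fun_prop)] at h
  exact h.trans_lt (IsGaussian.integrable_id (μ := stdGaussian (Vec d))).2

theorem integral_eq_of_gaussKer {σ : ℝ} (hσ : 0 < σ) {h : Vec d × Vec d → ℝ}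
    (hm : Measurable h)
    (hi : Integrable (fun w : Vec d × Vec d => h (w.1, w.1 + σ • w.2))
      (μ.prod (stdGaussian (Vec d)))) :
    ∫ w, h (w.1, w.1 + σ • w.2) ∂(μ.prod (stdGaussian (Vec d))) =
      ∫ y, ∫ x, gaussKer σ (y - x) * h (x, y) ∂μ := by
  have hg : Measurable fun w : Vec d × Vec d => (w.1, w.1 + σ • w.2) := by fun_prop
  have hk : Measurable fun p : Vec d × Vec d => ENNReal.ofReal (gaussKer σ (p.2 - p.1)) :=
    ((continuous_gaussKer σ).comp (by fun_prop)).measurable.ennreal_ofReal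
  have hs : ∀ p : Vec d × Vec d, (ENNReal.ofReal (gaussKer σ (p.2 - p.1))).toReal • h p =
      gaussKer σ (p.2 - p.1) * h p := fun p => by
    rw [ENNReal.toReal_ofReal (gaussKer_pos hσ _).le, smul_eq_mul]
  have h1 : Integrable h ((μ.prod (stdGaussian (Vec d))).map
      (fun w => (w.1, w.1 + σ • w.2))) :=
    (integrable_map_measure hm.aestronglyMeasurable hg.aemeasurable).2 hi
  rw [map_prodMk_add_smul μ hσ, integrable_withDensity_iff_integrable_smul' hk (by simp)] at h1
  rw [← integral_map (f := h) hg.aemeasurable hm.aestronglyMeasurable, map_prodMk_add_smul μ hσ,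
    integral_withDensity_eq_integral_toReal_smul hk (by simp)]
  simp_rw [hs] at h1 ⊢
  rw [integral_prod_symm _ h1]

/-- `heatField μ σ` is the conditional mean of `z` given `x₀ + σ z`. -/
theorem integral_apply_heatField {σ : ℝ} (hσ : 0 < σ) {A : Vec d → Vec d →L[ℝ] ℝ}
    (hA : Measurable A) {C : ℝ} (hC : ∀ y, ‖A y‖ ≤ C) :
    ∫ w, A (w.1 + σ • w.2) w.2 ∂(μ.prod (stdGaussian (Vec d))) =
      ∫ w, A (w.1 + σ • w.2) (heatField μ σ (w.1 + σ • w.2))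
        ∂(μ.prod (stdGaussian (Vec d))) := by
  have hV : Measurable (heatField μ σ) := (continuous_heatField μ hσ).measurable
  have happ : Measurable fun q : (Vec d →L[ℝ] ℝ) × Vec d => q.1 q.2 :=
    isBoundedBilinearMap_apply.continuous.measurable
  have hm1 : Measurable fun p : Vec d × Vec d => A p.2 (σ⁻¹ • (p.2 - p.1)) :=
    happ.comp ((hA.comp measurable_snd).prodMk (by fun_prop))
  have hm2 : Measurable fun p : Vec d × Vec d => A p.2 (heatField μ σ p.2) :=
    happ.comp ((hA.comp measurable_snd).prodMk (hV.comp measurable_snd))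
  have hg : Measurable fun w : Vec d × Vec d => (w.1, w.1 + σ • w.2) := by fun_prop
  have hz : Integrable (fun w : Vec d × Vec d => w.2) (μ.prod (stdGaussian (Vec d))) :=
    (IsGaussian.integrable_id (μ := stdGaussian (Vec d))).comp_snd μ
  -- The noise is rewritten as σ⁻¹(y - x), a function of the pair (x, y) that carries the joint
  -- density.
  have e1 : ∀ w : Vec d × Vec d, A (w.1 + σ • w.2) w.2 =
      A (w.1 + σ • w.2) (σ⁻¹ • (w.1 + σ • w.2 - w.1)) := fun w => by
    rw [add_sub_cancel_left, inv_smul_smul₀ hσ.ne']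
  have hi1 : Integrable (fun w : Vec d × Vec d =>
      A (w.1 + σ • w.2) (σ⁻¹ • (w.1 + σ • w.2 - w.1))) (μ.prod (stdGaussian (Vec d))) := by
    refine Integrable.mono' (hz.norm.const_mul C) (hm1.comp hg).aestronglyMeasurable
      (Eventually.of_forall fun w => ?_)
    rw [← e1]
    exact ((A _).le_opNorm _).trans (by gcongr; exact hC _)
  have hi2 : Integrable (fun w : Vec d × Vec d =>
      A (w.1 + σ • w.2) (heatField μ σ (w.1 + σ • w.2))) (μ.prod (stdGaussian (Vec d))) := by
    refine Integrable.mono' ((integrable_heatField_comp μ hσ).norm.const_mul C)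
      (hm2.comp hg).aestronglyMeasurable (Eventually.of_forall fun w => ?_)
    exact ((A _).le_opNorm _).trans (by gcongr; exact hC _)
  simp_rw [e1]
  rw [integral_eq_of_gaussKer μ hσ (h := fun p => A p.2 (σ⁻¹ • (p.2 - p.1))) hm1 hi1,
    integral_eq_of_gaussKer μ hσ (h := fun p => A p.2 (heatField μ σ p.2)) hm2 hi2]
  -- For fixed y, the functional `A y` is linear and continuous and passes through the integral in
  -- x, leaving the conditional mean.
  refine integral_congr_ae (Eventually.of_forall fun y => ?_)
  have hint : Integrable (fun x => gaussKer σ (y - x) • σ⁻¹ • (y - x)) μ := by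
    simp_rw [gaussKer_smul_inv_smul]
    exact (integrable_heatExp_smul μ hσ y).smul ((√(2 * Real.pi) * σ)⁻¹ ^ d * σ⁻¹)
  calc ∫ x, gaussKer σ (y - x) * A y (σ⁻¹ • (y - x)) ∂μ
      = ∫ x, A y (gaussKer σ (y - x) • σ⁻¹ • (y - x)) ∂μ := by
        simp_rw [map_smul, smul_eq_mul]
    _ = A y (∫ x, gaussKer σ (y - x) • σ⁻¹ • (y - x) ∂μ) := (A y).integral_comp_comm hint
    _ = ∫ x, gaussKer σ (y - x) * A y (heatField μ σ y) ∂μ := by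
        rw [integral_gaussKer_smul μ hσ, map_smul, smul_eq_mul, integral_mul_const,
          integral_gaussKer]

end

/-! ### Flows of bounded Lipschitz fields -/

section
variable {E : Type*} [NormedAddCommGroup E] [NormedSpace ℝ E]

/-- A time-dependent field that is jointly continuous, bounded by `M`, and `K`-Lipschitz in space. -/
structure IsBoundedLipschitzField (v : ℝ → E → E) (K M : ℝ≥0) : Prop where
  continuous : Continuous fun p : ℝ × E => v p.1 p.2
  lip : ∀ t, LipschitzWith K (v t)
  bound : ∀ t x, ‖v t x‖ ≤ M

/-- `Φ s x` is the integral curve of `v` that passes through `x` at time `s`. -/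
structure IsFlow (v : ℝ → E → E) (Φ : ℝ → E → ℝ → E) : Prop where
  start : ∀ s x, Φ s x s = x
  deriv : ∀ s x t, HasDerivAt (Φ s x) (v t (Φ s x t)) t

/-- A global bound on the field lets Picard–Lindelöf reach any time interval: the ball of radius
M(n+1) cannot be left within time n+1. Uniqueness makes the solutions on growing intervals
compatible, so they glue. -/
theorem IsBoundedLipschitzField.exists_hasDerivAt [CompleteSpace E] {v : ℝ → E → E} {K M : ℝ≥0}
    (hv : IsBoundedLipschitzField v K M) (s : ℝ) (x : E) :
    ∃ α : ℝ → E, α s = x ∧ ∀ t, HasDerivAt α (v t (α t)) t := by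
  have hloc : ∀ n : ℕ, ∃ α : ℝ → E, α s = x ∧
      ∀ t ∈ Icc (s - (n + 1)) (s + (n + 1)),
        HasDerivWithinAt α (v t (α t)) (Icc (s - (n + 1)) (s + (n + 1))) t := by
    intro n
    have hs : s ∈ Icc (s - ((n : ℝ) + 1)) (s + (n + 1)) := by
      constructor <;> linarith [(n.cast_nonneg : (0 : ℝ) ≤ n)]
    have hpl : IsPicardLindelof v (⟨s, hs⟩ : Icc (s - ((n : ℝ) + 1)) (s + (n + 1))) x
        (M * (n + 1)) 0 M K :=
      { lipschitzOnWith := fun t _ => (hv.lip t).lipschitzOnWith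
        continuousOn := fun y _ => (hv.continuous.comp (by fun_prop :
          Continuous fun t : ℝ => (t, y))).continuousOn
        norm_le := fun t _ y _ => hv.bound t y
        mul_max_le := by simp }
    exact hpl.exists_eq_forall_mem_Icc_hasDerivWithinAt₀
  choose β hβs hβ using hloc
  have hβ' : ∀ n : ℕ, ∀ t ∈ Ioo (s - ((n : ℝ) + 1)) (s + (n + 1)),
      HasDerivAt (β n) (v t (β n t)) t := fun n t ht =>
    (hβ n t (Ioo_subset_Icc_self ht)).hasDerivAt (Icc_mem_nhds ht.1 ht.2)
  have heq : ∀ m n : ℕ, m ≤ n → EqOn (β m) (β n) (Ioo (s - ((m : ℝ) + 1)) (s + (m + 1))) := by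
    intro m n hmn
    have hmn' : (m : ℝ) ≤ n := by exact_mod_cast hmn
    have hm0 : (0 : ℝ) ≤ m := m.cast_nonneg
    refine ODE_solution_unique_of_mem_Ioo (v := v) (s := fun _ => univ) (K := K)
      (t₀ := s) (fun t _ => (hv.lip t).lipschitzOnWith) ?_ (fun t ht => ⟨hβ' m t ht, trivial⟩)
      (fun t ht => ⟨hβ' n t ?_, trivial⟩) ((hβs m).trans (hβs n).symm)
    · constructor <;> linarith
    · constructor <;> linarith [ht.1, ht.2]
  have hmem : ∀ t (n : ℕ), |t - s| ≤ n → t ∈ Ioo (s - ((n : ℝ) + 1)) (s + (n + 1)) := by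
    intro t n h
    have := abs_le.1 h
    constructor <;> linarith [this.1, this.2]
  refine ⟨fun t => β ⌈|t - s|⌉₊ t, by simp [hβs], fun t₀ => ?_⟩
  -- The extra 1 makes one index serve for all times within distance 1 of `t₀`.
  set N : ℕ := ⌈|t₀ - s|⌉₊ + 1 with hN
  have hev : (fun t => β ⌈|t - s|⌉₊ t) =ᶠ[𝓝 t₀] β N := by
    filter_upwards [Metric.ball_mem_nhds t₀ one_pos] with t ht
    have h1 : |t - s| ≤ N := by
      have h2 : |t - t₀| < 1 := ht
      have h3 := Nat.le_ceil |t₀ - s|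
      have h4 := abs_sub_le t t₀ s
      rw [hN]; push_cast; linarith
    exact heq _ _ (Nat.ceil_le.2 h1) (hmem t _ (Nat.le_ceil _))
  have h5 : |t₀ - s| ≤ N := by
    rw [hN]; push_cast; linarith [Nat.le_ceil |t₀ - s|]
  have h6 := (hβ' N t₀ (hmem t₀ N h5)).congr_of_eventuallyEq hev
  rwa [← hev.eq_of_nhds] at h6

theorem IsBoundedLipschitzField.exists_isFlow [CompleteSpace E] {v : ℝ → E → E} {K M : ℝ≥0}
    (hv : IsBoundedLipschitzField v K M) : ∃ Φ, IsFlow v Φ := by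
  choose Φ h1 h2 using hv.exists_hasDerivAt
  exact ⟨Φ, h1, h2⟩

namespace IsFlow

variable {v : ℝ → E → E} {K M : ℝ≥0} {Φ : ℝ → E → ℝ → E}

theorem comp_eq (hΦ : IsFlow v Φ) (hv : IsBoundedLipschitzField v K M) (s r t : ℝ) (x : E) :
    Φ r (Φ s x r) t = Φ s x t := by
  have h := ODE_solution_unique_univ (v := v) (s := fun _ => univ) (K := K) (t₀ := r)
    (f := Φ r (Φ s x r)) (g := Φ s x) (fun t => (hv.lip t).lipschitzOnWith)
    (fun t => ⟨hΦ.deriv _ _ t, trivial⟩) (fun t => ⟨hΦ.deriv _ _ t, trivial⟩) (hΦ.start _ _)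
  rw [h]

theorem dist_le (hΦ : IsFlow v Φ) (hv : IsBoundedLipschitzField v K M) (s t : ℝ) (x y : E) :
    dist (Φ s x t) (Φ s y t) ≤ Real.exp (K * |t - s|) * dist x y := by
  have hcont : ∀ s x, Continuous (Φ s x) := fun s x =>
    continuous_iff_continuousAt.2 fun t => (hΦ.deriv s x t).continuousAt
  rcases le_total s t with h | h
  · have := dist_le_of_trajectories_ODE (v := v) (K := K) (f := Φ s x) (g := Φ s y) (a := s)
      (b := t) (δ := dist x y) (fun t => hv.lip t) (hcont s x).continuousOn
      (fun t _ => (hΦ.deriv s x t).hasDerivWithinAt) (hcont s y).continuousOn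
      (fun t _ => (hΦ.deriv s y t).hasDerivWithinAt) (by rw [hΦ.start, hΦ.start]) t ⟨h, le_rfl⟩
    rw [abs_of_nonneg (sub_nonneg.2 h), mul_comm]
    exact this
  -- For t before s, reverse time and apply the forward estimate to the field -v(-u, ·).
  · have hd : ∀ x u, HasDerivAt (fun u => Φ s x (-u)) (-v (-u) (Φ s x (-u))) u := fun x u => by
      have := (hΦ.deriv s x (-u)).scomp u (hasDerivAt_neg u)
      simpa using! this
    have := dist_le_of_trajectories_ODE (v := fun u x => -v (-u) x) (K := K)
      (f := fun u => Φ s x (-u)) (g := fun u => Φ s y (-u)) (a := -s)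
      (b := -t) (δ := dist x y) (fun t => (hv.lip (-t)).neg)
      ((hcont s x).comp continuous_neg).continuousOn
      (fun t _ => (hd x t).hasDerivWithinAt) ((hcont s y).comp continuous_neg).continuousOn
      (fun t _ => (hd y t).hasDerivWithinAt) (by simp [hΦ.start]) (-t) ⟨by linarith, le_rfl⟩
    rw [abs_of_nonpos (sub_nonpos.2 h), mul_comm]
    simp only [neg_neg] at this
    refine this.trans_eq ?_
    congr 3; ring

theorem norm_sub_le (hΦ : IsFlow v Φ) (hv : IsBoundedLipschitzField v K M) (s : ℝ) (x : E)
    (t r : ℝ) : ‖Φ s x t - Φ s x r‖ ≤ M * |t - r| :=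
  convex_univ.norm_image_sub_le_of_norm_hasDerivWithin_le (𝕜 := ℝ)
    (fun u _ => (hΦ.deriv s x u).hasDerivWithinAt) (fun u _ => hv.bound u _)
    (mem_univ r) (mem_univ t)

theorem continuous_uncurry (hΦ : IsFlow v Φ) (hv : IsBoundedLipschitzField v K M) (s : ℝ) :
    Continuous fun p : ℝ × E => Φ s p.2 p.1 := by
  refine continuous_iff_continuousAt.2 fun ⟨t₀, x₀⟩ => ?_
  rw [ContinuousAt, tendsto_iff_dist_tendsto_zero]
  have h : Tendsto (fun p : ℝ × E => Real.exp (K * |p.1 - s|) * dist p.2 x₀ + M * |p.1 - t₀|)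
      (𝓝 (t₀, x₀)) (𝓝 0) := by
    have hc : Continuous fun p : ℝ × E =>
      Real.exp (K * |p.1 - s|) * dist p.2 x₀ + M * |p.1 - t₀| := by fun_prop
    simpa using hc.tendsto (t₀, x₀)
  refine squeeze_zero (fun _ => dist_nonneg) (fun p => ?_) h
  refine (dist_triangle _ (Φ s x₀ p.1) _).trans (add_le_add (hΦ.dist_le hv _ _ _ _) ?_)
  rw [dist_eq_norm]
  exact hΦ.norm_sub_le hv _ _ _ _

/-- Differentiation of the flow with respect to the starting time and the starting point along
a curve `c`. -/
theorem hasDerivAt_start (hΦ : IsFlow v Φ) (hv : IsBoundedLipschitzField v K M) {c : ℝ → E}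
    {c' : E} {s : ℝ} (hc : HasDerivAt c c' s) :
    HasDerivAt (fun r => Φ r (c r) s) (c' - v s (c s)) s := by
  -- Over the short interval between r and s the trajectory stays near `c s`, where continuity keeps
  -- the field close to `v s (c s)`. No differentiability of the field in space is required.
  have hΔ : (fun r => Φ r (c r) s - c r - (s - r) • v s (c s)) =o[𝓝 s] fun r => r - s := by
    rw [Asymptotics.isLittleO_iff]
    intro ε hε
    have h1 : ∀ᶠ p in 𝓝 (s, c s), ‖v p.1 p.2 - v s (c s)‖ < ε := by
      have := (hv.continuous.tendsto (s, c s)).sub_const (v s (c s))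
      simp only [sub_self] at this
      simpa using this.norm.eventually (gt_mem_nhds (by simpa using hε))
    obtain ⟨η, hη, h2⟩ := Metric.eventually_nhds_iff.1 h1
    have h3 : Tendsto (fun r => M * |s - r| + ‖c r - c s‖) (𝓝 s) (𝓝 0) := by
      have hc' : ContinuousAt (fun r => M * |s - r| + ‖c r - c s‖) s := by
        have := hc.continuousAt
        fun_prop
      simpa using hc'.tendsto
    filter_upwards [h3.eventually (gt_mem_nhds hη), Metric.ball_mem_nhds s hη] with r hr1 hr2
    have h4 : ∀ u ∈ uIcc r s, ‖v u (Φ r (c r) u) - v s (c s)‖ ≤ ε := by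
      intro u hu
      have hus : |u - s| ≤ |r - s| := by
        rw [abs_sub_comm u, abs_sub_comm r]; exact abs_sub_right_of_mem_uIcc hu
      have hur : |u - r| ≤ |s - r| := abs_sub_left_of_mem_uIcc hu
      refine (h2 (y := (u, Φ r (c r) u)) ?_).le
      rw [Prod.dist_eq, max_lt_iff]
      refine ⟨hus.trans_lt hr2, ?_⟩
      rw [dist_eq_norm]
      have h5 := hΦ.norm_sub_le hv r (c r) u r
      rw [hΦ.start] at h5
      calc ‖Φ r (c r) u - c s‖ = ‖(Φ r (c r) u - c r) + (c r - c s)‖ := by abel_nf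
        _ ≤ M * |u - r| + ‖c r - c s‖ := (norm_add_le _ _).trans (by gcongr)
        _ ≤ M * |s - r| + ‖c r - c s‖ := by gcongr
        _ < η := hr1
    have h6 := (convex_uIcc r s).norm_image_sub_le_of_norm_hasDerivWithin_le (𝕜 := ℝ)
      (f := fun u => Φ r (c r) u - u • v s (c s)) (C := ε)
      (fun u _ => ((hΦ.deriv r (c r) u).sub
        ((hasDerivAt_id u).smul_const (v s (c s)))).hasDerivWithinAt)
      (fun u hu => by simpa using h4 u hu) left_mem_uIcc right_mem_uIcc
    simp only [hΦ.start] at h6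
    calc ‖Φ r (c r) s - c r - (s - r) • v s (c s)‖
        = ‖Φ r (c r) s - s • v s (c s) - (c r - r • v s (c s))‖ := by
          rw [sub_smul]; congr 1; abel
      _ ≤ ε * ‖s - r‖ := h6
      _ = ε * ‖r - s‖ := by rw [norm_sub_rev]
  rw [hasDerivAt_iff_isLittleO] at hc ⊢
  refine (hΔ.add hc).congr_left fun r => ?_
  rw [hΦ.start, smul_sub, sub_smul, sub_smul]
  module

end IsFlow

end

/-! ### Transport of the smoothed laws by the flow -/

section
variable {d : ℕ}

/-- The law of x₀ + σz is absolutely continuous whatever `μ` is; this is used to apply Rademacher's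
theorem along that law. -/
theorem ae_add_smul_prod (μ : Measure (Vec d)) [SFinite μ] {σ : ℝ} (hσ : 0 < σ) {p : Vec d → Prop} (hp : ∀ᵐ y, p y) :
    ∀ᵐ w ∂(μ.prod (stdGaussian (Vec d))), p (w.1 + σ • w.2) := by
  obtain ⟨s, hs, hm, h0⟩ := exists_measurable_superset_of_null (show volume {y | ¬ p y} = 0 from hp)
  have h1 : ∀ᵐ w ∂(μ.prod (stdGaussian (Vec d))), w.1 + σ • w.2 ∉ s := by
    refine (Measure.ae_prod_iff_ae_ae ?_).2 (Eventually.of_forall fun x =>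
      ae_add_smul_stdGaussian hσ x (measure_eq_zero_iff_ae_notMem.1 h0))
    exact (hm.preimage (by fun_prop : Measurable fun w : Vec d × Vec d => w.1 + σ • w.2)).compl
  filter_upwards [h1] with w hw
  by_contra hn
  exact hw (hs hn)

/-- If `v` agrees with the conditional mean field where the transported test function
has nonzero derivative, then the mean of the transported test function is stationary. -/
theorem hasDerivAt_integral_flow (μ : Measure (Vec d)) [IsProbabilityMeasure μ]
    {v : ℝ → Vec d → Vec d} {K M : ℝ≥0}
    (hv : IsBoundedLipschitzField v K M) {Φ : ℝ → Vec d → ℝ → Vec d} (hΦ : IsFlow v Φ)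
    {w₀ : Vec d → ℝ} {L : ℝ≥0} (hw : LipschitzWith L w₀) {C : ℝ} (hC : ∀ x, |w₀ x| ≤ C)
    (τ : ℝ) {s : ℝ} (hs : 0 < s)
    (hz : ∀ y, v s y ≠ heatField μ s y → fderiv ℝ (fun x => w₀ (Φ s x τ)) y = 0) :
    HasDerivAt (fun r => ∫ p, w₀ (Φ r (p.1 + r • p.2) τ) ∂(μ.prod (stdGaussian (Vec d)))) 0 s := by
  set w : Vec d → ℝ := fun x => w₀ (Φ s x τ) with hwdef
  -- Factoring through time s reduces the r-derivative at r = s to a derivative of the fixed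
  -- Lipschitz function `w`.
  have hcompat : ∀ r y, w₀ (Φ r y τ) = w (Φ r y s) := fun r y => by
    rw [hwdef]; simp only; rw [hΦ.comp_eq hv]
  have hΦlip : ∀ s t, LipschitzWith (Real.toNNReal (Real.exp (K * |t - s|))) (fun x => Φ s x t) :=
    fun s t => LipschitzWith.of_dist_le_mul fun x y => by
      rw [Real.coe_toNNReal _ (Real.exp_pos _).le]
      exact hΦ.dist_le hv s t x y
  obtain ⟨L', hwl⟩ : ∃ L', LipschitzWith L' w := ⟨_, hw.comp (hΦlip s τ)⟩
  set D : Vec d → Vec d →L[ℝ] ℝ := fderiv ℝ w with hD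
  have hDm : Measurable D := measurable_fderiv ℝ w
  have hDC : ∀ y, ‖D y‖ ≤ L' := fun y => norm_fderiv_le_of_lipschitz ℝ hwl
  have hz2 : Integrable (fun p : Vec d × Vec d => p.2) (μ.prod (stdGaussian (Vec d))) :=
    (IsGaussian.integrable_id (μ := stdGaussian (Vec d))).comp_snd μ
  have happ : Measurable fun q : (Vec d →L[ℝ] ℝ) × Vec d => q.1 q.2 :=
    isBoundedBilinearMap_apply.continuous.measurable
  have hvs : Continuous (v s) := (hv.lip s).continuous
  have hmD : Measurable fun p : Vec d × Vec d => D (p.1 + s • p.2) :=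
    hDm.comp (by fun_prop)
  have hmv : Measurable fun p : Vec d × Vec d => v s (p.1 + s • p.2) :=
    hvs.measurable.comp (by fun_prop)
  have hm1 : Measurable fun p : Vec d × Vec d => D (p.1 + s • p.2) p.2 :=
    happ.comp (hmD.prodMk measurable_snd)
  have hm2 : Measurable fun p : Vec d × Vec d => D (p.1 + s • p.2) (v s (p.1 + s • p.2)) :=
    happ.comp (hmD.prodMk hmv)
  have hi1 : Integrable (fun p : Vec d × Vec d => D (p.1 + s • p.2) p.2)
      (μ.prod (stdGaussian (Vec d))) :=
    Integrable.mono' (hz2.norm.const_mul (L' : ℝ)) hm1.aestronglyMeasurable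
      (Eventually.of_forall fun p => ((D _).le_opNorm _).trans (by gcongr; exact hDC _))
  have hi2 : Integrable (fun p : Vec d × Vec d => D (p.1 + s • p.2) (v s (p.1 + s • p.2)))
      (μ.prod (stdGaussian (Vec d))) :=
    Integrable.of_bound (C := L' * M) hm2.aestronglyMeasurable
      (Eventually.of_forall fun p => ((D _).le_opNorm _).trans (by
        gcongr
        · exact hDC _
        · exact hv.bound _ _))
  -- The integrand is the r-derivative: the starting point moves with velocity z, and the later
  -- starting time removes v. Replacing z by its conditional mean leaves `heatField` minus v, which
  -- is zero wherever D is not.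
  have hzero : ∫ p, D (p.1 + s • p.2) (p.2 - v s (p.1 + s • p.2))
      ∂(μ.prod (stdGaussian (Vec d))) = 0 := by
    simp_rw [map_sub]
    rw [integral_sub hi1 hi2, integral_apply_heatField μ hs hDm hDC, sub_eq_zero]
    refine integral_congr_ae (Eventually.of_forall fun p => ?_)
    by_cases h : v s (p.1 + s • p.2) = heatField μ s (p.1 + s • p.2)
    · simp only [h]
    · simp only [hz _ h, zero_apply]
  have key := hasDerivAt_integral_of_dominated_loc_of_lip (𝕜 := ℝ)
    (μ := μ.prod (stdGaussian (Vec d)))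
    (F := fun r p => w₀ (Φ r (p.1 + r • p.2) τ))
    (F' := fun p => D (p.1 + s • p.2) (p.2 - v s (p.1 + s • p.2))) (x₀ := s)
    (bound := fun p => L' * (Real.exp K * (M + ‖p.2‖))) (Metric.ball_mem_nhds s one_pos)
    (Eventually.of_forall fun r => ?_) ?_ ?_ ?_ ?_ ?_
  · rw [hzero] at key
    exact key.2
  · exact (hw.continuous.comp ((hΦlip r τ).continuous.comp (by fun_prop))).aestronglyMeasurable
  · refine Integrable.of_bound (C := C) ?_ (Eventually.of_forall fun p => hC _)
    exact (hw.continuous.comp ((hΦlip s τ).continuous.comp (by fun_prop))).aestronglyMeasurable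
  · simp_rw [map_sub]
    exact (hm1.sub hm2).aestronglyMeasurable
  · refine Eventually.of_forall fun p => LipschitzOnWith.of_dist_le_mul fun r hr r' hr' => ?_
    simp only [hcompat]
    refine (hwl.dist_le_mul _ _).trans ?_
    have h1 : dist (Φ r (p.1 + r • p.2) s) (Φ r' (p.1 + r' • p.2) s) ≤
        Real.exp (K * 1) * ((M + ‖p.2‖) * dist r r') := by
      rw [← hΦ.comp_eq hv r r' s]
      refine (hΦ.dist_le hv _ _ _ _).trans ?_
      have hr1 : |s - r'| ≤ 1 := by
        rw [abs_sub_comm]; exact (show |r' - s| < 1 from hr').le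
      have h2 : dist (Φ r (p.1 + r • p.2) r') (p.1 + r' • p.2) ≤ (M + ‖p.2‖) * dist r r' := by
        have h3 := hΦ.norm_sub_le hv r (p.1 + r • p.2) r' r
        rw [hΦ.start] at h3
        calc dist (Φ r (p.1 + r • p.2) r') (p.1 + r' • p.2)
            = ‖(Φ r (p.1 + r • p.2) r' - (p.1 + r • p.2)) + (r - r') • p.2‖ := by
              rw [dist_eq_norm, sub_smul]; congr 1; abel
          _ ≤ M * |r' - r| + |r - r'| * ‖p.2‖ := by
              refine (norm_add_le _ _).trans (add_le_add h3 ?_)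
              rw [norm_smul, Real.norm_eq_abs]
          _ = (M + ‖p.2‖) * dist r r' := by
              rw [Real.dist_eq, abs_sub_comm r' r]; ring
      gcongr
    rw [mul_one] at h1
    rw [Real.coe_nnabs, abs_of_nonneg (by positivity)]
    calc (L' : ℝ) * dist (Φ r (p.1 + r • p.2) s) (Φ r' (p.1 + r' • p.2) s)
        ≤ L' * (Real.exp K * ((M + ‖p.2‖) * dist r r')) := by gcongr
      _ = L' * (Real.exp K * (M + ‖p.2‖)) * dist r r' := by ring
  · exact (((integrable_const (M : ℝ)).add hz2.norm).const_mul _).const_mul _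
  -- Rademacher's theorem: `w` is differentiable almost everywhere, hence at almost every x₀ + sz.
  · filter_upwards [ae_add_smul_prod μ hs (hwl.ae_differentiableAt (μ := volume))] with p hp
    have hc : HasDerivAt (fun r : ℝ => p.1 + r • p.2) p.2 s := by
      simpa using ((hasDerivAt_id s).smul_const p.2).const_add p.1
    have h1 := hΦ.hasDerivAt_start hv hc
    have h2 : HasFDerivAt w (D (p.1 + s • p.2)) ((fun r => Φ r (p.1 + r • p.2) s) s) := by
      simp only [hΦ.start]; exact hp.hasFDerivAt
    have h3 := HasFDerivAt.comp_hasDerivAt (f := fun r => Φ r (p.1 + r • p.2) s) s h2 h1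
    refine h3.congr_of_eventuallyEq (Eventually.of_forall fun r => ?_)
    exact hcompat _ _

/-- A finite measure is determined by the integrals of Lipschitz functions of bounded support. -/
theorem ext_of_forall_integral_lipschitz {μ ν : Measure (Vec d)} [IsProbabilityMeasure μ]
    [IsProbabilityMeasure ν]
    (h : ∀ (w : Vec d → ℝ) (L : ℝ≥0) (r : ℝ), LipschitzWith L w → (∀ x, |w x| ≤ 1) →
      (∀ x, r < ‖x‖ → w x = 0) → ∫ x, w x ∂μ = ∫ x, w x ∂ν) : μ = ν := by
  have hb : ∀ F : Set (Vec d), IsClosed F → ∀ r, F ⊆ Metric.closedBall 0 r → μ F = ν F := by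
    intro F hF r hr
    have hδ : ∀ n : ℕ, (0 : ℝ) < 1 / (n + 1) := fun n => Nat.one_div_pos_of_nat
    have hlim : ∀ ρ : Measure (Vec d), IsProbabilityMeasure ρ →
        Tendsto (fun n : ℕ => ∫ x, ((thickenedIndicator (hδ n) F x : ℝ≥0) : ℝ) ∂ρ) atTop
          (𝓝 (ρ.real F)) := by
      intro ρ _
      have h1 := tendsto_lintegral_thickenedIndicator_of_isClosed ρ hF hδ
        tendsto_one_div_add_atTop_nhds_zero_nat
      have h2 := (ENNReal.tendsto_toReal (measure_ne_top ρ F)).comp h1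
      refine h2.congr fun n => ?_
      rw [integral_eq_lintegral_of_nonneg_ae (Eventually.of_forall fun x => NNReal.coe_nonneg _)
        (by fun_prop)]
      simp
    have heq : ∀ n : ℕ, ∫ x, ((thickenedIndicator (hδ n) F x : ℝ≥0) : ℝ) ∂μ =
        ∫ x, ((thickenedIndicator (hδ n) F x : ℝ≥0) : ℝ) ∂ν := by
      intro n
      -- The thickening radius is at most 1, so the support stays in the ball of radius r + 1.
      refine h _ (Real.toNNReal (1 / (n + 1)))⁻¹ (r + 1) ?_ ?_ ?_
      · exact (lipschitzWith_thickenedIndicator (hδ n) F)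
      · intro x
        rw [NNReal.abs_eq]
        exact_mod_cast thickenedIndicator_le_one (hδ n) F x
      · intro x hx
        rw [thickenedIndicator_zero, NNReal.coe_zero]
        intro hx2
        obtain ⟨y, hy, hxy⟩ := Metric.mem_thickening_iff.1 hx2
        have h1 : ‖y‖ ≤ r := by simpa using hr hy
        have h2 : ‖x‖ ≤ ‖y‖ + dist x y := by
          rw [dist_eq_norm]
          calc ‖x‖ = ‖y + (x - y)‖ := by abel_nf
            _ ≤ _ := norm_add_le _ _
        have h3 : (1 : ℝ) / (n + 1) ≤ 1 := by
          rw [div_le_one (by positivity)]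
          linarith [(n.cast_nonneg : (0 : ℝ) ≤ n)]
        linarith
    have h1 := hlim ν inferInstance
    simp_rw [← heq] at h1
    have h2 := tendsto_nhds_unique (hlim μ inferInstance) h1
    exact (measureReal_eq_measureReal_iff).1 h2
  refine ext_of_generate_finite _ (BorelSpace.measurable_eq.trans borel_eq_generateFrom_isClosed)
    isPiSystem_isClosed (fun F hF => ?_) (by simp)
  -- Bounded closed sets exhaust every closed set, and the closed sets form a generating π-system.
  have hU : F = ⋃ n : ℕ, F ∩ Metric.closedBall 0 n := by
    rw [← inter_iUnion, Metric.iUnion_closedBall_nat, inter_univ]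
  have hm : Monotone fun n : ℕ => F ∩ Metric.closedBall (0 : Vec d) n := fun m n h =>
    inter_subset_inter_right _ (Metric.closedBall_subset_closedBall (by exact_mod_cast h))
  have h1 := tendsto_measure_iUnion_atTop (μ := μ) hm
  have h2 := tendsto_measure_iUnion_atTop (μ := ν) hm
  rw [← hU] at h1 h2
  refine tendsto_nhds_unique h1 (h2.congr fun n => ?_)
  exact (hb _ (IsClosed.inter hF Metric.isClosed_closedBall) n inter_subset_right).symm

end

/-! ### Truncation of the conditional mean field -/

/-- Grönwall's inequality in both time directions. Growth is assumed only along the curve, so the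
constants are unaffected by the size of a truncation. -/
theorem one_add_norm_le_of_linear_growth {E : Type*} [NormedAddCommGroup E] [NormedSpace ℝ E]
    {f f' : ℝ → E} {A a b : ℝ} (hA : 0 < A) (hf : ∀ t, HasDerivAt f (f' t) t)
    (hb : ∀ t ∈ Icc a b, ‖f' t‖ ≤ A * (1 + ‖f t‖)) {s t : ℝ} (hs : s ∈ Icc a b)
    (ht : t ∈ Icc a b) : 1 + ‖f t‖ ≤ (1 + ‖f s‖) * Real.exp (A * |t - s|) := by
  have hcont : Continuous f := continuous_iff_continuousAt.2 fun t => (hf t).continuousAt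
  have aux : ∀ (g g' : ℝ → E) (p q : ℝ), Continuous g → (∀ t, HasDerivAt g (g' t) t) →
      (∀ t ∈ Ico p q, ‖g' t‖ ≤ A * (1 + ‖g t‖)) → p ≤ q →
      1 + ‖g q‖ ≤ (1 + ‖g p‖) * Real.exp (A * (q - p)) := by
    intro g g' p q hg hg' hgb hpq
    have h := norm_le_gronwallBound_of_norm_deriv_right_le (f := g) (f' := g') (δ := ‖g p‖)
      (K := A) (ε := A) (a := p) (b := q) hg.continuousOn
      (fun x _ => (hg' x).hasDerivWithinAt) le_rfl
      (fun x hx => (hgb x hx).trans_eq (by ring)) q ⟨hpq, le_rfl⟩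
    rw [gronwallBound_of_K_ne_0 hA.ne', div_self hA.ne'] at h
    simp only [one_mul] at h
    linarith
  rcases le_total s t with h | h
  · rw [abs_of_nonneg (sub_nonneg.2 h)]
    exact aux f f' s t hcont hf (fun u hu => hb u ⟨hs.1.trans hu.1, hu.2.le.trans ht.2⟩) h
  · rw [abs_of_nonpos (sub_nonpos.2 h)]
    have hd : ∀ u, HasDerivAt (fun u => f (-u)) (-f' (-u)) u := fun u => by
      have := (hf (-u)).scomp u (hasDerivAt_neg u)
      simpa using! this
    have := aux (fun u => f (-u)) (fun u => -f' (-u)) (-s) (-t) (hcont.comp continuous_neg) hd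
      (fun u hu => by
        rw [norm_neg]
        exact hb (-u) ⟨by linarith [hu.2, ht.1], by linarith [hu.1, hs.2]⟩) (by linarith)
    simp only [neg_neg] at this
    refine this.trans_eq ?_
    congr 3; ring

section
variable {d : ℕ}

/-- Coordinatewise projection to the cube `[-c, c]ᵈ`. -/
noncomputable def clampVec (c : ℝ) (y : Vec d) : Vec d :=
  WithLp.toLp 2 fun i => max (-c) (min c (y i))

theorem lipschitzWith_clampVec (c : ℝ) : LipschitzWith 1 (clampVec c : Vec d → Vec d) := by
  refine LipschitzWith.of_dist_le_mul fun x y => ?_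
  rw [NNReal.coe_one, one_mul, EuclideanSpace.dist_eq, EuclideanSpace.dist_eq]
  gcongr with i
  simp only [clampVec, Real.dist_eq]
  rw [max_comm, max_comm (-c)]
  refine (abs_max_sub_max_le_abs _ _ _).trans ?_
  rw [min_comm, min_comm c]
  have h := abs_min_sub_min_le_max (x i) c (y i) c
  simpa using h

theorem clampVec_of_norm_le {c : ℝ} {y : Vec d} (hy : ‖y‖ ≤ c) : clampVec c y = y := by
  ext i
  have h : |y i| ≤ c := (PiLp.norm_apply_le y i).trans hy
  rw [abs_le] at h
  simp [clampVec, h.1, h.2]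

theorem norm_clampVec_le {c : ℝ} (hc : 0 ≤ c) (y : Vec d) : ‖clampVec c y‖ ≤ ‖y‖ := by
  have h := (lipschitzWith_clampVec (d := d) c).dist_le_mul y 0
  rw [clampVec_of_norm_le (y := (0 : Vec d)) (by simpa using hc)] at h
  simpa using h

theorem norm_clampVec_le_sqrt {c : ℝ} (hc : 0 ≤ c) (y : Vec d) :
    ‖clampVec c y‖ ≤ √(d * c ^ 2) := by
  rw [EuclideanSpace.norm_eq]
  gcongr
  calc ∑ i, ‖clampVec c y i‖ ^ 2 ≤ ∑ _i : Fin d, c ^ 2 := by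
        refine Finset.sum_le_sum fun i _ => ?_
        have : |clampVec c y i| ≤ c := by
          simp only [clampVec, abs_le]
          exact ⟨le_max_left _ _, max_le (by linarith) (min_le_left _ _)⟩
        rw [Real.norm_eq_abs]
        gcongr
    _ = d * c ^ 2 := by simp

/-- The conditional mean field, frozen outside `σ ∈ [a, b]` and outside the cube `[-c, c]ᵈ`. -/
noncomputable def truncField (μ : Measure (Vec d)) (a b c σ : ℝ) (y : Vec d) : Vec d :=
  heatField μ (max a (min b σ)) (clampVec c y)

theorem truncField_eq {μ : Measure (Vec d)} {a b c σ : ℝ} (hσ : σ ∈ Icc a b) {y : Vec d}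
    (hy : ‖y‖ ≤ c) : truncField μ a b c σ y = heatField μ σ y := by
  rw [truncField, clampVec_of_norm_le hy, min_eq_right hσ.2, max_eq_right hσ.1]

/-- Clamping does not increase norms, so on [δ, b] the growth constant of the untruncated field
serves for all truncation levels. The resulting a priori bounds are uniform. -/
theorem norm_truncField_le {μ : Measure (Vec d)} {A a b c δ σ : ℝ} (hA0 : 0 ≤ A)
    (hA : ∀ σ ∈ Icc δ b, ∀ y, ‖heatField μ σ y‖ ≤ A * (1 + ‖y‖)) (haδ : a ≤ δ) (hc : 0 ≤ c)
    (hσ : σ ∈ Icc δ b) (y : Vec d) : ‖truncField μ a b c σ y‖ ≤ A * (1 + ‖y‖) := by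
  rw [truncField, min_eq_right hσ.2, max_eq_right (haδ.trans hσ.1)]
  refine (hA _ hσ _).trans ?_
  gcongr
  exact norm_clampVec_le hc y

variable (μ : Measure (Vec d)) [IsProbabilityMeasure μ]

/-- The clamped arguments stay in a fixed compact set, where `heatField` is Lipschitz and bounded;
composition with the 1-Lipschitz clamp makes both bounds global. -/
theorem exists_isBoundedLipschitzField_truncField {a b c : ℝ} (ha : 0 < a) (hab : a ≤ b)
    (hc : 0 ≤ c) : ∃ K M : ℝ≥0, IsBoundedLipschitzField (truncField μ a b c) K M := by
  obtain ⟨K, hK⟩ := exists_lipschitzOnWith_heatField μ (b := b) ha √(d * c ^ 2)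
  obtain ⟨A, hA0, hA⟩ := exists_norm_heatField_le μ (b := b) ha
  have hmem : ∀ σ, max a (min b σ) ∈ Icc a b := fun σ =>
    ⟨le_max_left _ _, max_le hab (min_le_left _ _)⟩
  have hcl : ∀ y : Vec d, clampVec c y ∈ Metric.closedBall (0 : Vec d) √(d * c ^ 2) := fun y => by
    simpa using norm_clampVec_le_sqrt hc y
  refine ⟨K, Real.toNNReal (A * (1 + √(d * c ^ 2))), ?_, fun t => ?_, fun t x => ?_⟩
  · refine continuous_iff_continuousAt.2 fun ⟨σ, y⟩ => ?_
    have := (lipschitzWith_clampVec (d := d) c).continuous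
    exact ContinuousAt.comp' (f := fun p : ℝ × Vec d => (max a (min b p.1), clampVec c p.2))
      (g := fun p : ℝ × Vec d => heatField μ p.1 p.2)
      (continuousAt_heatField μ (ha.trans_le (hmem σ).1) _) (by fun_prop)
  · refine LipschitzWith.of_dist_le_mul fun x y => ?_
    refine ((hK _ (hmem t)).dist_le_mul _ (hcl x) _ (hcl y)).trans ?_
    gcongr
    simpa using (lipschitzWith_clampVec (d := d) c).dist_le_mul x y
  · rw [Real.coe_toNNReal _ (by positivity)]
    refine (hA _ (hmem t) _).trans ?_
    gcongr
    exact norm_clampVec_le_sqrt hc x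

/-- The flow of the truncated field transports the smoothed laws, as seen by test functions whose
support stays in the region without truncation. -/
theorem integral_flow_truncField {A a b c τ r : ℝ} (hA0 : 0 < A)
    (hA : ∀ σ ∈ Icc τ b, ∀ y, ‖heatField μ σ y‖ ≤ A * (1 + ‖y‖)) (ha : 0 < a) (haτ : a ≤ τ)
    (hτb : τ ≤ b) (hc0 : 0 ≤ c) (hc : (1 + r) * Real.exp (A * (b - τ)) ≤ 1 + c)
    {Φ : ℝ → Vec d → ℝ → Vec d} (hΦ : IsFlow (truncField μ a b c) Φ)
    {w₀ : Vec d → ℝ} {L : ℝ≥0} (hw : LipschitzWith L w₀) (hw1 : ∀ x, |w₀ x| ≤ 1)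
    (hr : ∀ x, r < ‖x‖ → w₀ x = 0) :
    ∫ y, w₀ (Φ b y τ) ∂(heatLaw μ b) = ∫ y, w₀ y ∂(heatLaw μ τ) := by
  obtain ⟨K, M, hv⟩ := exists_isBoundedLipschitzField_truncField μ ha (haτ.trans hτb) hc0
  have hτ : 0 < τ := ha.trans_le haτ
  have hd : ∀ s ∈ Icc τ b, HasDerivAt
      (fun r => ∫ p, w₀ (Φ r (p.1 + r • p.2) τ) ∂(μ.prod (stdGaussian (Vec d)))) 0 s := by
    intro s hs
    refine hasDerivAt_integral_flow μ hv hΦ hw hw1 τ (hτ.trans_le hs.1) fun y hy => ?_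
    -- The truncated field differs from the true one only outside the ball of radius c. By the
    -- choice of c, a trajectory out there cannot be in the ball of radius r at time τ, so the
    -- transported test function vanishes near y.
    have hyc : c < ‖y‖ := by
      by_contra hn
      exact hy (truncField_eq ⟨haτ.trans hs.1, hs.2⟩ (not_lt.1 hn))
    have hev : (fun x => w₀ (Φ s x τ)) =ᶠ[𝓝 y] fun _ => 0 := by
      have : ∀ᶠ x in 𝓝 y, c < ‖x‖ := continuous_norm.continuousAt.eventually (lt_mem_nhds hyc)
      filter_upwards [this] with x hx
      refine hr _ ?_
      have h1 := one_add_norm_le_of_linear_growth hA0 (fun t => hΦ.deriv s x t)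
        (fun t ht => norm_truncField_le hA0.le hA haτ hc0 ht _) (left_mem_Icc.2 hτb) hs
      rw [hΦ.start] at h1
      have h2 : A * |s - τ| ≤ A * (b - τ) := by
        rw [abs_of_nonneg (by linarith [hs.1])]
        have := hs.2
        gcongr
      by_contra hn
      have h3 : (1 + ‖Φ s x τ‖) * Real.exp (A * |s - τ|) ≤ (1 + r) * Real.exp (A * (b - τ)) := by
        have := not_lt.1 hn
        have h0 : 0 ≤ r := (norm_nonneg _).trans this
        gcongr
      linarith
    rw [hev.fderiv_eq]
    simp
  -- Zero derivative on [τ, b]: compare r = b with r = τ, where the flow map is the identity.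
  have hconst := constant_of_has_deriv_right_zero
    (fun s hs => (hd s hs).continuousAt.continuousWithinAt)
    (fun s hs => (hd s (Ico_subset_Icc_self hs)).hasDerivWithinAt) b (right_mem_Icc.2 hτb)
  have hcΦ : Continuous fun y => Φ b y τ :=
    (hΦ.continuous_uncurry hv b).comp (by fun_prop : Continuous fun y : Vec d => (τ, y))
  rw [heatLaw, heatLaw, integral_map (f := fun y => w₀ (Φ b y τ)) (by fun_prop)
    (hw.continuous.comp hcΦ).aestronglyMeasurable,
    integral_map (by fun_prop) hw.continuous.aestronglyMeasurable]
  simpa [hΦ.start] using hconst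

end

/-! ### The deterministic flow that interpolates the smoothed laws -/

section
variable {d : ℕ} (μ : Measure (Vec d)) [IsProbabilityMeasure μ]

/-- On [δ, S] the a priori bound does not depend on n. Once the truncation level exceeds it, the
trajectory never meets the truncation, so by uniqueness all later flows agree there. -/
theorem exists_flow_truncField_stable {S : ℝ} (hS : 0 < S)
    {Φ : ℕ → ℝ → Vec d → ℝ → Vec d}
    (hΦ : ∀ n : ℕ, IsFlow (truncField μ (S / (n + 1)) S n) (Φ n)) {δ : ℝ} (hδ : δ ∈ Ioc 0 S)
    (y : Vec d) : ∃ N : ℕ, S / (N + 1) ≤ δ ∧ ∀ n ≥ N, ∀ σ ∈ Icc δ S,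
      ‖Φ n S y σ‖ ≤ N ∧ Φ n S y σ = Φ N S y σ := by
  obtain ⟨A, hA0, hA⟩ := exists_norm_heatField_le μ (b := S) hδ.1
  have hA' : ∀ σ ∈ Icc δ S, ∀ y, ‖heatField μ σ y‖ ≤ (A + 1) * (1 + ‖y‖) := fun σ hσ y =>
    (hA σ hσ y).trans (by gcongr; linarith)
  -- The first entry puts the time cutoff S/(N+1) below δ, the second puts the clamp radius above
  -- the Grönwall bound.
  obtain ⟨N, hN⟩ := exists_nat_ge (max (S / δ) ((1 + ‖y‖) * Real.exp ((A + 1) * S)))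
  have hN1 : S / δ ≤ N := (le_max_left _ _).trans hN
  have hN2 : (1 + ‖y‖) * Real.exp ((A + 1) * S) ≤ N := (le_max_right _ _).trans hN
  have hle : ∀ n ≥ N, S / ((n : ℝ) + 1) ≤ δ := by
    intro n hn
    have : (N : ℝ) ≤ n := by exact_mod_cast hn
    rw [div_le_iff₀ hδ.1] at hN1
    rw [div_le_iff₀ (by positivity)]
    nlinarith [hδ.1]
  have hbd : ∀ n ≥ N, ∀ σ ∈ Icc δ S, ‖Φ n S y σ‖ ≤ N := by
    intro n hn σ hσ
    have h1 := one_add_norm_le_of_linear_growth (by positivity : 0 < A + 1)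
      (fun t => (hΦ n).deriv S y t)
      (fun t ht => norm_truncField_le (by positivity) hA' (hle n hn) n.cast_nonneg ht _)
      (right_mem_Icc.2 hδ.2) hσ
    rw [(hΦ n).start] at h1
    have h2 : (A + 1) * |σ - S| ≤ (A + 1) * S := by
      rw [abs_of_nonpos (by linarith [hσ.2])]
      have := hσ.1
      have := hδ.1
      gcongr
      linarith
    have h3 : (1 + ‖y‖) * Real.exp ((A + 1) * |σ - S|) ≤ (1 + ‖y‖) * Real.exp ((A + 1) * S) := by
      gcongr
    linarith
  have hsol : ∀ n ≥ N, ∀ σ ∈ Icc δ S,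
      HasDerivAt (Φ n S y) (truncField μ (S / (N + 1)) S N σ (Φ n S y σ)) σ := by
    intro n hn σ hσ
    have hn' : (N : ℝ) ≤ n := by exact_mod_cast hn
    have h := (hΦ n).deriv S y σ
    rw [truncField_eq ⟨(hle n hn).trans hσ.1, hσ.2⟩ ((hbd n hn σ hσ).trans hn')] at h
    rwa [truncField_eq ⟨(hle N le_rfl).trans hσ.1, hσ.2⟩ (hbd n hn σ hσ)]
  refine ⟨N, hle N le_rfl, fun n hn σ hσ => ⟨hbd n hn σ hσ, ?_⟩⟩
  obtain ⟨K, M, hv⟩ := exists_isBoundedLipschitzField_truncField μ (a := S / (N + 1)) (b := S)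
    (c := N) (by positivity) ((hle N le_rfl).trans hδ.2) N.cast_nonneg
  refine ODE_solution_unique_of_mem_Icc_left (v := truncField μ (S / (N + 1)) S N)
    (s := fun _ => univ) (K := K) (a := δ) (b := S)
    (fun t _ => (hv.lip t).lipschitzOnWith)
    (fun t ht => (hsol n hn t ht).continuousAt.continuousWithinAt)
    (fun t ht => (hsol n hn t (Ioc_subset_Icc_self ht)).hasDerivWithinAt) (fun _ _ => trivial)
    (fun t ht => (hsol N le_rfl t ht).continuousAt.continuousWithinAt)
    (fun t ht => (hsol N le_rfl t (Ioc_subset_Icc_self ht)).hasDerivWithinAt) (fun _ _ => trivial)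
    ?_ hσ
  rw [(hΦ n).start, (hΦ N).start]

/-- A measurable family of solutions of `dy/dσ = E[z | x₀ + σ z = y]` on `(0, S]` that
transports the law of `x₀ + S z` to that of `x₀ + σ z`. -/
theorem exists_flow_heatLaw {S : ℝ} (hS : 0 < S) :
    ∃ Y : ℝ → Vec d → Vec d, Measurable (fun p : ℝ × Vec d => Y p.1 p.2) ∧ (∀ y, Y S y = y) ∧
      (∀ y, ContinuousOn (fun σ => Y σ y) (Ioc 0 S)) ∧
      (∀ y, ∀ σ ∈ Ioo 0 S, HasDerivAt (fun σ => Y σ y) (heatField μ σ (Y σ y)) σ) ∧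
      ∀ σ ∈ Ioc 0 S, (heatLaw μ S).map (Y σ) = heatLaw μ σ := by
  have hex : ∀ n : ℕ, ∃ Φ, IsFlow (truncField μ (S / (n + 1)) S n) Φ := fun n => by
    obtain ⟨K, M, hv⟩ := exists_isBoundedLipschitzField_truncField μ (a := S / (n + 1)) (b := S)
      (c := n) (by positivity) (div_le_self hS.le (by simp)) n.cast_nonneg
    exact hv.exists_isFlow
  choose Φ hΦ using hex
  have hΦc : ∀ n, Continuous fun p : ℝ × Vec d => Φ n S p.2 p.1 := fun n => by
    obtain ⟨K, M, hv⟩ := exists_isBoundedLipschitzField_truncField μ (a := S / (n + 1)) (b := S)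
      (c := n) (by positivity) (div_le_self hS.le (by simp)) n.cast_nonneg
    exact (hΦ n).continuous_uncurry hv S
  -- Setting the maps to 0 for σ outside (0, S] makes the sequence eventually constant at every
  -- point, so the limit is jointly measurable.
  set f : ℕ → ℝ × Vec d → Vec d := fun n =>
    (Prod.fst ⁻¹' Ioc 0 S).indicator fun p => Φ n S p.2 p.1 with hf
  have hfm : ∀ n, Measurable (f n) := fun n =>
    (hΦc n).measurable.indicator (measurable_fst measurableSet_Ioc)
  have hev : ∀ p, ∃ l, ∀ᶠ n in atTop, f n p = l := by
    rintro ⟨σ, y⟩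
    by_cases hσ : σ ∈ Ioc 0 S
    · obtain ⟨N, -, hN⟩ := exists_flow_truncField_stable μ hS hΦ hσ y
      refine ⟨Φ N S y σ, eventually_atTop.2 ⟨N, fun n hn => ?_⟩⟩
      rw [hf]
      simp only
      rw [indicator_of_mem (by exact hσ)]
      exact (hN n hn σ (left_mem_Icc.2 hσ.2)).2
    · refine ⟨0, Eventually.of_forall fun n => ?_⟩
      rw [hf]
      simp only
      rw [indicator_of_notMem (by exact hσ)]
  choose Y hY using hev
  have hYeq : ∀ σ ∈ Ioc 0 S, ∀ y, ∀ᶠ n in atTop, Φ n S y σ = Y (σ, y) := by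
    intro σ hσ y
    filter_upwards [hY (σ, y)] with n hn
    rw [← hn, hf]
    simp only
    rw [indicator_of_mem (by exact hσ)]
  have hYN : ∀ δ ∈ Ioc 0 S, ∀ y, ∃ N : ℕ, S / (N + 1) ≤ δ ∧ ∀ σ ∈ Icc δ S,
      ‖Φ N S y σ‖ ≤ N ∧ Y (σ, y) = Φ N S y σ := by
    intro δ hδ y
    obtain ⟨N, hNδ, hN⟩ := exists_flow_truncField_stable μ hS hΦ hδ y
    refine ⟨N, hNδ, fun σ hσ => ⟨(hN N le_rfl σ hσ).1, ?_⟩⟩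
    obtain ⟨n, hn, hnN⟩ := ((hYeq σ ⟨hδ.1.trans_le hσ.1, hσ.2⟩ y).and
      (eventually_ge_atTop N)).exists
    rw [← hn, (hN n hnN σ hσ).2]
  have hYm : Measurable Y := measurable_of_tendsto_metrizable hfm (tendsto_pi_nhds.2 fun p =>
    tendsto_const_nhds.congr' ((hY p).mono fun n hn => hn.symm))
  refine ⟨fun σ y => Y (σ, y), hYm, fun y => ?_, fun y σ hσ => ?_, fun y σ hσ => ?_,
    fun τ hτ => ?_⟩
  · obtain ⟨n, hn⟩ := (hYeq S ⟨hS, le_rfl⟩ y).exists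
    exact hn.symm.trans ((hΦ n).start S y)
  -- With lower end σ/2, one truncated flow represents Y on a whole neighbourhood of σ in (0, S].
  · have hδ : σ / 2 ∈ Ioc 0 S := ⟨half_pos hσ.1, (half_le_self hσ.1.le).trans hσ.2⟩
    obtain ⟨N, -, hN⟩ := hYN _ hδ y
    have h1 : ContinuousWithinAt (Φ N S y) (Ioc 0 S) σ :=
      ((hΦ N).deriv S y σ).continuousAt.continuousWithinAt
    refine h1.congr_of_eventuallyEq ?_ (hN σ ⟨half_le_self hσ.1.le, hσ.2⟩).2
    have : Ioi (σ / 2) ∈ 𝓝 σ := Ioi_mem_nhds (half_lt_self hσ.1)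
    filter_upwards [mem_nhdsWithin_of_mem_nhds this, self_mem_nhdsWithin] with t ht1 ht2
    exact (hN t ⟨le_of_lt ht1, ht2.2⟩).2
  · have hδ : σ / 2 ∈ Ioc 0 S := ⟨half_pos hσ.1, (half_le_self hσ.1.le).trans hσ.2.le⟩
    obtain ⟨N, hNδ, hN⟩ := hYN _ hδ y
    have hσ2 : σ ∈ Icc (σ / 2) S := ⟨half_le_self hσ.1.le, hσ.2.le⟩
    have h := (hΦ N).deriv S y σ
    rw [truncField_eq ⟨hNδ.trans hσ2.1, hσ.2.le⟩ (hN σ hσ2).1, ← (hN σ hσ2).2] at h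
    refine h.congr_of_eventuallyEq ?_
    filter_upwards [Ioo_mem_nhds (half_lt_self hσ.1) hσ.2] with t ht
    exact (hN t ⟨ht.1.le, ht.2.le⟩).2
  · have hm : Measurable fun y => Y (τ, y) := hYm.comp (by fun_prop)
    have : IsProbabilityMeasure ((heatLaw μ S).map fun y => Y (τ, y)) :=
      Measure.isProbabilityMeasure_map hm.aemeasurable
    refine ext_of_forall_integral_lipschitz fun w L r hw hw1 hr => ?_
    obtain ⟨A, hA0, hA⟩ := exists_norm_heatField_le μ (b := S) hτ.1
    have hA' : ∀ σ ∈ Icc τ S, ∀ y, ‖heatField μ σ y‖ ≤ (A + 1) * (1 + ‖y‖) := fun σ hσ y =>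
      (hA σ hσ y).trans (by gcongr; linarith)
    -- Here the level depends on the support radius r of the test function, not on the starting
    -- point, so the integral identity holds exactly for all large n.
    obtain ⟨N, hN⟩ := exists_nat_ge (max (S / τ) ((1 + r) * Real.exp ((A + 1) * (S - τ))))
    have hN1 : S / τ ≤ N := (le_max_left _ _).trans hN
    have hN2 := (le_max_right _ _).trans hN
    have hint : ∀ᶠ n in atTop, ∫ y, w (Φ n S y τ) ∂(heatLaw μ S) = ∫ y, w y ∂(heatLaw μ τ) := by
      filter_upwards [eventually_ge_atTop N] with n hn
      have hn' : (N : ℝ) ≤ n := by exact_mod_cast hn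
      refine integral_flow_truncField μ (by positivity : 0 < A + 1) hA' (by positivity) ?_ hτ.2
        n.cast_nonneg (by linarith) (hΦ n) hw hw1 hr
      rw [div_le_iff₀ hτ.1] at hN1
      rw [div_le_iff₀ (by positivity)]
      nlinarith [hτ.1]
    have hlim : Tendsto (fun n => ∫ y, w (Φ n S y τ) ∂(heatLaw μ S)) atTop
        (𝓝 (∫ y, w (Y (τ, y)) ∂(heatLaw μ S))) := by
      refine tendsto_integral_of_dominated_convergence (fun _ => 1) (fun n => ?_)
        (integrable_const _) (fun n => Eventually.of_forall fun y => hw1 _)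
        (Eventually.of_forall fun y => ?_)
      · exact (hw.continuous.comp ((hΦc n).comp
          (by fun_prop : Continuous fun y : Vec d => (τ, y)))).aestronglyMeasurable
      · exact tendsto_const_nhds.congr' ((hYeq τ hτ y).mono fun n hn => congrArg w hn.symm)
    rw [integral_map hm.aemeasurable hw.continuous.aestronglyMeasurable]
    exact tendsto_nhds_unique hlim (tendsto_const_nhds.congr' (hint.mono fun n hn => hn.symm))

end

/-! ### The limit of the flow as σ → 0, and the gradient of the smoothed density. -/

section
variable {d : ℕ} (μ : Measure (Vec d))

theorem measurable_heatField [SFinite μ] :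
    Measurable fun p : ℝ × Vec d => heatField μ p.1 p.2 := by
  have h1 : Measurable fun q : (ℝ × Vec d) × Vec d => heatExp q.1.1 (q.1.2 - q.2) := by
    unfold heatExp
    fun_prop
  have h2 : Measurable fun p : ℝ × Vec d => heatDens μ p.1 p.2 :=
    (h1.stronglyMeasurable.integral_prod_right' (ν := μ)).measurable
  have h3 : Measurable fun p : ℝ × Vec d => heatMoment μ p.1 p.2 := by
    have h4 : Measurable fun q : (ℝ × Vec d) × Vec d => q.1.2 - q.2 := by fun_prop
    have h5 : StronglyMeasurable fun q : (ℝ × Vec d) × Vec d =>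
      heatExp q.1.1 (q.1.2 - q.2) • (q.1.2 - q.2) := (h1.smul h4).stronglyMeasurable
    exact (h5.integral_prod_right' (ν := μ)).measurable
  exact (measurable_fst.mul h2).inv.smul h3

variable [IsProbabilityMeasure μ]

/-- The expected length of a trajectory on (0, S] is at most S·E‖z‖, by transport of the laws and
Jensen. Hence almost every trajectory converges, and the law of the limit is the weak limit of the
laws of x₀ + σz. -/
theorem exists_limit_flow_heatLaw {S : ℝ} {Y : ℝ → Vec d → Vec d}
    (hYm : Measurable (fun p : ℝ × Vec d => Y p.1 p.2))
    (hYc : ∀ y, ContinuousOn (fun σ => Y σ y) (Ioc 0 S))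
    (hYd : ∀ y, ∀ σ ∈ Ioo 0 S, HasDerivAt (fun σ => Y σ y) (heatField μ σ (Y σ y)) σ)
    (hYl : ∀ σ ∈ Ioc 0 S, (heatLaw μ S).map (Y σ) = heatLaw μ σ) (hS : 0 < S) :
    ∃ Y₀ : Vec d → Vec d, Measurable Y₀ ∧ (heatLaw μ S).map Y₀ = μ ∧
      ∀ᵐ y ∂(heatLaw μ S), Tendsto (fun σ => Y σ y) (𝓝[>] 0) (𝓝 (Y₀ y)) := by
  have hYσ : ∀ σ, Measurable (Y σ) := fun σ => hYm.comp measurable_prodMk_left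
  have hg : Measurable fun p : ℝ × Vec d => heatField μ p.1 (Y p.1 p.2) :=
    (measurable_heatField μ).comp (measurable_fst.prodMk hYm)
  have hfin : ∫⁻ y, (∫⁻ σ in Ioc 0 S, ‖heatField μ σ (Y σ y)‖ₑ) ∂(heatLaw μ S) < ∞ := by
    rw [lintegral_lintegral_swap (by
      exact (hg.enorm.comp measurable_swap).aemeasurable)]
    have h1 : ∫⁻ σ in Ioc 0 S, (∫⁻ y, ‖heatField μ σ (Y σ y)‖ₑ ∂(heatLaw μ S)) ≤
        ∫⁻ _σ in Ioc 0 S, (∫⁻ z, ‖z‖ₑ ∂(stdGaussian (Vec d))) := by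
      refine setLIntegral_mono' measurableSet_Ioc fun σ hσ => ?_
      rw [← lintegral_map (f := fun y => ‖heatField μ σ y‖ₑ)
        (continuous_heatField μ hσ.1).measurable.enorm (hYσ σ), hYl σ hσ]
      exact lintegral_enorm_heatField_le μ hσ.1
    refine h1.trans_lt ?_
    rw [setLIntegral_const]
    exact ENNReal.mul_lt_top (IsGaussian.integrable_id (μ := stdGaussian (Vec d))).2
      (by simp)
  have hae : ∀ᵐ y ∂(heatLaw μ S), ∃ l, Tendsto (fun σ => Y σ y) (𝓝[>] 0) (𝓝 l) := by
    have hm : Measurable fun y => ∫⁻ σ in Ioc 0 S, ‖heatField μ σ (Y σ y)‖ₑ :=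
      (hg.enorm.comp measurable_swap).lintegral_prod_right'
    filter_upwards [ae_lt_top hm hfin.ne] with y hy
    have hint : IntegrableOn (fun σ => heatField μ σ (Y σ y)) (Ioc 0 S) :=
      ⟨(hg.comp (by fun_prop : Measurable fun σ : ℝ => (σ, y))).aestronglyMeasurable, hy⟩
    have hii : IntervalIntegrable (fun σ => heatField μ σ (Y σ y)) volume 0 S :=
      (intervalIntegrable_iff_integrableOn_Ioc_of_le hS.le).2 hint
    refine ⟨Y S y - ∫ σ in (0 : ℝ)..S, heatField μ σ (Y σ y), ?_⟩
    have hcont : ContinuousOn (fun r => ∫ σ in r..S, heatField μ σ (Y σ y)) (uIcc 0 S) :=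
      intervalIntegral.continuousOn_primitive_interval_left
        (by rw [uIcc_of_le hS.le, integrableOn_Icc_iff_integrableOn_Ioc]; exact hint)
    rw [uIcc_of_le hS.le] at hcont
    have h2 := (hcont 0 (left_mem_Icc.2 hS.le)).tendsto.mono_left
      (nhdsWithin_mono 0 (Ioc_subset_Icc_self))
    rw [nhdsWithin_Ioc_eq_nhdsGT hS] at h2
    refine (h2.const_sub (Y S y)).congr' ?_
    have hmem : Ioc 0 S ∈ 𝓝[>] (0 : ℝ) := Ioc_mem_nhdsGT hS
    filter_upwards [hmem] with r hr
    rw [intervalIntegral.integral_eq_sub_of_hasDerivAt_of_le hr.2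
      ((hYc y).mono fun t ht => ⟨hr.1.trans_le ht.1, ht.2⟩)
      (fun t ht => hYd y t ⟨hr.1.trans ht.1, ht.2⟩)
      (hii.mono_set (by
        rw [uIcc_of_le hr.2, uIcc_of_le hS.le]; exact Icc_subset_Icc_left hr.1.le))]
    abel
  obtain ⟨Y₀, hY₀, hlim⟩ := measurable_limit_of_tendsto_metrizable_ae
    (fun σ => (hYσ σ).aemeasurable) hae
  refine ⟨Y₀, hY₀, ?_, hlim⟩
  have : IsProbabilityMeasure ((heatLaw μ S).map Y₀) :=
    Measure.isProbabilityMeasure_map hY₀.aemeasurable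
  refine ext_of_forall_integral_eq_of_IsFiniteMeasure fun F => ?_
  rw [integral_map hY₀.aemeasurable F.continuous.aestronglyMeasurable]
  have h1 : Tendsto (fun σ => ∫ y, F (Y σ y) ∂(heatLaw μ S)) (𝓝[>] 0)
      (𝓝 (∫ y, F (Y₀ y) ∂(heatLaw μ S))) := by
    refine tendsto_integral_filter_of_dominated_convergence (fun _ => ‖F‖)
      (Eventually.of_forall fun σ =>
        (F.continuous.measurable.comp (hYσ σ)).aestronglyMeasurable)
      (Eventually.of_forall fun σ => Eventually.of_forall fun y => F.norm_coe_le_norm _)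
      (integrable_const _) ?_
    filter_upwards [hlim] with y hy
    exact (F.continuous.tendsto _).comp hy
  have h2 : Tendsto (fun σ : ℝ => ∫ w, F (w.1 + σ • w.2) ∂(μ.prod (stdGaussian (Vec d))))
      (𝓝[>] 0) (𝓝 (∫ w, F w.1 ∂(μ.prod (stdGaussian (Vec d))))) := by
    refine tendsto_integral_filter_of_dominated_convergence (fun _ => ‖F‖)
      (Eventually.of_forall fun σ =>
        (F.continuous.comp (by fun_prop)).aestronglyMeasurable)
      (Eventually.of_forall fun σ => Eventually.of_forall fun y => F.norm_coe_le_norm _)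
      (integrable_const _) (Eventually.of_forall fun w => ?_)
    have hc : Continuous fun σ : ℝ => F (w.1 + σ • w.2) := F.continuous.comp (by fun_prop)
    simpa using (hc.tendsto 0).mono_left nhdsWithin_le_nhds
  have h3 : ∫ w, F w.1 ∂(μ.prod (stdGaussian (Vec d))) = ∫ x, F x ∂μ := by
    rw [integral_fun_fst (f := F)]; simp
  rw [h3] at h2
  refine tendsto_nhds_unique h1 (h2.congr' ?_)
  filter_upwards [Ioc_mem_nhdsGT hS] with σ hσ
  rw [← integral_map (hYσ σ).aemeasurable F.continuous.aestronglyMeasurable, hYl σ hσ, heatLaw,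
    integral_map (by fun_prop) F.continuous.aestronglyMeasurable]

theorem hasGradientAt_heatDens {σ : ℝ} (hσ : 0 < σ) (y : Vec d) :
    HasGradientAt (heatDens μ σ) (-(σ ^ 2)⁻¹ • heatMoment μ σ y) y := by
  have hcont : Continuous fun x : Vec d => -(heatExp σ (y - x) / σ ^ 2) • innerSL ℝ (y - x) := by
    have := (continuous_heatExp (d := d) σ)
    fun_prop
  have h := hasFDerivAt_integral_of_dominated_of_fderiv_le (𝕜 := ℝ) (μ := μ) (x₀ := y)
    (F := fun y x => heatExp σ (y - x))
    (F' := fun y x => -(heatExp σ (y - x) / σ ^ 2) • innerSL ℝ (y - x)) (bound := fun _ => 1 / σ)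
    univ_mem (Eventually.of_forall fun y => (integrable_heatExp μ σ y).aestronglyMeasurable)
    (integrable_heatExp μ σ y) hcont.aestronglyMeasurable
    (Eventually.of_forall fun x y _ => norm_fderiv_heatExp_le hσ _) (integrable_const _)
    (Eventually.of_forall fun x y _ => by
      simpa using! (hasFDerivAt_heatExp σ (y - x)).comp y ((hasFDerivAt_id y).sub_const x))
  rw [hasGradientAt_iff_hasFDerivAt]
  refine h.congr_fderiv ?_
  ext w
  have hi : Integrable (fun x => -(heatExp σ (y - x) / σ ^ 2) • innerSL ℝ (y - x)) μ :=
    Integrable.of_bound (C := 1 / σ) hcont.aestronglyMeasurable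
      (Eventually.of_forall fun x => norm_fderiv_heatExp_le hσ _)
  rw [ContinuousLinearMap.integral_apply hi, InnerProductSpace.toDual_apply_apply, heatMoment,
    inner_smul_left, real_inner_comm, ← integral_inner (integrable_heatExp_smul μ hσ y),
    ← integral_const_mul]
  refine integral_congr_ae (Eventually.of_forall fun x => ?_)
  simp only [smul_apply, innerSL_apply_apply, smul_eq_mul, inner_smul_right, real_inner_comm w]
  simp
  ring

end

/-! ### The score of the noised density -/

/-- The noise to signal ratio `√(1 - a) / √a`. -/
noncomputable def heatScale (a : ℝ) : ℝ := √(1 - a) / √a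

theorem heatScale_pos {a : ℝ} (ha : a ∈ Ioo (0 : ℝ) 1) : 0 < heatScale a :=
  div_pos (Real.sqrt_pos.2 (sub_pos.2 ha.2)) (Real.sqrt_pos.2 ha.1)

section
variable {d : ℕ}

theorem isProbabilityMeasure_pdfLaw {f : Vec d → ℝ} (hf1 : ∫⁻ x, ENNReal.ofReal (f x) = 1) :
    IsProbabilityMeasure (pdfLaw f) := ⟨by
  rw [pdfLaw, withDensity_apply _ MeasurableSet.univ, Measure.restrict_univ, hf1]⟩

/-- This is the dilation x_t = √a (x₀ + σz) with σ = `heatScale a`; the prefactor is constant in x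
and drops out of the score. -/
theorem noisyPdf_eq {f : Vec d → ℝ} (hf : Measurable f) (hf0 : ∀ x, 0 ≤ f x) {a : ℝ}
    (ha : a ∈ Ioo (0 : ℝ) 1) (x : Vec d) :
    noisyPdf a f x = (√(2 * Real.pi * (1 - a)))⁻¹ ^ d *
      heatDens (pdfLaw f) (heatScale a) ((√a)⁻¹ • x) := by
  rw [noisyPdf, heatDens, pdfLaw,
    integral_withDensity_eq_integral_toReal_smul hf.ennreal_ofReal (by simp), ← integral_const_mul]
  refine integral_congr_ae (Eventually.of_forall fun x₀ => ?_)
  simp only [noiseKernel, heatExp]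
  rw [ENNReal.toReal_ofReal (hf0 _), smul_eq_mul]
  have hsa : 0 < √a := Real.sqrt_pos.2 ha.1
  have h1a : 0 < 1 - a := sub_pos.2 ha.2
  have h1 : x - √a • x₀ = √a • ((√a)⁻¹ • x - x₀) := by
    rw [smul_sub, smul_inv_smul₀ hsa.ne']
  have h2 : -‖x - √a • x₀‖ ^ 2 / (2 * (1 - a)) =
      -‖(√a)⁻¹ • x - x₀‖ ^ 2 / (2 * heatScale a ^ 2) := by
    rw [h1, norm_smul, Real.norm_of_nonneg hsa.le, mul_pow, heatScale, div_pow,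
      Real.sq_sqrt ha.1.le, Real.sq_sqrt h1a.le]
    field_simp
  rw [h2]
  ring

theorem noisyLaw_eq {f : Vec d → ℝ} [IsProbabilityMeasure (pdfLaw f)] {a : ℝ} (ha : 0 < a) :
    noisyLaw a f = (heatLaw (pdfLaw f) (heatScale a)).map fun y => √a • y := by
  have hsa : 0 < √a := Real.sqrt_pos.2 ha
  rw [noisyLaw, heatLaw, Measure.map_map (by fun_prop) (by fun_prop)]
  congr 1
  ext1 w
  simp only [Function.comp_apply, heatScale, smul_add, smul_smul]
  rw [mul_div_cancel₀ _ hsa.ne']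

/-- Tweedie's formula: the score is -E[z | x_t = x]/√(1 - a). -/
theorem hasGradientAt_log_noisyPdf {f : Vec d → ℝ} [IsProbabilityMeasure (pdfLaw f)]
    (hf : Measurable f) (hf0 : ∀ x, 0 ≤ f x) {a : ℝ} (ha : a ∈ Ioo (0 : ℝ) 1) (x : Vec d) :
    HasGradientAt (fun y => Real.log (noisyPdf a f y))
      (-(√(1 - a))⁻¹ • heatField (pdfLaw f) (heatScale a) ((√a)⁻¹ • x)) x := by
  have hσ := heatScale_pos ha
  have hsa : 0 < √a := Real.sqrt_pos.2 ha.1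
  have hw : 0 < √(1 - a) := Real.sqrt_pos.2 (sub_pos.2 ha.2)
  have hc : 0 < (√(2 * Real.pi * (1 - a)))⁻¹ ^ d := by
    have : 0 < 1 - a := sub_pos.2 ha.2
    positivity
  set c := (√(2 * Real.pi * (1 - a)))⁻¹ ^ d
  have hR := heatDens_pos (pdfLaw f) (heatScale a) ((√a)⁻¹ • x)
  simp_rw [noisyPdf_eq hf hf0 ha]
  have h1 : HasFDerivAt (fun y : Vec d => (√a)⁻¹ • y) ((√a)⁻¹ • ContinuousLinearMap.id ℝ (Vec d)) x :=
    ((√a)⁻¹ • ContinuousLinearMap.id ℝ (Vec d)).hasFDerivAt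
  have h2 := (hasGradientAt_iff_hasFDerivAt.1
    (hasGradientAt_heatDens (pdfLaw f) hσ ((√a)⁻¹ • x)))
  have h3 := ((h2.comp x h1).const_mul c).log (mul_pos hc hR).ne'
  rw [hasGradientAt_iff_hasFDerivAt]
  refine h3.congr_fderiv ?_
  ext w
  simp only [smul_apply, ContinuousLinearMap.comp_apply, ContinuousLinearMap.id_apply,
    InnerProductSpace.toDual_apply_apply, heatField, inner_smul_left, inner_smul_right,
    smul_eq_mul, Function.comp_apply]
  have hσe : heatScale a * √a = √(1 - a) := by
    rw [heatScale]; field_simp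
  rw [← hσe]
  simp
  field_simp

theorem noisyPdf_pos {f : Vec d → ℝ} [IsProbabilityMeasure (pdfLaw f)]
    (hf : Measurable f) (hf0 : ∀ x, 0 ≤ f x) {a : ℝ} (ha : a ∈ Ioo (0 : ℝ) 1) (x : Vec d) :
    0 < noisyPdf a f x := by
  have : 0 < 1 - a := sub_pos.2 ha.2
  rw [noisyPdf_eq hf hf0 ha]
  exact mul_pos (by positivity) (heatDens_pos _ _ _)

end

/-! ### The probability flow -/

namespace IsSchedule

variable {T βmax : ℝ} {β : ℝ → ℝ}

theorem intervalIntegrable (hβ : IsSchedule T βmax β) {t : ℝ} (ht : t ∈ Icc 0 T) :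
    IntervalIntegrable β volume 0 t :=
  (hβ.continuousOn.mono (Icc_subset_Icc_right ht.2)).intervalIntegrable_of_Icc ht.1

theorem continuousOn_integral (hβ : IsSchedule T βmax β) (hT : 0 < T) :
    ContinuousOn (fun t => ∫ r in (0 : ℝ)..t, β r) (Icc 0 T) := by
  have h := intervalIntegral.continuousOn_primitive_interval (μ := volume) (f := β) (a := 0)
    (b := T) (by
      rw [uIcc_of_le hT.le]; exact hβ.continuousOn.integrableOn_Icc)
  rwa [uIcc_of_le hT.le] at h

theorem hasDerivAt_integral (hβ : IsSchedule T βmax β) {t : ℝ} (ht : t ∈ Ioo 0 T) :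
    HasDerivAt (fun t => ∫ r in (0 : ℝ)..t, β r) (β t) t := by
  have hnhds : Icc 0 T ∈ 𝓝 t := Icc_mem_nhds ht.1 ht.2
  exact intervalIntegral.integral_hasDerivAt_right
    (hβ.intervalIntegrable (Ioo_subset_Icc_self ht))
    (hβ.continuousOn.stronglyMeasurableAtFilter_nhdsWithin measurableSet_Icc t
      |>.filter_mono (by rw [nhdsWithin_eq_nhds.2 hnhds])) (hβ.continuousOn.continuousAt hnhds)

theorem integral_pos (hβ : IsSchedule T βmax β) {t : ℝ} (ht : t ∈ Ioc 0 T) :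
    0 < ∫ r in (0 : ℝ)..t, β r :=
  intervalIntegral.intervalIntegral_pos_of_pos_on (hβ.intervalIntegrable ⟨ht.1.le, ht.2⟩)
    (fun x hx => hβ.pos x ⟨hx.1.le, hx.2.le.trans ht.2⟩) ht.1

theorem integral_le (hβ : IsSchedule T βmax β) {t : ℝ} (ht : t ∈ Icc 0 T) :
    ∫ r in (0 : ℝ)..t, β r ≤ T * βmax := by
  have h := intervalIntegral.integral_mono_on ht.1 (hβ.intervalIntegrable ht)
    (intervalIntegrable_const (c := βmax)) (fun x hx => hβ.le x ⟨hx.1, hx.2.trans ht.2⟩)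
  rw [intervalIntegral.integral_const, smul_eq_mul, sub_zero] at h
  have h0 : 0 < βmax := (hβ.pos t ht).trans_le (hβ.le t ht)
  have := ht.2
  exact h.trans (by gcongr)

theorem continuousOn_alphaBar (hβ : IsSchedule T βmax β) (hT : 0 < T) :
    ContinuousOn (alphaBar β) (Icc 0 T) :=
  Real.continuous_exp.comp_continuousOn (hβ.continuousOn_integral hT).neg

theorem hasDerivAt_alphaBar (hβ : IsSchedule T βmax β) {t : ℝ} (ht : t ∈ Ioo 0 T) :
    HasDerivAt (alphaBar β) (-(β t * alphaBar β t)) t := by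
  have h := (hβ.hasDerivAt_integral ht).neg.exp
  refine h.congr_deriv ?_
  rw [alphaBar]; simp only [Pi.neg_apply]; ring

theorem alphaBar_mem (hβ : IsSchedule T βmax β) {t : ℝ} (ht : t ∈ Ioc 0 T) :
    alphaBar β t ∈ Ioo (0 : ℝ) 1 :=
  ⟨Real.exp_pos _, by
    rw [alphaBar, ← Real.exp_zero, Real.exp_lt_exp]
    exact neg_lt_zero.2 (hβ.integral_pos ht)⟩

theorem alphaBar_strictAnti (hβ : IsSchedule T βmax β) {s t : ℝ} (hs : 0 ≤ s) (hst : s < t)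
    (ht : t ≤ T) : alphaBar β t < alphaBar β s := by
  rw [alphaBar, alphaBar, Real.exp_lt_exp, neg_lt_neg_iff]
  have h1 := hβ.intervalIntegrable ⟨hs, hst.le.trans ht⟩
  have h2 := hβ.intervalIntegrable ⟨hs.trans hst.le, ht⟩
  rw [← sub_pos, intervalIntegral.integral_interval_sub_left h2 h1]
  refine intervalIntegral.intervalIntegral_pos_of_pos_on (h1.symm.trans h2) (fun x hx =>
    hβ.pos x ⟨hs.trans hx.1.le, hx.2.le.trans ht⟩) hst

theorem hasDerivAt_heatScale (hβ : IsSchedule T βmax β) {t : ℝ} (ht : t ∈ Ioo 0 T) :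
    HasDerivAt (fun t => heatScale (alphaBar β t))
      (β t / (2 * √(1 - alphaBar β t) * √(alphaBar β t))) t := by
  have ha := hβ.alphaBar_mem (Ioo_subset_Ioc_self ht)
  have h := hβ.hasDerivAt_alphaBar ht
  have h1a : 0 < 1 - alphaBar β t := sub_pos.2 ha.2
  have h1 := (h.const_sub 1).sqrt h1a.ne'
  have h2 := h.sqrt ha.1.ne'
  have hsa : 0 < √(alphaBar β t) := Real.sqrt_pos.2 ha.1
  have hw : 0 < √(1 - alphaBar β t) := Real.sqrt_pos.2 h1a
  refine (h1.div h2 hsa.ne').congr_deriv ?_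
  have e1 : alphaBar β t = √(alphaBar β t) ^ 2 := (Real.sq_sqrt ha.1.le).symm
  have e2 : √(1 - alphaBar β t) ^ 2 = 1 - alphaBar β t := Real.sq_sqrt h1a.le
  generalize √(1 - alphaBar β t) = w at *
  generalize hs : √(alphaBar β t) = s at *
  rw [e1] at e2 ⊢
  field_simp
  rw [e2]
  ring

end IsSchedule

theorem alphaBar_zero (β : ℝ → ℝ) : alphaBar β 0 = 1 := by simp [alphaBar]

theorem heatScale_lt {a b : ℝ} (ha : 0 < a) (hab : a < b) (hb : b ≤ 1) :
    heatScale b < heatScale a := by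
  have hsa : 0 < √a := Real.sqrt_pos.2 ha
  have h1 : √(1 - b) < √(1 - a) := Real.sqrt_lt_sqrt (by linarith) (by linarith)
  have h2 : √a ≤ √b := Real.sqrt_le_sqrt hab.le
  exact div_lt_div₀ h1 h2 (Real.sqrt_nonneg _) hsa

section
variable {d : ℕ} {T βmax : ℝ} {β : ℝ → ℝ} {f : Vec d → ℝ}

/-- The score is jointly continuous for positive times. -/
theorem continuousOn_score [IsProbabilityMeasure (pdfLaw f)] (hT : 0 < T)
    (hβ : IsSchedule T βmax β) (hf : Measurable f) (hf0 : ∀ x, 0 ≤ f x) :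
    ContinuousOn (fun p : ℝ × Vec d =>
      gradient (fun y => Real.log (noisyPdf (alphaBar β p.1) f y)) p.2) (Ioc 0 T ×ˢ univ) := by
  have hα : ContinuousOn (fun p : ℝ × Vec d => alphaBar β p.1) (Ioc 0 T ×ˢ univ) :=
    (hβ.continuousOn_alphaBar hT).comp continuousOn_fst fun p hp => ⟨hp.1.1.le, hp.1.2⟩
  have hmem : ∀ p ∈ Ioc 0 T ×ˢ (univ : Set (Vec d)), alphaBar β p.1 ∈ Ioo (0 : ℝ) 1 :=
    fun p hp => hβ.alphaBar_mem hp.1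
  have hform : EqOn (fun p : ℝ × Vec d =>
      gradient (fun y => Real.log (noisyPdf (alphaBar β p.1) f y)) p.2)
      (fun p => -(√(1 - alphaBar β p.1))⁻¹ • heatField (pdfLaw f) (heatScale (alphaBar β p.1))
        ((√(alphaBar β p.1))⁻¹ • p.2)) (Ioc 0 T ×ˢ univ) := fun p hp =>
    (hasGradientAt_log_noisyPdf hf hf0 (hmem p hp) p.2).gradient
  refine ContinuousOn.congr ?_ hform
  have h1 : ContinuousOn (fun p : ℝ × Vec d => √(1 - alphaBar β p.1)) (Ioc 0 T ×ˢ univ) :=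
    (continuousOn_const.sub hα).sqrt
  have h2 : ContinuousOn (fun p : ℝ × Vec d => √(alphaBar β p.1)) (Ioc 0 T ×ˢ univ) := hα.sqrt
  have h2' : ∀ p ∈ Ioc 0 T ×ˢ (univ : Set (Vec d)), √(alphaBar β p.1) ≠ 0 := fun p hp =>
    (Real.sqrt_pos.2 (hmem p hp).1).ne'
  have h3 : ContinuousOn (fun p : ℝ × Vec d => (heatScale (alphaBar β p.1),
      (√(alphaBar β p.1))⁻¹ • p.2)) (Ioc 0 T ×ˢ univ) :=
    (h1.div h2 h2').prodMk ((h2.inv₀ h2').smul continuousOn_snd)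
  have h4 : ContinuousOn (fun q : ℝ × Vec d => heatField (pdfLaw f) q.1 q.2) (Ioi 0 ×ˢ univ) :=
    fun q hq => (continuousAt_heatField (pdfLaw f) hq.1 q.2).continuousWithinAt
  exact (h1.inv₀ fun p hp => (Real.sqrt_pos.2 (sub_pos.2 (hmem p hp).2)).ne').neg.smul
    (h4.comp h3 fun p hp => ⟨heatScale_pos (hmem p hp), trivial⟩)

/-- The probability flow: solutions of `dy/dt = -(β_t/2) (y + ∇ log p_t(y))` whose law at time `t`
is that of `x_t`, and which converge to a variable with the law of `x₀` as `t → 0`. -/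
theorem exists_probabilityFlow [IsProbabilityMeasure (pdfLaw f)] (hT : 0 < T)
    (hβ : IsSchedule T βmax β) (hf : Measurable f) (hf0 : ∀ x, 0 ≤ f x) :
    ∃ (Y : ℝ → Vec d → Vec d) (Y₀ : Vec d → Vec d),
      Measurable (fun p : ℝ × Vec d => Y p.1 p.2) ∧ (∀ x, Y T x = x) ∧
      (∀ x, ContinuousOn (fun t => Y t x) (Ioc 0 T)) ∧
      (∀ x, ∀ t ∈ Ioo 0 T, HasDerivAt (fun t => Y t x) (-(β t / 2) • (Y t x +
        gradient (fun y => Real.log (noisyPdf (alphaBar β t) f y)) (Y t x))) t) ∧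
      (∀ t ∈ Ioc 0 T, (noisyLaw (alphaBar β T) f).map (Y t) = noisyLaw (alphaBar β t) f) ∧
      Measurable Y₀ ∧ (noisyLaw (alphaBar β T) f).map Y₀ = pdfLaw f ∧
      ∀ᵐ x ∂(noisyLaw (alphaBar β T) f), Tendsto (fun t => Y t x) (𝓝[>] 0) (𝓝 (Y₀ x)) := by
  set S := heatScale (alphaBar β T) with hSdef
  have hTmem : T ∈ Ioc 0 T := ⟨hT, le_rfl⟩
  have hS : 0 < S := heatScale_pos (hβ.alphaBar_mem hTmem)
  have hsT : 0 < √(alphaBar β T) := Real.sqrt_pos.2 (Real.exp_pos _)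
  obtain ⟨H, hHm, hHS, hHc, hHd, hHl⟩ := exists_flow_heatLaw (pdfLaw f) hS
  obtain ⟨H₀, hH₀m, hH₀l, hH₀⟩ := exists_limit_flow_heatLaw (pdfLaw f) hHm hHc hHd hHl hS
  have hσmem : ∀ t ∈ Ioc 0 T, heatScale (alphaBar β t) ∈ Ioc 0 S := by
    intro t ht
    refine ⟨heatScale_pos (hβ.alphaBar_mem ht), ?_⟩
    rcases ht.2.eq_or_lt with h | h
    · rw [h]
    · exact (heatScale_lt (Real.exp_pos _) (hβ.alphaBar_strictAnti ht.1.le h le_rfl)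
        (hβ.alphaBar_mem ht).2.le).le
  have hσmem' : ∀ t ∈ Ioo 0 T, heatScale (alphaBar β t) ∈ Ioo 0 S := fun t ht =>
    ⟨(hσmem t (Ioo_subset_Ioc_self ht)).1,
      heatScale_lt (Real.exp_pos _) (hβ.alphaBar_strictAnti ht.1.le ht.2 le_rfl)
        (hβ.alphaBar_mem (Ioo_subset_Ioc_self ht)).2.le⟩
  -- Freezing ᾱ outside [0, T] makes it continuous on the line, since joint measurability of the
  -- flow is claimed for all real t.
  set A : ℝ → ℝ := fun t => alphaBar β (projIcc 0 T hT.le t) with hAdef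
  have hAc : Continuous A :=
    (hβ.continuousOn_alphaBar hT).comp_continuous (by fun_prop) fun t => (projIcc 0 T hT.le t).2
  have hA : ∀ t ∈ Icc 0 T, A t = alphaBar β t := fun t ht => by
    rw [hAdef]; simp only; rw [projIcc_of_mem _ ht]
  have hAσ : Measurable fun t => heatScale (A t) := by
    have := hAc.measurable
    unfold heatScale
    fun_prop
  have hlaw : (heatLaw (pdfLaw f) S).map (fun y => √(alphaBar β T) • y) =
      noisyLaw (alphaBar β T) f := (noisyLaw_eq (Real.exp_pos _)).symm
  have hback : (noisyLaw (alphaBar β T) f).map (fun x => (√(alphaBar β T))⁻¹ • x) =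
      heatLaw (pdfLaw f) S := by
    rw [← hlaw, Measure.map_map (by fun_prop) (by fun_prop)]
    have : (fun x : Vec d => (√(alphaBar β T))⁻¹ • x) ∘ (fun y => √(alphaBar β T) • y) = id := by
      ext1 y; simp [inv_smul_smul₀ hsT.ne']
    rw [this, Measure.map_id]
  have hα0 : Tendsto (fun t => alphaBar β t) (𝓝[>] 0) (𝓝 1) := by
    have h := (hβ.continuousOn_alphaBar hT 0 (left_mem_Icc.2 hT.le)).tendsto.mono_left
      (nhdsWithin_mono 0 Ioc_subset_Icc_self)
    rw [nhdsWithin_Ioc_eq_nhdsGT hT] at h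
    simpa [alphaBar_zero] using h
  have hσ0 : Tendsto (fun t => heatScale (alphaBar β t)) (𝓝[>] 0) (𝓝[>] 0) := by
    refine tendsto_nhdsWithin_iff.2 ⟨?_, ?_⟩
    · have h1 := (hα0.const_sub 1).sqrt.div hα0.sqrt (by simp)
      rw [sub_self, Real.sqrt_zero, zero_div] at h1
      exact h1
    · filter_upwards [Ioc_mem_nhdsGT hT] with t ht
      exact (hσmem t ht).1
  obtain ⟨Y, hY⟩ : ∃ Y : ℝ → Vec d → Vec d, ∀ t x,
      Y t x = √(A t) • H (heatScale (A t)) ((√(alphaBar β T))⁻¹ • x) := ⟨_, fun _ _ => rfl⟩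
  have hYA : ∀ t ∈ Icc 0 T, ∀ x,
      Y t x = √(alphaBar β t) • H (heatScale (alphaBar β t)) ((√(alphaBar β T))⁻¹ • x) :=
    fun t ht x => by rw [hY, hA t ht]
  have hsc : Measurable fun x : Vec d => (√(alphaBar β T))⁻¹ • x := by fun_prop
  have hYm : Measurable fun p : ℝ × Vec d => Y p.1 p.2 := by
    simp_rw [hY]
    have h1 := hAc.measurable
    have h2 : Measurable fun p : ℝ × Vec d => √(A p.1) := by fun_prop
    exact h2.smul (hHm.comp (Measurable.prodMk
      (hAσ.comp measurable_fst) (hsc.comp measurable_snd)))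
  refine ⟨Y, fun x => H₀ ((√(alphaBar β T))⁻¹ • x), hYm, fun x => ?_, fun x => ?_,
    fun x t ht => ?_, fun t ht => ?_, hH₀m.comp hsc, ?_, ?_⟩
  · rw [hYA T ⟨hT.le, le_rfl⟩, ← hSdef, hHS, smul_inv_smul₀ hsT.ne']
  · have h1 : ContinuousOn (fun t => √(alphaBar β t) • H (heatScale (alphaBar β t))
        ((√(alphaBar β T))⁻¹ • x)) (Ioc 0 T) := by
      have hα := (hβ.continuousOn_alphaBar hT).mono (Ioc_subset_Icc_self)
      have hσ : ContinuousOn (fun t => heatScale (alphaBar β t)) (Ioc 0 T) :=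
        (continuousOn_const.sub hα).sqrt.div hα.sqrt fun t ht =>
          (Real.sqrt_pos.2 (Real.exp_pos _)).ne'
      exact hα.sqrt.smul ((hHc _).comp hσ hσmem)
    exact h1.congr fun t ht => hYA t ⟨ht.1.le, ht.2⟩ x
  · have ha := hβ.alphaBar_mem (Ioo_subset_Ioc_self ht)
    have h1 := (hβ.hasDerivAt_alphaBar ht).sqrt ha.1.ne'
    -- Change of time t ↦ σ(t). Multiplied by √ᾱ, its speed is β/(2√(1 - ᾱ)), which by Tweedie's
    -- formula gives the score term; the derivative of √ᾱ gives the term -(β/2)Y.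
    have h2 := (hHd ((√(alphaBar β T))⁻¹ • x) _ (hσmem' t ht)).scomp t (hβ.hasDerivAt_heatScale ht)
    have h3 := h1.smul h2
    have hev : (fun t => Y t x) =ᶠ[𝓝 t]
        fun t => √(alphaBar β t) • H (heatScale (alphaBar β t)) ((√(alphaBar β T))⁻¹ • x) := by
      filter_upwards [Icc_mem_nhds ht.1 ht.2] with r hr
      exact hYA r hr x
    refine (h3.congr_of_eventuallyEq hev).congr_deriv ?_
    rw [hYA t (Ioo_subset_Icc_self ht), (hasGradientAt_log_noisyPdf hf hf0 ha _).gradient]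
    have hsa : 0 < √(alphaBar β t) := Real.sqrt_pos.2 ha.1
    have hw : 0 < √(1 - alphaBar β t) := Real.sqrt_pos.2 (sub_pos.2 ha.2)
    rw [inv_smul_smul₀ hsa.ne']
    simp only [Function.comp_apply, smul_add, smul_smul]
    rw [add_comm]
    congr 2
    · rw [neg_div, neg_mul, neg_inj]
      have e1 : alphaBar β t = √(alphaBar β t) ^ 2 := (Real.sq_sqrt ha.1.le).symm
      nth_rewrite 1 [e1]
      field_simp
    · field_simp
  · have e : Y t =
        (fun y => √(alphaBar β t) • y) ∘ H (heatScale (alphaBar β t)) ∘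
          (fun x => (√(alphaBar β T))⁻¹ • x) := by
      ext1 x
      exact hYA t ⟨ht.1.le, ht.2⟩ x
    have hHσ : Measurable (H (heatScale (alphaBar β t))) := hHm.comp measurable_prodMk_left
    rw [e, ← Measure.map_map (by fun_prop) (hHσ.comp (by fun_prop)),
      ← Measure.map_map hHσ (by fun_prop), hback, hHl _ (hσmem t ht)]
    exact (noisyLaw_eq (Real.exp_pos _)).symm
  · rw [← hH₀l, ← hback, Measure.map_map hH₀m (by fun_prop)]
    rfl
  · have h1 : ∀ᵐ x ∂(noisyLaw (alphaBar β T) f),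
        Tendsto (fun σ => H σ ((√(alphaBar β T))⁻¹ • x)) (𝓝[>] 0)
          (𝓝 (H₀ ((√(alphaBar β T))⁻¹ • x))) :=
      ae_of_ae_map hsc.aemeasurable (by rw [hback]; exact hH₀)
    filter_upwards [h1] with x hx
    have h2 := hα0.sqrt.smul (hx.comp hσ0)
    rw [Real.sqrt_one, one_smul] at h2
    refine h2.congr' ?_
    filter_upwards [Ioc_mem_nhdsGT hT] with t ht
    exact (hYA t ⟨ht.1.le, ht.2⟩ x).symm

end

/-! ### Stability of the reverse-time dynamics -/

/-- A backward Grönwall inequality: `κ = K'` controls the expansion and `m` the forcing. -/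
theorem norm_sub_le_of_inner_deriv_ge {E : Type*} [NormedAddCommGroup E] [InnerProductSpace ℝ E]
    {X Y X' Y' : ℝ → E} {K κ m : ℝ → ℝ} {p q : ℝ} (hpq : p ≤ q)
    (hXc : ContinuousOn X (Icc p q)) (hYc : ContinuousOn Y (Icc p q))
    (hX : ∀ t ∈ Ioo p q, HasDerivAt X (X' t) t) (hY : ∀ t ∈ Ioo p q, HasDerivAt Y (Y' t) t)
    (hKc : ContinuousOn K (Icc p q)) (hK : ∀ t ∈ Ioo p q, HasDerivAt K (κ t) t)
    (hκ : ∀ t ∈ Ioo p q, 0 ≤ κ t) (hm : ∀ t ∈ Icc p q, 0 ≤ m t) (hmc : ContinuousOn m (Icc p q))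
    (hin : ∀ t ∈ Ioo p q, -inner ℝ (X t - Y t) (X' t - Y' t) ≤
      κ t * ‖X t - Y t‖ ^ 2 + m t * ‖X t - Y t‖) :
    ‖X p - Y p‖ ≤ Real.exp (K q - K p) * (‖X q - Y q‖ + ∫ t in p..q, m t) := by
  have hKmono : MonotoneOn K (Icc p q) := by
    refine monotoneOn_of_deriv_nonneg (convex_Icc _ _) hKc ?_ ?_
    · rw [interior_Icc]
      exact fun t ht => (hK t ht).differentiableAt.differentiableWithinAt
    · rw [interior_Icc]
      exact fun t ht => (hK t ht).deriv ▸ hκ t ht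
  -- The norm is not differentiable at 0; √(‖·‖² + η) is, and η tends to 0 at the end.
  have key : ∀ η : ℝ, 0 < η → ‖X p - Y p‖ ≤
      Real.exp (K q - K p) * (√(‖X q - Y q‖ ^ 2 + η) + ∫ t in p..q, m t) := by
    intro η hη
    set r : ℝ → ℝ := fun t => √(‖X t - Y t‖ ^ 2 + η) with hr
    have hr0 : ∀ t, 0 < r t := fun t => Real.sqrt_pos.2 (by positivity)
    have hrle : ∀ t, ‖X t - Y t‖ ≤ r t := fun t =>
      Real.le_sqrt_of_sq_le (by linarith)
    have hrsq : ∀ t, r t ^ 2 = ‖X t - Y t‖ ^ 2 + η := fun t => Real.sq_sqrt (by positivity)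
    have hrc : ContinuousOn r (Icc p q) := (((hXc.sub hYc).norm.pow 2).add continuousOn_const).sqrt
    have hmi : IntervalIntegrable m volume p q := hmc.intervalIntegrable_of_Icc hpq
    set I : ℝ → ℝ := fun t => ∫ u in p..t, m u with hI
    have hIc : ContinuousOn I (Icc p q) := by
      have h := intervalIntegral.continuousOn_primitive_interval (μ := volume) (f := m) (a := p)
        (b := q) (by rw [uIcc_of_le hpq]; exact hmc.integrableOn_Icc)
      rwa [uIcc_of_le hpq] at h
    have hId : ∀ t ∈ Ioo p q, HasDerivAt I (m t) t := fun t ht => by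
      have hnhds : Icc p q ∈ 𝓝 t := Icc_mem_nhds ht.1 ht.2
      exact intervalIntegral.integral_hasDerivAt_right
        ((hmc.mono (Icc_subset_Icc_right ht.2.le)).intervalIntegrable_of_Icc ht.1.le)
        (hmc.stronglyMeasurableAtFilter_nhdsWithin measurableSet_Icc t
          |>.filter_mono (by rw [nhdsWithin_eq_nhds.2 hnhds])) (hmc.continuousAt hnhds)
    have hrd : ∀ t ∈ Ioo p q,
        HasDerivAt r (inner ℝ (X t - Y t) (X' t - Y' t) / r t) t := fun t ht => by
      have h1 := (((hX t ht).sub (hY t ht)).norm_sq.add_const η).sqrt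
        (by simp only [Pi.sub_apply]; positivity)
      refine h1.congr_deriv ?_
      simp only [Pi.sub_apply]
      rw [mul_div_mul_left _ _ (by norm_num)]
    -- The derivative is at least m(e^{K(q)} - e^{K(t)}), nonnegative because K is nondecreasing.
    -- Comparing the values at p and q gives the claim.
    have hG : MonotoneOn (fun t => r t * Real.exp (K t) + Real.exp (K q) * I t) (Icc p q) := by
      have hd : ∀ t ∈ Ioo p q, HasDerivAt (fun t => r t * Real.exp (K t) + Real.exp (K q) * I t)
          (inner ℝ (X t - Y t) (X' t - Y' t) / r t * Real.exp (K t) +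
            r t * (Real.exp (K t) * κ t) + Real.exp (K q) * m t) t := fun t ht =>
        ((hrd t ht).mul (hK t ht).exp).add ((hId t ht).const_mul _)
      refine monotoneOn_of_deriv_nonneg (convex_Icc _ _)
        ((hrc.mul hKc.rexp).add (continuousOn_const.mul hIc)) ?_ ?_
      · rw [interior_Icc]
        exact fun t ht => (hd t ht).differentiableAt.differentiableWithinAt
      · rw [interior_Icc]
        intro t ht
        rw [(hd t ht).deriv]
        have htI := Ioo_subset_Icc_self ht
        have h1 : -(κ t * r t + m t) ≤ inner ℝ (X t - Y t) (X' t - Y' t) / r t := by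
          rw [le_div_iff₀ (hr0 t)]
          have h2 := hin t ht
          have h3 : κ t * ‖X t - Y t‖ ^ 2 ≤ κ t * (r t * r t) := by
            have := hκ t ht
            rw [pow_two]
            gcongr <;> exact hrle t
          have h4 : m t * ‖X t - Y t‖ ≤ m t * r t := by
            have := hm t htI
            gcongr
            exact hrle t
          nlinarith
        have h5 : Real.exp (K t) ≤ Real.exp (K q) :=
          Real.exp_le_exp.2 (hKmono htI (right_mem_Icc.2 hpq) ht.2.le)
        have h6 : 0 < Real.exp (K t) := Real.exp_pos _
        have h7 := hm t htI
        have h8 := mul_le_mul_of_nonneg_right h1 h6.le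
        have h9 := mul_le_mul_of_nonneg_right h5 h7
        nlinarith
    have hfin := hG (left_mem_Icc.2 hpq) (right_mem_Icc.2 hpq) hpq
    simp only [hI, intervalIntegral.integral_same, mul_zero, add_zero] at hfin
    rw [Real.exp_sub, div_mul_eq_mul_div, le_div_iff₀ (Real.exp_pos _)]
    calc ‖X p - Y p‖ * Real.exp (K p) ≤ r p * Real.exp (K p) := by
          have := hrle p
          gcongr
      _ ≤ _ := hfin
      _ = _ := by ring
  have hlim : Tendsto (fun η : ℝ => Real.exp (K q - K p) *
      (√(‖X q - Y q‖ ^ 2 + η) + ∫ t in p..q, m t)) (𝓝[>] 0)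
      (𝓝 (Real.exp (K q - K p) * (‖X q - Y q‖ + ∫ t in p..q, m t))) := by
    have hc : Continuous fun η : ℝ => Real.exp (K q - K p) *
      (√(‖X q - Y q‖ ^ 2 + η) + ∫ t in p..q, m t) := by fun_prop
    have h := (hc.tendsto 0).mono_left (nhdsWithin_le_nhds (s := Ioi 0))
    simpa [Real.sqrt_sq (norm_nonneg _)] using h
  refine ge_of_tendsto hlim ?_
  filter_upwards [self_mem_nhdsWithin] with η hη
  exact key η hη

/-- A primitive of `(β / 2) (1 + Lg + Lε / √(1 - ᾱ))`. -/
noncomputable def expansionRate (Lε Lg : ℝ) (β : ℝ → ℝ) (t : ℝ) : ℝ :=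
  (∫ r in (0 : ℝ)..t, β r) / 2 * (1 + Lg) +
    Lε * (Real.log (1 + √(1 - alphaBar β t)) + (∫ r in (0 : ℝ)..t, β r) / 2)

/-- A bound for `expansionRate` on `[0, T]`. -/
noncomputable def expansionBound (T βmax Lε Lg : ℝ) : ℝ :=
  T * βmax / 2 * (1 + Lg) + Lε * (Real.log 2 + T * βmax / 2)

section
variable {T βmax Lε Lg : ℝ} {β : ℝ → ℝ}

theorem continuousOn_expansionRate (hT : 0 < T) (hβ : IsSchedule T βmax β) :
    ContinuousOn (expansionRate Lε Lg β) (Icc 0 T) := by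
  have h1 := hβ.continuousOn_integral hT
  have h2 : ContinuousOn (fun t => √(1 - alphaBar β t)) (Icc 0 T) :=
    (continuousOn_const.sub (hβ.continuousOn_alphaBar hT)).sqrt
  have h3 : ContinuousOn (fun t => Real.log (1 + √(1 - alphaBar β t))) (Icc 0 T) :=
    (continuousOn_const.add h2).log fun t _ =>
      (add_pos_of_pos_of_nonneg one_pos (Real.sqrt_nonneg (1 - alphaBar β t))).ne'
  exact ((h1.div_const 2).mul continuousOn_const).add
    (continuousOn_const.mul (h3.add (h1.div_const 2)))

/-- With w = √(1 - ᾱ), the derivative of log(1 + w) is β(1 - w²)/(2w(1 + w)) = β/(2w) - β/2. Half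
the integral of β restores β/(2w), so the singular rate has a bounded primitive. -/
theorem hasDerivAt_expansionRate (hβ : IsSchedule T βmax β) {t : ℝ} (ht : t ∈ Ioo 0 T) :
    HasDerivAt (expansionRate Lε Lg β)
      (β t / 2 * (1 + (Lε / √(1 - alphaBar β t) + Lg))) t := by
  have ha := hβ.alphaBar_mem (Ioo_subset_Ioc_self ht)
  have h1a : 0 < 1 - alphaBar β t := sub_pos.2 ha.2
  have hw : 0 < √(1 - alphaBar β t) := Real.sqrt_pos.2 h1a
  have h1 := (hβ.hasDerivAt_integral ht).div_const 2
  have h2 := ((((hβ.hasDerivAt_alphaBar ht).const_sub 1).sqrt h1a.ne').const_add 1).log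
    (by positivity)
  refine ((h1.mul_const (1 + Lg)).add ((h2.add h1).const_mul Lε)).congr_deriv ?_
  have e2 : alphaBar β t = 1 - √(1 - alphaBar β t) ^ 2 := by rw [Real.sq_sqrt h1a.le]; ring
  generalize √(1 - alphaBar β t) = w at *
  rw [e2]
  have : 1 + w ≠ 0 := by positivity
  field_simp
  ring

theorem expansionRate_nonneg (hβ : IsSchedule T βmax β) (hLε : 0 ≤ Lε) (hLg : 0 ≤ Lg) {t : ℝ}
    (ht : t ∈ Ioc 0 T) : 0 ≤ expansionRate Lε Lg β t := by
  have h1 := (hβ.integral_pos ht).le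
  have h2 : 0 ≤ Real.log (1 + √(1 - alphaBar β t)) :=
    Real.log_nonneg (by linarith [Real.sqrt_nonneg (1 - alphaBar β t)])
  unfold expansionRate
  positivity

theorem expansionRate_le (hβ : IsSchedule T βmax β) (hLε : 0 ≤ Lε) (hLg : 0 ≤ Lg) {t : ℝ}
    (ht : t ∈ Ioc 0 T) : expansionRate Lε Lg β t ≤ expansionBound T βmax Lε Lg := by
  have h1 := hβ.integral_le ⟨ht.1.le, ht.2⟩
  have h2 : √(1 - alphaBar β t) ≤ 1 :=
    Real.sqrt_le_one.2 (by linarith [(hβ.alphaBar_mem ht).1])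
  have h3 : Real.log (1 + √(1 - alphaBar β t)) ≤ Real.log 2 :=
    Real.log_le_log (by positivity) (by linarith)
  unfold expansionRate expansionBound
  gcongr

variable {d : ℕ}

/-- Comparison of a solution `X` of the reverse-time dynamics with drift `(β/2) (x + b)` and a
solution `Y` of the same equation with `b` replaced by `σ`. -/
theorem enorm_sub_le_of_reverse_dynamics (hT : 0 < T) (hβ : IsSchedule T βmax β) (hLε : 0 ≤ Lε)
    (hLg : 0 ≤ Lg) {b : ℝ → Vec d → Vec d}
    (hb : ∀ t ∈ Ioc 0 T, ∀ x y, |inner ℝ (x - y) (b t x - b t y)| ≤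
      (Lε / √(1 - alphaBar β t) + Lg) * ‖x - y‖ ^ 2)
    {X Y σ : ℝ → Vec d} {X₀ Y₀ : Vec d}
    (hXc : ContinuousOn X (Ioc 0 T)) (hYc : ContinuousOn Y (Ioc 0 T))
    (hX : ∀ t ∈ Ioo 0 T, HasDerivAt X (-(β t / 2) • (X t + b t (X t))) t)
    (hY : ∀ t ∈ Ioo 0 T, HasDerivAt Y (-(β t / 2) • (Y t + σ t)) t)
    (hm : ContinuousOn (fun t => b t (Y t) - σ t) (Ioc 0 T))
    (hX₀ : Tendsto X (𝓝[>] 0) (𝓝 X₀)) (hY₀ : Tendsto Y (𝓝[>] 0) (𝓝 Y₀)) :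
    ‖X₀ - Y₀‖ₑ ≤ ENNReal.ofReal (Real.exp (expansionBound T βmax Lε Lg)) *
      (‖X T - Y T‖ₑ + ∫⁻ t in Ioc 0 T, ENNReal.ofReal (β t / 2) * ‖b t (Y t) - σ t‖ₑ) := by
  -- The dynamics are controlled only for positive times: estimate on [p, T] with a bound free of p,
  -- then let p → 0.
  have hp : ∀ p ∈ Ioc 0 T, ‖X p - Y p‖ₑ ≤
      ENNReal.ofReal (Real.exp (expansionBound T βmax Lε Lg)) *
      (‖X T - Y T‖ₑ + ∫⁻ t in Ioc 0 T, ENNReal.ofReal (β t / 2) * ‖b t (Y t) - σ t‖ₑ) := by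
    intro p hp
    have hsub : Icc p T ⊆ Ioc 0 T := fun t ht => ⟨hp.1.trans_le ht.1, ht.2⟩
    have hsub' : Ioo p T ⊆ Ioo 0 T := fun t ht => ⟨hp.1.trans ht.1, ht.2⟩
    have hβ0 : ∀ t ∈ Ioc 0 T, 0 ≤ β t := fun t ht => (hβ.pos t ⟨ht.1.le, ht.2⟩).le
    set m : ℝ → ℝ := fun t => β t / 2 * ‖b t (Y t) - σ t‖ with hmdef
    have hmc : ContinuousOn m (Icc p T) :=
      ((hβ.continuousOn.mono (hsub.trans Ioc_subset_Icc_self)).div_const 2).mul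
        (hm.mono hsub).norm
    have hm0 : ∀ t ∈ Icc p T, 0 ≤ m t := fun t ht => by
      have := hβ0 t (hsub ht)
      positivity
    have h := norm_sub_le_of_inner_deriv_ge (K := expansionRate Lε Lg β)
      (κ := fun t => β t / 2 * (1 + (Lε / √(1 - alphaBar β t) + Lg))) (m := m) hp.2
      (hXc.mono hsub) (hYc.mono hsub) (fun t ht => hX t (hsub' ht)) (fun t ht => hY t (hsub' ht))
      ((continuousOn_expansionRate hT hβ).mono (hsub.trans Ioc_subset_Icc_self))
      (fun t ht => hasDerivAt_expansionRate hβ (hsub' ht))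
      (fun t ht => by
        have := hβ0 t (Ioo_subset_Ioc_self (hsub' ht))
        positivity) hm0 hmc
      (fun t ht => by
        have htc := Ioo_subset_Ioc_self (hsub' ht)
        have h0 := hβ0 t htc
        have h1 := (abs_le.1 (hb t htc (X t) (Y t))).2
        -- The linear part and the increment of b form the expansion; the residual of b along Y is
        -- the forcing.
        have e : -(β t / 2) • (X t + b t (X t)) - -(β t / 2) • (Y t + σ t) =
            -(β t / 2) • ((X t - Y t) + (b t (X t) - b t (Y t)) + (b t (Y t) - σ t)) := by
          module
        rw [e, inner_smul_right, inner_add_right, inner_add_right, real_inner_self_eq_norm_sq]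
        have h2 : inner ℝ (X t - Y t) (b t (Y t) - σ t) ≤
            ‖X t - Y t‖ * ‖b t (Y t) - σ t‖ := real_inner_le_norm _ _
        have h3 := mul_le_mul_of_nonneg_left (add_le_add h1 h2) (by positivity : 0 ≤ β t / 2)
        simp only [hmdef]
        nlinarith)
    have hK : expansionRate Lε Lg β T - expansionRate Lε Lg β p ≤
        expansionBound T βmax Lε Lg := by
      have h1 := expansionRate_le hβ hLε hLg (t := T) ⟨hT, le_rfl⟩
      have h2 := expansionRate_nonneg hβ hLε hLg hp
      linarith
    have hI0 : 0 ≤ ∫ t in p..T, m t := intervalIntegral.integral_nonneg hp.2 hm0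
    have h' : ‖X p - Y p‖ ≤ Real.exp (expansionBound T βmax Lε Lg) *
        (‖X T - Y T‖ + ∫ t in p..T, m t) := h.trans (by gcongr)
    have hmi : IntegrableOn m (Ioc p T) := hmc.integrableOn_Icc.mono_set Ioc_subset_Icc_self
    calc ‖X p - Y p‖ₑ = ENNReal.ofReal ‖X p - Y p‖ := (ofReal_norm _).symm
      _ ≤ ENNReal.ofReal (Real.exp (expansionBound T βmax Lε Lg) *
          (‖X T - Y T‖ + ∫ t in p..T, m t)) := ENNReal.ofReal_le_ofReal h'
      _ = ENNReal.ofReal (Real.exp (expansionBound T βmax Lε Lg)) *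
          (‖X T - Y T‖ₑ + ∫⁻ t in Ioc p T, ENNReal.ofReal (m t)) := by
        rw [ENNReal.ofReal_mul (Real.exp_pos _).le, ENNReal.ofReal_add (norm_nonneg _) hI0,
          ofReal_norm, intervalIntegral.integral_of_le hp.2,
          ofReal_integral_eq_lintegral_ofReal hmi
          ((ae_restrict_iff' measurableSet_Ioc).2 (Eventually.of_forall fun t ht =>
            hm0 t (Ioc_subset_Icc_self ht)))]
      _ ≤ _ := by
        refine mul_le_mul' le_rfl (add_le_add le_rfl ?_)
        refine (lintegral_mono_set (Ioc_subset_Ioc_left hp.1.le)).trans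
          (setLIntegral_mono' measurableSet_Ioc fun t ht => ?_)
        rw [hmdef]
        simp only
        rw [ENNReal.ofReal_mul (by have := hβ0 t ht; positivity), ofReal_norm]
  refine le_of_tendsto (hX₀.sub hY₀).enorm ?_
  filter_upwards [Ioc_mem_nhdsGT hT] with p hp'
  exact hp p hp'

end

/-! ### The Wasserstein estimate -/

section
variable {d : ℕ} {T βmax Lε Lg : ℝ} {β : ℝ → ℝ}

theorem tendsto_nhdsGT_of_continuousOn_Icc {E : Type*} [TopologicalSpace E] {X : ℝ → E}
    (hT : 0 < T) (hX : ContinuousOn X (Icc 0 T)) : Tendsto X (𝓝[>] 0) (𝓝 (X 0)) := by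
  have h := (hX 0 (left_mem_Icc.2 hT.le)).tendsto.mono_left
    (nhdsWithin_mono 0 Ioc_subset_Icc_self)
  rwa [nhdsWithin_Ioc_eq_nhdsGT hT] at h

/-- The sampler is, almost surely, a continuous function of its starting point, and the paths
of the sampler start from a dense set of points. -/
theorem IsSampler.exists_continuous_map (hT : 0 < T) (hβ : IsSchedule T βmax β) (hLε : 0 ≤ Lε)
    (hLg : 0 ≤ Lg) {b : ℝ → Vec d → Vec d}
    (hb : ∀ t ∈ Ioc 0 T, ∀ x y, |inner ℝ (x - y) (b t x - b t y)| ≤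
      (Lε / √(1 - alphaBar β t) + Lg) * ‖x - y‖ ^ 2)
    {Ω : Type*} [MeasurableSpace Ω] {P : Measure Ω} {X : ℝ → Ω → Vec d}
    (hX : IsSampler P T (fun t x => (β t / 2) • (x + b t x)) X) :
    ∃ Ψ : Vec d → Vec d, Continuous Ψ ∧ P.map (X 0) = (stdGaussian (Vec d)).map Ψ ∧
      Dense {x | ∃ ξ : ℝ → Vec d, ξ T = x ∧ ξ 0 = Ψ x ∧ ContinuousOn ξ (Icc 0 T) ∧
        ∀ t ∈ Ioo 0 T, HasDerivAt ξ (-(β t / 2) • (ξ t + b t (ξ t))) t} := by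
  set G : Set Ω := {ω | ContinuousOn (fun t => X t ω) (Icc 0 T) ∧
    ∀ t ∈ Ioo 0 T, HasDerivAt (fun r => X r ω) (-(β t / 2) • (X t ω + b t (X t ω))) t} with hGdef
  have hG : ∀ᵐ ω ∂P, ω ∈ G := by
    filter_upwards [hX.continuousOn, hX.ode] with ω h1 h2
    exact ⟨h1, fun t ht => by simpa only [neg_smul] using h2 t ht⟩
  -- Two paths of the same equation: the forcing vanishes, leaving a Lipschitz dependence of X_0 on
  -- X_T.
  have hdist : ∀ ω ∈ G, ∀ ω' ∈ G, ‖X 0 ω - X 0 ω'‖ₑ ≤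
      ENNReal.ofReal (Real.exp (expansionBound T βmax Lε Lg)) * ‖X T ω - X T ω'‖ₑ := by
    intro ω hω ω' hω'
    have h := enorm_sub_le_of_reverse_dynamics hT hβ hLε hLg hb (X := fun t => X t ω)
      (Y := fun t => X t ω') (σ := fun t => b t (X t ω')) (hω.1.mono Ioc_subset_Icc_self)
      (hω'.1.mono Ioc_subset_Icc_self) hω.2 hω'.2 (by simpa using continuousOn_const)
      (tendsto_nhdsGT_of_continuousOn_Icc hT hω.1) (tendsto_nhdsGT_of_continuousOn_Icc hT hω'.1)
    simpa using h
  set A : Set (Vec d) := X T '' G with hA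
  have hex : ∀ x, ∃ y, x ∈ A → ∃ ω ∈ G, X T ω = x ∧ X 0 ω = y := by
    intro x
    by_cases hx : x ∈ A
    · obtain ⟨ω, hω, rfl⟩ := hx
      exact ⟨X 0 ω, fun _ => ⟨ω, hω, rfl, rfl⟩⟩
    · exact ⟨0, fun h => absurd h hx⟩
  choose Ψ₀ hΨ₀ using hex
  have hlip : LipschitzOnWith (Real.toNNReal (Real.exp (expansionBound T βmax Lε Lg))) Ψ₀ A := by
    intro x hx y hy
    obtain ⟨ω, hω, h1, h2⟩ := hΨ₀ x hx
    obtain ⟨ω', hω', h1', h2'⟩ := hΨ₀ y hy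
    rw [edist_eq_enorm_sub, edist_eq_enorm_sub, ← h2, ← h2']
    have := hdist ω hω ω' hω'
    rwa [h1, h1'] at this
  -- Extending from the starting set to the whole space gives a continuous, hence measurable, map
  -- without measurability of `A`.
  obtain ⟨Ψ, hΨ, hΨA⟩ := hlip.extend_finite_dimension
  have hXΨ : ∀ ω ∈ G, X 0 ω = Ψ (X T ω) := by
    intro ω hω
    have hmem : X T ω ∈ A := mem_image_of_mem _ hω
    obtain ⟨ω', hω', h1, h2⟩ := hΨ₀ _ hmem
    rw [← hΨA hmem, ← h2]
    have h3 := hdist ω hω ω' hω'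
    rw [h1, sub_self, enorm_zero, mul_zero, nonpos_iff_eq_zero, enorm_eq_zero, sub_eq_zero] at h3
    exact h3
  have hTm : AEMeasurable (X T) P := hX.aemeasurable T (right_mem_Icc.2 hT.le)
  refine ⟨Ψ, hΨ.continuous, ?_, ?_⟩
  · rw [← hX.init, AEMeasurable.map_map_of_aemeasurable
      hΨ.continuous.measurable.aemeasurable hTm]
    refine Measure.map_congr ?_
    filter_upwards [hG] with ω hω
    exact hXΨ ω hω
  · have hdense : Dense A := by
      have h1 : ∀ᵐ x ∂(stdGaussian (Vec d)), x ∈ closure A := by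
        rw [← hX.init]
        refine (ae_map_iff hTm (p := fun x => x ∈ closure A) isClosed_closure.measurableSet).2 ?_
        filter_upwards [hG] with ω hω
        exact subset_closure (mem_image_of_mem _ hω)
      have h2 := Measure.dense_of_ae h1
      exact dense_closure.1 h2
    refine hdense.mono ?_
    rintro _ ⟨ω, hω, rfl⟩
    exact ⟨fun t => X t ω, rfl, hXΨ ω hω, hω.1, hω.2⟩

theorem sq_lintegral_mul_le {α : Type*} [MeasurableSpace α] {μ : Measure α} {w g : α → ℝ≥0∞}
    (hw : AEMeasurable w μ) (hg : AEMeasurable g μ) :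
    (∫⁻ t, w t * g t ∂μ) ^ 2 ≤ (∫⁻ t, w t ∂μ) * ∫⁻ t, w t * g t ^ 2 ∂μ := by
  have h := ENNReal.lintegral_mul_le_Lp_mul_Lq μ Real.HolderConjugate.two_two
    (hw.pow_const (1 / 2 : ℝ)) ((hw.pow_const (1 / 2 : ℝ)).mul hg)
  have e0 : ∀ x : ℝ≥0∞, (x ^ (1 / 2 : ℝ)) ^ (2 : ℝ) = x := fun x => by
    rw [← ENNReal.rpow_mul]; norm_num
  have e1 : ∀ x : ℝ≥0∞, x ^ (1 / 2 : ℝ) * x ^ (1 / 2 : ℝ) = x := fun x => by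
    rw [← ENNReal.rpow_add_of_nonneg _ _ (by norm_num) (by norm_num)]; norm_num
  simp only [Pi.mul_apply, ← mul_assoc, e1, e0, ENNReal.mul_rpow_of_nonneg _ _ zero_le_two] at h
  simp only [ENNReal.rpow_two] at h
  calc (∫⁻ t, w t * g t ∂μ) ^ 2
      ≤ ((∫⁻ t, w t ∂μ) ^ (1 / 2 : ℝ) * (∫⁻ t, w t * g t ^ 2 ∂μ) ^ (1 / 2 : ℝ)) ^ 2 := by gcongr
    _ = _ := by rw [mul_pow, ← ENNReal.rpow_two, ← ENNReal.rpow_two, e0, e0]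

theorem ENNReal.add_sq_le_two_mul (x y : ℝ≥0∞) : (x + y) ^ 2 ≤ 2 * (x ^ 2 + y ^ 2) := by
  have h := ENNReal.rpow_add_le_mul_rpow_add_rpow x y (p := 2) one_le_two
  norm_num at h
  exact h

/-- Written as I/c - V ≤ cost of π, the bound has a left side free of π and passes to the infimum
without an optimal coupling. Subadditivity of the square root then separates V. -/
theorem W2_le_of_forall_coupling {μ ν μ' ν' : Measure (Vec d)} {c V : ℝ≥0∞} (hc0 : c ≠ 0)
    (hc : c ≠ ∞) (h : ∀ π, IsCoupling π μ' ν' → ∃ π', IsCoupling π' μ ν ∧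
      ∫⁻ z, ‖z.1 - z.2‖ₑ ^ 2 ∂π' ≤ c * ((∫⁻ z, ‖z.1 - z.2‖ₑ ^ 2 ∂π) + V)) :
    W2 μ ν ≤ c ^ (1 / 2 : ℝ) * (V ^ (1 / 2 : ℝ) + W2 μ' ν') := by
  set I := ⨅ (π : Measure (Vec d × Vec d)) (_ : IsCoupling π μ ν),
    ∫⁻ z, ‖z.1 - z.2‖ₑ ^ 2 ∂π with hI
  set I' := ⨅ (π : Measure (Vec d × Vec d)) (_ : IsCoupling π μ' ν'),
    ∫⁻ z, ‖z.1 - z.2‖ₑ ^ 2 ∂π with hI'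
  have h1 : I / c - V ≤ I' := by
    refine le_iInf₂ fun π hπ => ?_
    obtain ⟨π', hπ', hle⟩ := h π hπ
    rw [tsub_le_iff_right, ENNReal.div_le_iff hc0 hc, mul_comm]
    exact (iInf₂_le π' hπ').trans hle
  rw [tsub_le_iff_right, ENNReal.div_le_iff hc0 hc, mul_comm] at h1
  have h2 : W2 μ ν = I ^ (1 / 2 : ℝ) := rfl
  have h3 : W2 μ' ν' = I' ^ (1 / 2 : ℝ) := rfl
  rw [h2, h3]
  calc I ^ (1 / 2 : ℝ) ≤ (c * (I' + V)) ^ (1 / 2 : ℝ) := by gcongr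
    _ = c ^ (1 / 2 : ℝ) * (V + I') ^ (1 / 2 : ℝ) := by
      rw [ENNReal.mul_rpow_of_nonneg _ _ (by norm_num), add_comm]
    _ ≤ _ := by
      gcongr
      exact ENNReal.rpow_add_le_add_rpow _ _ (by norm_num) (by norm_num)

end

/-- The square of the constant of the Wasserstein estimate. -/
noncomputable def stabilityConst (T βmax Lε Lg : ℝ) : ℝ≥0∞ :=
  2 * ENNReal.ofReal (Real.exp (expansionBound T βmax Lε Lg)) ^ 2 *
    (1 + ENNReal.ofReal (T * βmax / 2))

theorem stabilityConst_ne_zero (T βmax Lε Lg : ℝ) : stabilityConst T βmax Lε Lg ≠ 0 := by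
  have h : ENNReal.ofReal (Real.exp (expansionBound T βmax Lε Lg)) ≠ 0 :=
    (ENNReal.ofReal_pos.2 (Real.exp_pos _)).ne'
  simp [stabilityConst, Real.exp_pos]

theorem stabilityConst_ne_top (T βmax Lε Lg : ℝ) : stabilityConst T βmax Lε Lg ≠ ∞ := by
  unfold stabilityConst
  finiteness

section
variable {d : ℕ} {T βmax Lε Lg : ℝ} {β : ℝ → ℝ}

/-- A field that is continuous for times in `(0, T]` agrees there with a measurable one. -/
theorem exists_measurable_eq_of_continuousOn {F : Type*} [TopologicalSpace F] [MeasurableSpace F]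
    [BorelSpace F] [Zero F] {e : ℝ × Vec d → F} (he : ContinuousOn e (Ioc 0 T ×ˢ univ)) :
    ∃ E : ℝ × Vec d → F, Measurable E ∧ ∀ t ∈ Ioc 0 T, ∀ y, E (t, y) = e (t, y) := by
  classical
  refine ⟨(Ioc 0 T ×ˢ univ).piecewise e (fun _ => 0), ?_, fun t ht y => ?_⟩
  · exact he.measurable_piecewise continuousOn_const (measurableSet_Ioc.prod MeasurableSet.univ)
  · exact piecewise_eq_of_mem _ _ _ ⟨ht, trivial⟩

/-- The law of the sample is as close to the target as the drift is to the drift of the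
probability flow and the initial law to the law of `x_T`. -/
theorem IsSampler.W2_le (hT : 0 < T) (hβ : IsSchedule T βmax β) (hLε : 0 ≤ Lε)
    (hLg : 0 ≤ Lg) {b : ℝ → Vec d → Vec d}
    (hb : ∀ t ∈ Ioc 0 T, ∀ x y, |inner ℝ (x - y) (b t x - b t y)| ≤
      (Lε / √(1 - alphaBar β t) + Lg) * ‖x - y‖ ^ 2)
    (hbc : ContinuousOn (fun z : ℝ × Vec d => b z.1 z.2) (Ioc 0 T ×ˢ univ))
    {f : Vec d → ℝ} [IsProbabilityMeasure (pdfLaw f)] (hf : Measurable f) (hf0 : ∀ x, 0 ≤ f x)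
    {Ω : Type*} [MeasurableSpace Ω] {P : Measure Ω} {X : ℝ → Ω → Vec d}
    (hX : IsSampler P T (fun t x => (β t / 2) • (x + b t x)) X) :
    W2 (pdfLaw f) (P.map (X 0)) ≤ stabilityConst T βmax Lε Lg ^ (1 / 2 : ℝ) *
      ((∫⁻ t in Ioc 0 T, ENNReal.ofReal (β t / 2) *
        ∫⁻ x, ‖b t x - gradient (fun y => Real.log (noisyPdf (alphaBar β t) f y)) x‖ₑ ^ 2
          ∂(noisyLaw (alphaBar β t) f)) ^ (1 / 2 : ℝ) +
        W2 (noisyLaw (alphaBar β T) f) (stdGaussian (Vec d))) := by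
  set s : ℝ → Vec d → Vec d :=
    fun t x => gradient (fun y => Real.log (noisyPdf (alphaBar β t) f y)) x with hs
  obtain ⟨Ψ, hΨ, hΨlaw, hΨd⟩ := hX.exists_continuous_map hT hβ hLε hLg hb
  obtain ⟨Y, Y₀, hYm, hYT, hYc, hYd, hYlaw, hY₀m, hY₀law, hY₀⟩ :=
    exists_probabilityFlow hT hβ hf hf0
  have hec : ContinuousOn (fun z : ℝ × Vec d => b z.1 z.2 - s z.1 z.2) (Ioc 0 T ×ˢ univ) :=
    hbc.sub (continuousOn_score hT hβ hf hf0)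
  obtain ⟨E, hE, hEe⟩ := exists_measurable_eq_of_continuousOn hec
  -- Dimension 0 specializes the lemma to functions of time alone.
  obtain ⟨w', hw', hwe'⟩ := exists_measurable_eq_of_continuousOn (d := 0) (T := T)
    (e := fun z => ENNReal.ofReal (β z.1 / 2)) (ENNReal.continuous_ofReal.comp_continuousOn
      (((hβ.continuousOn.mono Ioc_subset_Icc_self).comp continuousOn_fst
        fun z hz => hz.1).div_const 2))
  obtain ⟨w, hwm, hwe⟩ : ∃ w : ℝ → ℝ≥0∞, Measurable w ∧
      ∀ t ∈ Ioc 0 T, w t = ENNReal.ofReal (β t / 2) :=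
    ⟨fun t => w' (t, 0), hw'.comp (by fun_prop), fun t ht => hwe' t ht 0⟩
  have hwint : ∫⁻ t in Ioc 0 T, w t ≤ ENNReal.ofReal (T * βmax / 2) := by
    calc ∫⁻ t in Ioc 0 T, w t ≤ ∫⁻ t in Ioc 0 T, ENNReal.ofReal (βmax / 2) := by
          refine setLIntegral_mono' measurableSet_Ioc fun t ht => ?_
          rw [hwe t ht]
          have := hβ.le t ⟨ht.1.le, ht.2⟩
          gcongr
      _ = ENNReal.ofReal (T * βmax / 2) := by
        rw [setLIntegral_const, Real.volume_Ioc, sub_zero, ← ENNReal.ofReal_mul' hT.le]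
        congr 1; ring
  set C₀ := ENNReal.ofReal (Real.exp (expansionBound T βmax Lε Lg)) with hC₀
  set I : Vec d → ℝ≥0∞ := fun x => ∫⁻ t in Ioc 0 T, w t * ‖E (t, Y t x)‖ₑ with hI
  set J : Vec d → ℝ≥0∞ := fun x => ∫⁻ t in Ioc 0 T, w t * ‖E (t, Y t x)‖ₑ ^ 2 with hJ
  have hEY : Measurable fun p : Vec d × ℝ => ‖E (p.2, Y p.2 p.1)‖ₑ :=
    (hE.comp (measurable_snd.prodMk (hYm.comp measurable_swap))).enorm
  have hJm : Measurable fun p : Vec d × ℝ => w p.2 * ‖E (p.2, Y p.2 p.1)‖ₑ ^ 2 :=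
    (hwm.comp measurable_snd).mul (hEY.pow_const 2)
  have hJmeas : Measurable J := hJm.lintegral_prod_right'
  -- Cauchy–Schwarz in time with weight β/2, whose total mass is at most Tβmax/2.
  have hIJ : ∀ x, I x ^ 2 ≤ ENNReal.ofReal (T * βmax / 2) * J x := fun x =>
    (sq_lintegral_mul_le hwm.aemeasurable
      (hEY.comp measurable_prodMk_left).aemeasurable).trans (mul_le_mul' hwint le_rfl)
  -- The exceptional set involves x only. For fixed x the inequality is closed in y and holds on the
  -- dense set of sampler starts, so it holds for every y, and therefore almost surely under any
  -- coupling.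
  have hpt : ∀ᵐ x ∂(noisyLaw (alphaBar β T) f), ∀ y,
      ‖Y₀ x - Ψ y‖ₑ ≤ C₀ * (‖x - y‖ₑ + I x) := by
    filter_upwards [hY₀] with x hx y
    have hcl : IsClosed {y | ‖Y₀ x - Ψ y‖ₑ ≤ C₀ * (‖x - y‖ₑ + I x)} :=
      isClosed_le (continuous_const.sub hΨ).enorm ((ENNReal.continuous_const_mul
        ENNReal.ofReal_ne_top).comp
          ((continuous_const.sub continuous_id).enorm.add continuous_const))
    refine closure_minimal ?_ hcl (hΨd y)
    rintro _ ⟨ξ, rfl, hξ0, hξc, hξd⟩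
    have h := enorm_sub_le_of_reverse_dynamics hT hβ hLε hLg hb (X := ξ) (Y := fun t => Y t x)
      (σ := fun t => s t (Y t x)) (hξc.mono Ioc_subset_Icc_self) (hYc x) hξd (hYd x)
      (hec.comp (continuousOn_id.prodMk (hYc x)) fun t ht => ⟨ht, trivial⟩)
      (tendsto_nhdsGT_of_continuousOn_Icc hT hξc) hx
    have hIx : I x = ∫⁻ t in Ioc 0 T, ENNReal.ofReal (β t / 2) * ‖b t (Y t x) - s t (Y t x)‖ₑ :=
      setLIntegral_congr_fun measurableSet_Ioc fun t ht => by
        simp only [hwe t ht, hEe t ht]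
    rw [hYT, ← hIx, hξ0, enorm_sub_rev, enorm_sub_rev (ξ T)] at h
    exact h
  -- Tonelli, then transport: under the law at time T, `Y t` has the law of x_t, which is the law in
  -- the error functional.
  have hJint : ∫⁻ x, J x ∂(noisyLaw (alphaBar β T) f) = ∫⁻ t in Ioc 0 T, ENNReal.ofReal (β t / 2) *
      ∫⁻ x, ‖b t x - s t x‖ₑ ^ 2 ∂(noisyLaw (alphaBar β t) f) := by
    have : SFinite (noisyLaw (alphaBar β T) f) := by unfold noisyLaw; infer_instance
    rw [hJ, lintegral_lintegral_swap hJm.aemeasurable]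
    refine setLIntegral_congr_fun measurableSet_Ioc fun t ht => ?_
    have hYt : Measurable (Y t) := hYm.comp measurable_prodMk_left
    have hEt : Measurable fun x => ‖E (t, Y t x)‖ₑ :=
      (hE.comp (measurable_const.prodMk hYt)).enorm
    rw [lintegral_const_mul _ (hEt.pow_const 2), hwe t ht,
      ← hYlaw t ht]
    congr 1
    have h1 : ∀ x, b t x - s t x = E (t, x) := fun x => (hEe t ht x).symm
    simp_rw [h1]
    have hEm : Measurable fun x => ‖E (t, x)‖ₑ ^ 2 :=
      (hE.comp (measurable_const.prodMk measurable_id)).enorm.pow_const 2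
    rw [lintegral_map hEm hYt]
  refine W2_le_of_forall_coupling (stabilityConst_ne_zero _ _ _ _) (stabilityConst_ne_top _ _ _ _)
    fun π hπ => ?_
  have hmap : Measurable fun z : Vec d × Vec d => (Y₀ z.1, Ψ z.2) :=
    (hY₀m.comp measurable_fst).prodMk (hΨ.measurable.comp measurable_snd)
  refine ⟨π.map fun z => (Y₀ z.1, Ψ z.2), ⟨?_, ?_⟩, ?_⟩
  · rw [Measure.map_map measurable_fst hmap, ← hY₀law, ← hπ.1,
      Measure.map_map hY₀m measurable_fst]
    rfl
  · rw [Measure.map_map measurable_snd hmap, hΨlaw, ← hπ.2,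
      Measure.map_map hΨ.measurable measurable_snd]
    rfl
  · have hJ1 : Measurable fun z : Vec d × Vec d => J z.1 := hJmeas.comp measurable_fst
    rw [lintegral_map (by fun_prop) hmap, ← hJint, ← hπ.1, lintegral_map hJmeas measurable_fst,
      ← lintegral_add_right _ hJ1,
      ← lintegral_const_mul' _ _ (stabilityConst_ne_top _ _ _ _)]
    have hptπ : ∀ᵐ z ∂π, ∀ y, ‖Y₀ z.1 - Ψ y‖ₑ ≤ C₀ * (‖z.1 - y‖ₑ + I z.1) :=
      ae_of_ae_map measurable_fst.aemeasurable (by rw [hπ.1]; exact hpt)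
    refine lintegral_mono_ae ?_
    filter_upwards [hptπ] with z hz
    set W := ENNReal.ofReal (T * βmax / 2)
    calc ‖Y₀ z.1 - Ψ z.2‖ₑ ^ 2 ≤ (C₀ * (‖z.1 - z.2‖ₑ + I z.1)) ^ 2 := by
          have := hz z.2
          gcongr
      _ = C₀ ^ 2 * (‖z.1 - z.2‖ₑ + I z.1) ^ 2 := mul_pow _ _ _
      _ ≤ C₀ ^ 2 * (2 * (‖z.1 - z.2‖ₑ ^ 2 + W * J z.1)) := by
          have := ENNReal.add_sq_le_two_mul ‖z.1 - z.2‖ₑ (I z.1)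
          have h2 := hIJ z.1
          refine mul_le_mul' le_rfl (this.trans ?_)
          gcongr
      _ ≤ C₀ ^ 2 * (2 * ((1 + W) * (‖z.1 - z.2‖ₑ ^ 2 + J z.1))) := by
          gcongr
          rw [mul_add]
          gcongr
          · exact le_mul_of_one_le_left' le_self_add
          · exact le_add_self
      _ = _ := by unfold stabilityConst; ring

end

/-! ### The statistical model -/

namespace DataModel

variable {d s k₁ k₂ : ℕ} (M : DataModel d s k₁ k₂) (h : History s d) (c₁ : Vec k₁) (c₂ : Vec k₂)

theorem integrable_joint :
    Integrable (fun w : Vec d × Vec k₂ => M.joint h c₁ w.1 w.2) (volume.prod volume) := by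
  refine ⟨(M.measurable h c₁).aestronglyMeasurable, ?_⟩
  rw [hasFiniteIntegral_iff_ofReal (f := fun w : Vec d × Vec k₂ => M.joint h c₁ w.1 w.2)
      (Eventually.of_forall fun w => M.nonneg h c₁ w.1 w.2),
    ← Measure.volume_eq_prod, M.mass h c₁]
  exact ENNReal.one_lt_top

theorem measurable_cond1 : Measurable (M.cond1 h c₁) :=
  (M.measurable h c₁).stronglyMeasurable.integral_prod_right'.measurable

theorem cond1_nonneg (x₀ : Vec d) : 0 ≤ M.cond1 h c₁ x₀ :=
  integral_nonneg fun c₂ => M.nonneg h c₁ x₀ c₂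

/-- The Bochner integral in `cond1` equals Tonelli's inner integral only where the slice is
integrable, which is almost everywhere. -/
theorem lintegral_cond1 : ∫⁻ x, ENNReal.ofReal (M.cond1 h c₁ x) = 1 := by
  have hm : Measurable fun w : Vec d × Vec k₂ => ENNReal.ofReal (M.joint h c₁ w.1 w.2) :=
    (M.measurable h c₁).ennreal_ofReal
  rw [← M.mass h c₁, Measure.volume_eq_prod, lintegral_prod _ hm.aemeasurable]
  refine lintegral_congr_ae ?_
  filter_upwards [(M.integrable_joint h c₁).prod_right_ae] with x hx
  exact ofReal_integral_eq_lintegral_ofReal hx (Eventually.of_forall fun c₂ => M.nonneg h c₁ x c₂)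

theorem measurable_joint_left : Measurable fun x₀ => M.joint h c₁ x₀ c₂ :=
  (M.measurable h c₁).comp measurable_prodMk_right

theorem measurable_cond2 : Measurable (M.cond2 h c₁ c₂) :=
  (M.measurable_joint_left h c₁ c₂).div_const _

variable {h c₁ c₂}

theorem cond2_nonneg (hpos : 0 < M.evidence h c₁ c₂) (x₀ : Vec d) : 0 ≤ M.cond2 h c₁ c₂ x₀ :=
  div_nonneg (M.nonneg h c₁ x₀ c₂) hpos.le

theorem lintegral_cond2 (hpos : 0 < M.evidence h c₁ c₂) :
    ∫⁻ x, ENNReal.ofReal (M.cond2 h c₁ c₂ x) = 1 := by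
  -- Positive evidence encodes finiteness too: the Bochner integral of a non-integrable slice is 0.
  have hi : Integrable fun x₀ => M.joint h c₁ x₀ c₂ := by
    by_contra hni
    exact hpos.ne' (integral_undef hni)
  rw [← ofReal_integral_eq_lintegral_ofReal (f := M.cond2 h c₁ c₂) (hi.div_const _)
    (Eventually.of_forall (M.cond2_nonneg hpos))]
  simp only [cond2]
  rw [integral_div]
  change ENNReal.ofReal (M.evidence h c₁ c₂ / _) = 1
  rw [div_self hpos.ne', ENNReal.ofReal_one]

theorem noisyPdf_joint (hpos : 0 < M.evidence h c₁ c₂) (a : ℝ) (x : Vec d) :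
    noisyPdf a (fun x₀ => M.joint h c₁ x₀ c₂) x =
      M.evidence h c₁ c₂ * noisyPdf a (M.cond2 h c₁ c₂) x := by
  unfold noisyPdf
  rw [← integral_const_mul]
  refine integral_congr_ae (Eventually.of_forall fun x₀ => ?_)
  simp only [cond2]
  field_simp

/-- Bayes' rule for the scores. -/
theorem gradient_log_noisyPdf_cond2 (hpos : 0 < M.evidence h c₁ c₂) {a : ℝ}
    (ha : a ∈ Ioo (0 : ℝ) 1) (x : Vec d) :
    gradient (fun y => Real.log (noisyPdf a (M.cond2 h c₁ c₂) y)) x =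
      M.score h c₁ a x + M.guidance h c₁ c₂ a x := by
  have := isProbabilityMeasure_pdfLaw (M.lintegral_cond1 h c₁)
  have := isProbabilityMeasure_pdfLaw (M.lintegral_cond2 hpos)
  have h1 := hasGradientAt_log_noisyPdf (M.measurable_cond1 h c₁) (M.cond1_nonneg h c₁) ha x
  have h2 := hasGradientAt_log_noisyPdf (M.measurable_cond2 h c₁ c₂) (M.cond2_nonneg hpos) ha x
  have hp1 := noisyPdf_pos (M.measurable_cond1 h c₁) (M.cond1_nonneg h c₁) ha
  have hp2 := noisyPdf_pos (M.measurable_cond2 h c₁ c₂) (M.cond2_nonneg hpos) ha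
  -- The evidence does not depend on y and drops out of the gradient.
  have hlog : (fun y => Real.log (M.likelihood h c₁ c₂ a y)) = fun y =>
      Real.log (noisyPdf a (M.cond2 h c₁ c₂) y) - Real.log (noisyPdf a (M.cond1 h c₁) y) +
        Real.log (M.evidence h c₁ c₂) := by
    ext1 y
    rw [likelihood, M.noisyPdf_joint hpos, Real.log_div (mul_pos hpos (hp2 y)).ne' (hp1 y).ne',
      Real.log_mul hpos.ne' (hp2 y).ne']
    ring
  have h3 : HasGradientAt (fun y => Real.log (M.likelihood h c₁ c₂ a y))
      (gradient (fun y => Real.log (noisyPdf a (M.cond2 h c₁ c₂) y)) x - M.score h c₁ a x) x := by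
    rw [hlog, score, h1.gradient, h2.gradient, hasGradientAt_iff_hasFDerivAt, map_sub]
    exact (h2.hasFDerivAt.sub h1.hasFDerivAt).add_const _
  rw [guidance, h3.gradient, add_sub_cancel]

end DataModel

/-! ### Measurability of the error terms and the normal form of the drifts. -/

section
variable {d : ℕ} {T βmax : ℝ} {β : ℝ → ℝ}

/-- Writing x_t through (x₀, z) replaces the varying law by a fixed product measure, so Tonelli
applies. It serves to split the time integral of a sum of two errors, where measurability of one
summand suffices. -/
theorem aemeasurable_lintegral_noisyLaw (hT : 0 < T) (hβ : IsSchedule T βmax β) {f : Vec d → ℝ}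
    [IsProbabilityMeasure (pdfLaw f)] {u : ℝ → Vec d → ℝ≥0∞}
    (hu : ContinuousOn (fun z : ℝ × Vec d => u z.1 z.2) (Ioc 0 T ×ˢ univ)) :
    AEMeasurable (fun t => ∫⁻ x, u t x ∂(noisyLaw (alphaBar β t) f))
      (volume.restrict (Ioc 0 T)) := by
  obtain ⟨E, hE, hEe⟩ := exists_measurable_eq_of_continuousOn hu
  obtain ⟨A', hA', hAe'⟩ := exists_measurable_eq_of_continuousOn (d := 0) (T := T)
    (e := fun z => alphaBar β z.1) (((hβ.continuousOn_alphaBar hT).mono Ioc_subset_Icc_self).comp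
        continuousOn_fst fun z hz => hz.1)
  have hA : Measurable fun t : ℝ => A' (t, 0) := hA'.comp (by fun_prop)
  have hm : Measurable fun p : ℝ × (Vec d × Vec d) =>
      E (p.1, √(A' (p.1, 0)) • p.2.1 + √(1 - A' (p.1, 0)) • p.2.2) := by
    have h1 : Measurable fun p : ℝ × (Vec d × Vec d) => A' (p.1, 0) := hA.comp measurable_fst
    refine hE.comp (measurable_fst.prodMk ?_)
    exact (h1.sqrt.smul (measurable_fst.comp measurable_snd)).add
      ((h1.const_sub 1).sqrt.smul (measurable_snd.comp measurable_snd))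
  refine ⟨_, hm.lintegral_prod_right' (ν := (pdfLaw f).prod (stdGaussian (Vec d))), ?_⟩
  refine (ae_restrict_iff' measurableSet_Ioc).2 (Eventually.of_forall fun t ht => ?_)
  have hEt : Measurable fun x => E (t, x) := hE.comp measurable_prodMk_left
  have h1 : ∀ x, u t x = E (t, x) := fun x => (hEe t ht x).symm
  have h2 : A' (t, 0) = alphaBar β t := hAe' t ht 0
  simp_rw [h1, h2]
  rw [noisyLaw, lintegral_map hEt (by fun_prop)]

theorem drift1_eq (β : ℝ → ℝ) (ε : ℝ → Vec d → Vec d) :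
    drift1 β ε = fun t x => (β t / 2) • (x + -(√(1 - alphaBar β t))⁻¹ • ε t x) := by
  ext1 t; ext1 x
  rw [drift1, smul_add, smul_smul, sub_eq_add_neg, ← neg_smul]
  congr 2
  rw [div_mul_eq_div_div, div_eq_mul_inv (β t / 2), mul_neg]

theorem drift2_eq (β : ℝ → ℝ) (ε g : ℝ → Vec d → Vec d) :
    drift2 β ε g = fun t x => (β t / 2) • (x + (-(√(1 - alphaBar β t))⁻¹ • ε t x + g t x)) := by
  ext1 t; ext1 x
  rw [drift2, drift1_eq, ← smul_add, add_assoc]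

theorem IsRegularField.neg_inv_sqrt_smul {Lε : ℝ} {ε : ℝ → Vec d → Vec d}
    (hε : IsRegularField T Lε ε) {t : ℝ} (ht : t ∈ Ioc 0 T) (x y : Vec d) :
    |inner ℝ (x - y) (-(√(1 - alphaBar β t))⁻¹ • ε t x - -(√(1 - alphaBar β t))⁻¹ • ε t y)| ≤
      Lε / √(1 - alphaBar β t) * ‖x - y‖ ^ 2 := by
  rw [← smul_sub, inner_smul_right, abs_mul, abs_neg, abs_of_nonneg (by positivity),
    div_eq_inv_mul, mul_assoc]
  have := hε.lip t ht x y
  gcongr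

theorem continuousOn_inv_sqrt_smul (hT : 0 < T) (hβ : IsSchedule T βmax β)
    {ε : ℝ → Vec d → Vec d}
    (hε : ContinuousOn (fun z : ℝ × Vec d => ε z.1 z.2) (Ioc 0 T ×ˢ univ)) :
    ContinuousOn (fun z : ℝ × Vec d => (√(1 - alphaBar β z.1))⁻¹ • ε z.1 z.2)
      (Ioc 0 T ×ˢ univ) := by
  have hα : ContinuousOn (fun z : ℝ × Vec d => alphaBar β z.1) (Ioc 0 T ×ˢ univ) :=
    (hβ.continuousOn_alphaBar hT).comp continuousOn_fst fun z hz => ⟨hz.1.1.le, hz.1.2⟩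
  exact ((continuousOn_const.sub hα).sqrt.inv₀ fun z hz =>
    (Real.sqrt_pos.2 (sub_pos.2 (hβ.alphaBar_mem hz.1).2)).ne').smul hε

theorem half_lintegral_mul_eq (u : ℝ → ℝ≥0∞) :
    (1 / 2) * ∫⁻ t in Ioc 0 T, ENNReal.ofReal (β t) * u t =
      ∫⁻ t in Ioc 0 T, ENNReal.ofReal (β t / 2) * u t := by
  rw [← lintegral_const_mul' _ _ (by finiteness)]
  refine lintegral_congr fun t => ?_
  rw [div_eq_inv_mul, ENNReal.ofReal_mul (by norm_num), ENNReal.ofReal_inv_of_pos two_pos,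
    ENNReal.ofReal_ofNat, one_div, mul_assoc]

theorem enorm_sub_sq_le {E : Type*} [SeminormedAddCommGroup E] (x y : E) :
    ‖x - y‖ₑ ^ 2 ≤ 2 * (‖x‖ₑ ^ 2 + ‖y‖ₑ ^ 2) := by
  refine le_trans ?_ (ENNReal.add_sq_le_two_mul _ _)
  gcongr
  exact enorm_sub_le

end

/-! ### The stability estimate for the two samplers. -/

section
variable {d s k₁ k₂ : ℕ} {T βmax Lε Lg : ℝ} {β : ℝ → ℝ}

theorem continuous_of_continuousOn_prod {F : Type*} [TopologicalSpace F] {u : ℝ → Vec d → F}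
    (hu : ContinuousOn (fun z : ℝ × Vec d => u z.1 z.2) (Ioc 0 T ×ˢ univ)) {t : ℝ}
    (ht : t ∈ Ioc 0 T) : Continuous (u t) :=
  hu.comp_continuous (f := fun x => (t, x)) (by fun_prop) fun _ => ⟨ht, trivial⟩

theorem W2_cond1_le (hT : 0 < T) (hLε : 0 ≤ Lε) (hβ : IsSchedule T βmax β)
    (M : DataModel d s k₁ k₂) {ε : ℝ → Vec d → Vec d} (hε : IsRegularField T Lε ε)
    (h : History s d) (c₁ : Vec k₁) {Ω : Type*} [MeasurableSpace Ω] {P : Measure Ω}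
    {X : ℝ → Ω → Vec d} (hX : IsSampler P T (drift1 β ε) X) :
    W2 (pdfLaw (M.cond1 h c₁)) (P.map (X 0)) ≤ stabilityConst T βmax Lε 0 ^ (1 / 2 : ℝ) *
      ((M.errorScore h c₁ T β ε (M.cond1 h c₁)) ^ (1 / 2 : ℝ) +
        W2 (noisyLaw (alphaBar β T) (M.cond1 h c₁)) (stdGaussian (Vec d))) := by
  have := isProbabilityMeasure_pdfLaw (M.lintegral_cond1 h c₁)
  rw [drift1_eq] at hX
  have hmain := hX.W2_le hT hβ hLε le_rfl
    (fun t ht x y => by simpa only [add_zero] using hε.neg_inv_sqrt_smul ht x y)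
    (by
      simp only [neg_smul]
      exact (continuousOn_inv_sqrt_smul hT hβ hε.continuousOn).neg)
    (M.measurable_cond1 h c₁) (M.cond1_nonneg h c₁)
  refine hmain.trans_eq ?_
  rw [DataModel.errorScore, half_lintegral_mul_eq]
  have e : ∀ t x, ‖-(√(1 - alphaBar β t))⁻¹ • ε t x -
      gradient (fun y => Real.log (noisyPdf (alphaBar β t) (M.cond1 h c₁) y)) x‖ₑ =
      ‖(√(1 - alphaBar β t))⁻¹ • ε t x + M.score h c₁ (alphaBar β t) x‖ₑ := fun t x => by
    rw [DataModel.score, neg_smul, ← neg_add', enorm_neg]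
  simp_rw [e]

/-- By Bayes' rule the field error is the guidance error minus the score error. The square of a
difference costs a factor 2, hence √2 in the constant. -/
theorem W2_cond2_le (hT : 0 < T) (hLε : 0 ≤ Lε) (hLg : 0 ≤ Lg) (hβ : IsSchedule T βmax β)
    (M : DataModel d s k₁ k₂) {ε g : ℝ → Vec d → Vec d} (hε : IsRegularField T Lε ε)
    (hg : IsRegularField T Lg g) {h : History s d} {c₁ : Vec k₁} {c₂ : Vec k₂}
    (hpos : 0 < M.evidence h c₁ c₂) {Ω : Type*} [MeasurableSpace Ω] {P : Measure Ω}
    {X : ℝ → Ω → Vec d} (hX : IsSampler P T (drift2 β ε g) X) :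
    W2 (pdfLaw (M.cond2 h c₁ c₂)) (P.map (X 0)) ≤
      stabilityConst T βmax Lε Lg ^ (1 / 2 : ℝ) * 2 ^ (1 / 2 : ℝ) *
      ((M.errorScore h c₁ T β ε (M.cond2 h c₁ c₂) +
          M.errorGuidance h c₁ c₂ T β g (M.cond2 h c₁ c₂)) ^ (1 / 2 : ℝ) +
        W2 (noisyLaw (alphaBar β T) (M.cond2 h c₁ c₂)) (stdGaussian (Vec d))) := by
  have := isProbabilityMeasure_pdfLaw (M.lintegral_cond1 h c₁)
  have := isProbabilityMeasure_pdfLaw (M.lintegral_cond2 hpos)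
  rw [drift2_eq] at hX
  have hεc := continuousOn_inv_sqrt_smul hT hβ hε.continuousOn
  have hεc' : ContinuousOn (fun z : ℝ × Vec d => -(√(1 - alphaBar β z.1))⁻¹ • ε z.1 z.2)
      (Ioc 0 T ×ˢ univ) := by
    simp only [neg_smul]
    exact hεc.neg
  have hmain := hX.W2_le hT hβ hLε hLg
    (fun t ht x y => by
      rw [add_sub_add_comm, inner_add_right, add_mul]
      exact (abs_add_le _ _).trans (add_le_add (hε.neg_inv_sqrt_smul ht x y) (hg.lip t ht x y)))
    (hεc'.add hg.continuousOn) (M.measurable_cond2 h c₁ c₂) (M.cond2_nonneg hpos)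
  set f := M.cond2 h c₁ c₂ with hf
  set R : ℝ → Vec d → Vec d :=
    fun t x => (√(1 - alphaBar β t))⁻¹ • ε t x + M.score h c₁ (alphaBar β t) x with hR
  have hRc : ContinuousOn (fun z : ℝ × Vec d => R z.1 z.2) (Ioc 0 T ×ˢ univ) :=
    hεc.add (continuousOn_score hT hβ (M.measurable_cond1 h c₁) (M.cond1_nonneg h c₁))
  have hR2 : ContinuousOn (fun z : ℝ × Vec d => ‖R z.1 z.2‖ₑ ^ 2) (Ioc 0 T ×ˢ univ) :=
    (ENNReal.continuous_pow 2).comp_continuousOn hRc.enorm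
  have hRm := aemeasurable_lintegral_noisyLaw (f := f) (u := fun t x => ‖R t x‖ₑ ^ 2) hT hβ hR2
  have hβm : AEMeasurable (fun t => ENNReal.ofReal (β t / 2)) (volume.restrict (Ioc 0 T)) :=
    (((hβ.continuousOn.mono Ioc_subset_Icc_self).aemeasurable measurableSet_Ioc).div_const
      2).ennreal_ofReal
  have hβRm : AEMeasurable (fun t => ENNReal.ofReal (β t / 2) *
      ∫⁻ x, ‖R t x‖ₑ ^ 2 ∂(noisyLaw (alphaBar β t) f)) (volume.restrict (Ioc 0 T)) := hβm.mul hRm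
  have hV : (∫⁻ t in Ioc 0 T, ENNReal.ofReal (β t / 2) *
      ∫⁻ x, ‖-(√(1 - alphaBar β t))⁻¹ • ε t x + g t x -
        gradient (fun y => Real.log (noisyPdf (alphaBar β t) f y)) x‖ₑ ^ 2
          ∂(noisyLaw (alphaBar β t) f)) ≤
      2 * (M.errorScore h c₁ T β ε f + M.errorGuidance h c₁ c₂ T β g f) := by
    rw [DataModel.errorScore, DataModel.errorGuidance, half_lintegral_mul_eq,
      half_lintegral_mul_eq, ← lintegral_add_left' hβRm,
      ← lintegral_const_mul' _ _ (by finiteness)]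
    refine setLIntegral_mono' measurableSet_Ioc fun t ht => ?_
    have hRt : Measurable fun x => ‖R t x‖ₑ ^ 2 := by
      have hc : Continuous (R t) := continuous_of_continuousOn_prod hRc ht
      exact hc.enorm.measurable.pow_const 2
    rw [← mul_add, mul_left_comm, ← lintegral_add_left hRt,
      ← lintegral_const_mul' 2 _ (by finiteness)]
    refine mul_le_mul' le_rfl (lintegral_mono fun x => ?_)
    rw [M.gradient_log_noisyPdf_cond2 hpos (hβ.alphaBar_mem ht)]
    have e : -(√(1 - alphaBar β t))⁻¹ • ε t x + g t x -
        (M.score h c₁ (alphaBar β t) x + M.guidance h c₁ c₂ (alphaBar β t) x) =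
        (g t x - M.guidance h c₁ c₂ (alphaBar β t) x) - R t x := by
      simp only [hR]
      module
    rw [e, add_comm (‖R t x‖ₑ ^ 2)]
    exact enorm_sub_sq_le _ _
  refine hmain.trans ?_
  rw [mul_assoc]
  gcongr
  rw [mul_add, ← ENNReal.mul_rpow_of_nonneg _ _ (by norm_num)]
  gcongr
  -- Since √2 ≥ 1, the same factor may be put in front of the Wasserstein term.
  exact le_mul_of_one_le_left' (ENNReal.one_le_rpow one_le_two (by norm_num))

end

theorem theorem1 (T βmax Lε : ℝ) (hT : 0 < T) (hLε : 0 < Lε) :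
    -- choice 1: inexpensive simulation only
    (∃ C : ℝ≥0, ∀ (d s k₁ k₂ : ℕ) (β : ℝ → ℝ), IsSchedule T βmax β →
      ∀ (M : DataModel d s k₁ k₂) (ε : History s d → Vec k₁ → ℝ → Vec d → Vec d),
        (∀ h c₁, IsRegularField T Lε (ε h c₁)) →
      ∀ (h : History s d) (c₁ : Vec k₁), HasSecondMoment (M.cond1 h c₁) →
      ∀ (Ω : Type*) [MeasurableSpace Ω] (P : Measure Ω) (X : ℝ → Ω → Vec d),
        IsSampler P T (drift1 β (ε h c₁)) X →
        W2 (pdfLaw (M.cond1 h c₁)) (P.map (X 0)) ≤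
          C * ((M.errorScore h c₁ T β (ε h c₁) (M.cond1 h c₁)) ^ (1 / 2 : ℝ) +
            W2 (noisyLaw (alphaBar β T) (M.cond1 h c₁)) (stdGaussian (Vec d)))) ∧
    -- choice 2: guidance by the expensive simulation
    (∀ Lg : ℝ, 0 < Lg →
      ∃ C : ℝ≥0, ∀ (d s k₁ k₂ : ℕ) (β : ℝ → ℝ), IsSchedule T βmax β →
      ∀ (M : DataModel d s k₁ k₂) (ε : History s d → Vec k₁ → ℝ → Vec d → Vec d)
        (g : History s d → Vec k₁ → Vec k₂ → ℝ → Vec d → Vec d),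
        (∀ h c₁, IsRegularField T Lε (ε h c₁)) →
        (∀ h c₁ c₂, IsRegularField T Lg (g h c₁ c₂)) →
      ∀ (h : History s d) (c₁ : Vec k₁) (c₂ : Vec k₂),
        0 < M.evidence h c₁ c₂ → HasSecondMoment (M.cond2 h c₁ c₂) →
      ∀ (Ω : Type*) [MeasurableSpace Ω] (P : Measure Ω) (X : ℝ → Ω → Vec d),
        IsSampler P T (drift2 β (ε h c₁) (g h c₁ c₂)) X →
        W2 (pdfLaw (M.cond2 h c₁ c₂)) (P.map (X 0)) ≤
          C * ((M.errorScore h c₁ T β (ε h c₁) (M.cond2 h c₁ c₂) +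
              M.errorGuidance h c₁ c₂ T β (g h c₁ c₂) (M.cond2 h c₁ c₂)) ^ (1 / 2 : ℝ) +
            W2 (noisyLaw (alphaBar β T) (M.cond2 h c₁ c₂)) (stdGaussian (Vec d)))) := by
  have hc : ∀ Lg, stabilityConst T βmax Lε Lg ^ (1 / 2 : ℝ) ≠ ∞ := fun Lg =>
    ENNReal.rpow_ne_top_of_nonneg (by norm_num) (stabilityConst_ne_top _ _ _ _)
  refine ⟨⟨(stabilityConst T βmax Lε 0 ^ (1 / 2 : ℝ)).toNNReal, ?_⟩, fun Lg hLg =>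
    ⟨(stabilityConst T βmax Lε Lg ^ (1 / 2 : ℝ) * 2 ^ (1 / 2 : ℝ)).toNNReal, ?_⟩⟩
  · intro d s k₁ k₂ β hβ M ε hε h c₁ _ Ω _ P X hX
    rw [ENNReal.coe_toNNReal (hc 0)]
    exact W2_cond1_le hT hLε.le hβ M (hε h c₁) h c₁ hX
  · intro d s k₁ k₂ β hβ M ε g hε hg h c₁ c₂ hpos _ Ω _ P X hX
    rw [ENNReal.coe_toNNReal (ENNReal.mul_ne_top (hc Lg)
      (ENNReal.rpow_ne_top_of_nonneg (by norm_num) ENNReal.ofNat_ne_top))]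
    exact W2_cond2_le hT hLε.le hLg.le hβ M (hε h c₁) (hg h c₁ c₂) hpos hX
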